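/- Fix $\gamma\in\mathbb R$. For $Y=(\zeta,U,H,v,w,h)$, a sextuple of real functions on $\mathbb R$, put $y(\xi)=\xi+\zeta(\xi)$, $q=1+v$. Let $F=L^\infty\times(L^2\cap L^\infty)\times L^\infty\times L^2\times L^2\times L^2$ with norm $$\|Y\|_F=\|\zeta\|_{L^\infty}+\|U\|_{L^2}+\|U\|_{L^\infty}+\|H\|_{L^\infty}+\|v\|_{L^2}+\|w\|_{L^2}+\|h\|_{L^2}.$$ Let $F^e$ and, for $\alpha>1$, $F^\alpha$ be the sets of $Y\in F$ for which, respectively, the following quantities are finite: $$\|Y\|_{F^e}=\|Y\|_F+\|q\|_{L^\infty}+\|w\|_{L^\infty}+\|h\|_{L^\infty}+\|e^{|\xi|/2}U\|_{L^2}+\|e^{|\xi|/2}w\|_{L^2}+\|e^{|\xi|}h\|_{L^1},$$ $$\|Y\|_{F^\alpha}=\|Y\|_F+\|q\|_{L^\infty}+\|w\|_{L^\infty}+\|h\|_{L^\infty}+\|(1+|\xi|)^{\alpha/2}U\|_{L^2}+\|(1+|\xi|)^{\alpha/2}w\|_{L^2}+\|(1+|\xi|)^{\alpha}h\|_{L^1}.$$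 Let $\mathcal G$ be the set of $Y\in F$ such that $q,w,h\in L^\infty$; $y,U,H$ are locally absolutely continuous with $y_\xi=q$, $U_\xi=w$, $H_\xi=h$; and almost everywhere $qh=U^2q^2+w^2$, $q\ge0$, $h\ge0$, $q+h\ge c$ for some constant $c>0$. Consider the system $$\zeta_t=\gamma U,\quad U_t=-Q,\quad H_t=U^3-2PU,\quad v_t=\gamma w,$$ $$w_t=\tfrac{\gamma}{2}h+\bigl(\tfrac{3-2\gamma}{2}U^2-P\bigr)q,\quad h_t=-2QUq+(3U^2-2P)w,\qquad(1)$$ where $$P(Y)(\xi)=\tfrac12\int_{\mathbb R}e^{-\operatorname{sgn}(\xi-\eta)(y(\xi)-y(\eta))}\bigl(\tfrac{3-2\gamma}{2}U^2q+\tfrac{\gamma}{2}h\bigr)(\eta)\,d\eta,$$ $$Q(Y)(\xi)=-\tfrac12\int_{\mathbb R}\operatorname{sgn}(\xi-\eta)e^{-\operatorname{sgn}(\xi-\eta)(y(\xi)-y(\eta))}\bigl(\tfrac{3-2\gamma}{2}U^2q+\tfrac{\gamma}{2}h\bigr)(\eta)\,d\eta.$$ For $\Delta\xi>0$ and an integer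 $N\ge1$ let $\xi_i=i\Delta\xi$, $R=N\Delta\xi$. Let $F_{\{\Delta\xi,R\}}$ be the set of $Y\in F$ all of whose components are constant on each $[\xi_i,\xi_{i+1})$, $i\in\mathbb Z$, such that $U,v,w,h$ vanish outside $[-R,R)$, $\zeta$ and $H$ are constant on $[R,\infty)$, $\zeta$ is constant on $(-\infty,-R)$ and $H=0$ on $(-\infty,-R)$. The discretised, truncated system $(1)_{\Delta\xi,R}$ is (1) with $P$ and $Q$ replaced by $$\sum_{i=-N}^{N-1}P(Y)(\xi_i)\chi_{[\xi_i,\xi_{i+1})}\quad\text{and}\quad\sum_{i=-N}^{N-1}Q(Y)(\xi_i)\chi_{[\xi_i,\xi_{i+1})}.$$ A solution on $[0,T]$ is one in $C^1([0,T],F)$; solutions of $(1)_{\Delta\xi,R}$ are taken with values in $F_{\{\Delta\xi,R\}}$. **Theorem.** Let $T>0$. (i) For every $K\ge0$ there are constants $C\ge 0$, $\delta>0$ and an integer $n\ge1$, depending only on $K$, $T$ (and $\gamma$), such that for every $Y_0\in\mathcal G\cap F^e$ with $\|Y_0\|_{F^e}\le K$ the following holds. The system (1) has a solution on $[0,T]$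 with initial data $Y_0$. If $Y$ is such a solution, $\Delta\xi+\frac1R\le\frac1n$, and $Y_{0,\Delta\xi,R}\in F_{\{\Delta\xi,R\}}$ satisfies $\|Y_0-Y_{0,\Delta\xi,R}\|_F\le\delta$, then $(1)_{\Delta\xi,R}$ has a solution on $[0,T]$ with initial data $Y_{0,\Delta\xi,R}$, and every such solution $Y_{\{\Delta\xi,R\}}$ satisfies $$\sup_{t\in[0,T]}\|Y(t,\cdot)-Y_{\{\Delta\xi,R\}}(t,\cdot)\|_F\le C\bigl(\|Y_0-Y_{0,\Delta\xi,R}\|_F+\sqrt{\Delta\xi}+e^{-R}\bigr).$$ (ii) For every $\alpha>1$ the same holds with $F^e$ replaced by $F^\alpha$, $e^{-R}$ replaced by $R^{-\alpha/2}$, and constants that may also depend on $\alpha$. -/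

import Mathlib

open MeasureTheory Filter Topology Set
open scoped ENNReal NNReal

noncomputable section

namespace HyperelasticRod

/-- A sextuple `(ζ, U, H, v, w, h)` of real functions on the line. -/
@[ext]
structure State where
  ζ : ℝ → ℝ
  U : ℝ → ℝ
  H : ℝ → ℝ
  v : ℝ → ℝ
  w : ℝ → ℝ
  h : ℝ → ℝ

namespace State

/-- The physical variable `y(ξ) = ξ + ζ(ξ)`. -/
def y (Y : State) (ξ : ℝ) : ℝ := ξ + Y.ζ ξ

/-- The physical variable `q(ξ) = 1 + v(ξ)`. -/
def q (Y : State) (ξ : ℝ) : ℝ := 1 + Y.v ξ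

instance : Sub State where
  sub Y Z := ⟨Y.ζ - Z.ζ, Y.U - Z.U, Y.H - Z.H, Y.v - Z.v, Y.w - Z.w, Y.h - Z.h⟩

instance : SMul ℝ State where
  smul c Y := ⟨c • Y.ζ, c • Y.U, c • Y.H, c • Y.v, c • Y.w, c • Y.h⟩

end State

/-! ### The spaces -/

/-- The norm of `F`, with value `∞` where it is not finite. -/
def normF (Y : State) : ℝ≥0∞ :=
  eLpNorm Y.ζ ∞ volume + eLpNorm Y.U 2 volume + eLpNorm Y.U ∞ volume + eLpNorm Y.H ∞ volume
    + eLpNorm Y.v 2 volume + eLpNorm Y.w 2 volume + eLpNorm Y.h 2 volume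

/-- `F = L^∞ × (L² ∩ L^∞) × L^∞ × L² × L² × L²`; its elements are represented by functions. -/
structure MemF (Y : State) : Prop where
  memLp_ζ : MemLp Y.ζ ∞ volume
  memLp_two_U : MemLp Y.U 2 volume
  memLp_top_U : MemLp Y.U ∞ volume
  memLp_H : MemLp Y.H ∞ volume
  memLp_v : MemLp Y.v 2 volume
  memLp_w : MemLp Y.w 2 volume
  memLp_h : MemLp Y.h 2 volume

/-- The norm of `F^e` (exponential decay). -/
def normFexp (Y : State) : ℝ≥0∞ :=
  normF Y + eLpNorm Y.q ∞ volume + eLpNorm Y.w ∞ volume + eLpNorm Y.h ∞ volume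
    + eLpNorm (fun ξ => Real.exp (|ξ| / 2) * Y.U ξ) 2 volume
    + eLpNorm (fun ξ => Real.exp (|ξ| / 2) * Y.w ξ) 2 volume
    + eLpNorm (fun ξ => Real.exp |ξ| * Y.h ξ) 1 volume

/-- The norm of `F^α` (polynomial decay). -/
def normFpol (α : ℝ) (Y : State) : ℝ≥0∞ :=
  normF Y + eLpNorm Y.q ∞ volume + eLpNorm Y.w ∞ volume + eLpNorm Y.h ∞ volume
    + eLpNorm (fun ξ => (1 + |ξ|) ^ (α / 2) * Y.U ξ) 2 volume
    + eLpNorm (fun ξ => (1 + |ξ|) ^ (α / 2) * Y.w ξ) 2 volume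
    + eLpNorm (fun ξ => (1 + |ξ|) ^ α * Y.h ξ) 1 volume

/-- The space `F^e`. -/
def MemFexp (Y : State) : Prop := MemF Y ∧ normFexp Y < ∞

/-- The space `F^α`. -/
def MemFpol (α : ℝ) (Y : State) : Prop := MemF Y ∧ normFpol α Y < ∞

/-- The set `𝒢` of admissible Lagrangian data. Since `q, w, h` are bounded, the relations
`y_ξ = q`, `U_ξ = w`, `H_ξ = h` are those of Lipschitz functions (classical derivatives almost
everywhere), expressed through the fundamental theorem of calculus. -/
structure MemG (Y : State) : Prop where
  memF : MemF Y
  memLp_q : MemLp Y.q ∞ volume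
  memLp_w : MemLp Y.w ∞ volume
  memLp_h : MemLp Y.h ∞ volume
  invariant : ∀ᵐ ξ, Y.q ξ * Y.h ξ = Y.U ξ ^ 2 * Y.q ξ ^ 2 + Y.w ξ ^ 2
  q_nonneg : ∀ᵐ ξ, 0 ≤ Y.q ξ
  h_nonneg : ∀ᵐ ξ, 0 ≤ Y.h ξ
  lower_bound : ∃ c : ℝ, 0 < c ∧ ∀ᵐ ξ, c ≤ Y.q ξ + Y.h ξ
  deriv_y : ∀ a b : ℝ, ∫ ξ in a..b, Y.q ξ = Y.y b - Y.y a
  deriv_U : ∀ a b : ℝ, ∫ ξ in a..b, Y.w ξ = Y.U b - Y.U a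
  deriv_H : ∀ a b : ℝ, ∫ ξ in a..b, Y.h ξ = Y.H b - Y.H a

/-- `f` is constant on every cell `[ξ_i, ξ_{i+1})` of the grid `ξ_i = i Δξ`. -/
def IsStep (Δξ : ℝ) (f : ℝ → ℝ) : Prop :=
  ∀ i : ℤ, ∀ ξ ∈ Ico (i * Δξ) ((i + 1) * Δξ), f ξ = f (i * Δξ)

/-- The space `F_{Δξ}` of grid functions in `F`. -/
structure MemFgrid (Δξ : ℝ) (Y : State) : Prop where
  memF : MemF Y
  step_ζ : IsStep Δξ Y.ζ
  step_U : IsStep Δξ Y.U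
  step_H : IsStep Δξ Y.H
  step_v : IsStep Δξ Y.v
  step_w : IsStep Δξ Y.w
  step_h : IsStep Δξ Y.h

/-- The space `F_R`: `U, v, w, h` vanish outside `[-R, R)`, where `ζ` and `H` are constant on
either side, `H` being zero on the left. -/
structure MemFcut (R : ℝ) (Y : State) : Prop where
  memF : MemF Y
  vanish : ∀ ξ, ξ < -R ∨ R ≤ ξ → Y.U ξ = 0 ∧ Y.v ξ = 0 ∧ Y.w ξ = 0 ∧ Y.h ξ = 0
  right : ∃ ζr Hr : ℝ, ∀ ξ, R ≤ ξ → Y.ζ ξ = ζr ∧ Y.H ξ = Hr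
  left : ∃ ζl : ℝ, ∀ ξ, ξ < -R → Y.ζ ξ = ζl ∧ Y.H ξ = 0

/-- The finite-dimensional space `F_{Δξ,R} = F_{Δξ} ∩ F_R` with `R = N Δξ`. -/
def MemFdisc (Δξ : ℝ) (N : ℕ) (Y : State) : Prop :=
  MemFgrid Δξ Y ∧ MemFcut (N * Δξ) Y

/-! ### The systems of differential equations -/

/-- The density `(3 - 2γ)/2 U² q + γ/2 h`. -/
def source (γ : ℝ) (Y : State) (η : ℝ) : ℝ :=
  (3 - 2 * γ) / 2 * Y.U η ^ 2 * Y.q η + γ / 2 * Y.h η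

def P (γ : ℝ) (Y : State) (ξ : ℝ) : ℝ :=
  1 / 2 * ∫ η, Real.exp (-(Real.sign (ξ - η) * (Y.y ξ - Y.y η))) * source γ Y η

def Q (γ : ℝ) (Y : State) (ξ : ℝ) : ℝ :=
  -(1 / 2) * ∫ η, Real.sign (ξ - η) *
    Real.exp (-(Real.sign (ξ - η) * (Y.y ξ - Y.y η))) * source γ Y η

/-- `∑_{i=-N}^{N-1} f(ξ_i) χ_{[ξ_i, ξ_{i+1})}` with `ξ_i = i Δξ`. -/
def sampleCut (Δξ : ℝ) (N : ℕ) (f : ℝ → ℝ) (ξ : ℝ) : ℝ :=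
  ∑ i ∈ Finset.Ico (-(N : ℤ)) (N : ℤ),
    (Ico ((i : ℝ) * Δξ) (((i : ℝ) + 1) * Δξ)).indicator (fun _ => f (i * Δξ)) ξ

/-- The common form of the right-hand sides, for given functions `p` and `r` in the places of
`P` and `Q`. -/
def rhs (γ : ℝ) (p r : ℝ → ℝ) (Y : State) : State where
  ζ ξ := γ * Y.U ξ
  U ξ := -r ξ
  H ξ := Y.U ξ ^ 3 - 2 * p ξ * Y.U ξ
  v ξ := γ * Y.w ξ
  w ξ := γ / 2 * Y.h ξ + ((3 - 2 * γ) / 2 * Y.U ξ ^ 2 - p ξ) * Y.q ξ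
  h ξ := -2 * r ξ * Y.U ξ * Y.q ξ + (3 * Y.U ξ ^ 2 - 2 * p ξ) * Y.w ξ

/-- The vector field `G` of the exact system. -/
def G (γ : ℝ) (Y : State) : State := rhs γ (P γ Y) (Q γ Y) Y

/-- The vector field `G_{Δξ,R}`, `R = N Δξ`, of the discretised and truncated system. -/
def Gdisc (γ Δξ : ℝ) (N : ℕ) (Y : State) : State :=
  rhs γ (sampleCut Δξ N (P γ Y)) (sampleCut Δξ N (Q γ Y)) Y

/-- `Y ∈ C¹([0,T], F)` solves `Y_t = 𝒱(Y)`, `Y(0) = Y₀`; derivative and continuity are those of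
the norm of `F`, one-sided at the end points. -/
structure IsSolution (𝒱 : State → State) (T : ℝ) (Y₀ : State) (Y : ℝ → State) : Prop where
  init : Y 0 = Y₀
  memF : ∀ t ∈ Icc 0 T, MemF (Y t)
  hasDeriv : ∀ t ∈ Icc 0 T,
    Tendsto (fun s => normF ((s - t)⁻¹ • (Y s - Y t) - 𝒱 (Y t))) (𝓝[Icc 0 T \ {t}] t) (𝓝 0)
  contDeriv : ∀ t ∈ Icc 0 T,
    Tendsto (fun s => normF (𝒱 (Y s) - 𝒱 (Y t))) (𝓝[Icc 0 T] t) (𝓝 0)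

/-- `Y` is the solution on `[0,T]` of the exact system with initial data `Y₀`. -/
def IsExactSolution (γ T : ℝ) (Y₀ : State) (Y : ℝ → State) : Prop :=
  IsSolution (G γ) T Y₀ Y

/-- `Z` is the solution on `[0,T]`, with values in `F_{Δξ,R}`, of the discretised and truncated
system with initial data `Z₀`. -/
def IsDiscreteSolution (γ Δξ : ℝ) (N : ℕ) (T : ℝ) (Z₀ : State) (Z : ℝ → State) : Prop :=
  IsSolution (Gdisc γ Δξ N) T Z₀ Z ∧ ∀ t ∈ Icc 0 T, MemFdisc Δξ N (Z t)

end HyperelasticRod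

end

open MeasureTheory Filter Topology Set
open scoped ENNReal NNReal

noncomputable section

namespace HyperelasticRod

/-! ### Linear structure on states -/

namespace State

/-! Both systems are ordinary differential equations in `F`, and the theorem has the form "stability
plus consistency implies convergence". The kernel of `P` and `Q` is `e^{-|ξ-η|}` times a factor
controlled by the sup norm of `ζ`. Young's inequality and Cauchy–Schwarz therefore make both
potentials, and with them `G`, Lipschitz on bounded sets of `F` (`G_sub_bnd`). Grönwall's inequality
then turns a bound for `G(Y) - Gdisc(Z)` into a bound for `Y - Z` (`IsSolution.nF_sub_le`).

The consistency error (`normF_G_sub_Gdisc_le`) has two sources. Freezing a potential at the left end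
of a cell changes the kernel by a relative error of order `Δξ`, except for `η` in the cell itself,
where a bounded error lives on a set of length `Δξ`. The L² norm of that indicator is `√Δξ`, which
is the rate in the theorem. Cutting off discards `P(Y)` and `Q(Y)` outside `[-R, R)`, so only the
exact solution has to decay.

The discrete solution needs no a priori estimate of its own: as long as it is within distance 1 of
the exact one, it lies in a fixed ball, and there the Grönwall bound keeps the distance below 1/2.
This closes the bootstrap and also gives existence up to time `T`; `exists_error_estimate` assembles
the argument.

What remains is to bound the exact solution and its potentials. The relations of `𝒢` are preserved
(`SupSol.adm`). They give `U² q ≤ h` and `2|U w| ≤ h`, and they make `y` increasing, so that `U²`,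
`P` and `Q` are bounded in terms of `∫ h`, which does not grow. Then `v, w, h` solve a linear system
with bounded coefficients (`exists_apriori`). Decay comes from a comparison principle for the energy
density `U² + h`, applied twice (`exists_energy_le`): first linearly, with a weaker weight `σ`, then
using that `P² + Q²` is quadratic, so that one factor already decays.

To make all these arguments pointwise in `ξ`, the exact solution is first constructed among
functions bounded everywhere, in the closed subspace where `y_ξ = q`, `U_ξ = w`, `H_ξ = h`
(`exists_supSol`). An L² majorant and dominated convergence transfer it to `F`
(`SupSol.isSolution`), and initial data given only up to null sets are replaced by a good
representative (`MemG.exists_initData`). -/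

instance : Zero State := ⟨⟨0, 0, 0, 0, 0, 0⟩⟩

instance : Add State where
  add Y Z := ⟨Y.ζ + Z.ζ, Y.U + Z.U, Y.H + Z.H, Y.v + Z.v, Y.w + Z.w, Y.h + Z.h⟩

instance : Neg State where
  neg Y := ⟨-Y.ζ, -Y.U, -Y.H, -Y.v, -Y.w, -Y.h⟩

@[simp] lemma zero_ζ : (0 : State).ζ = 0 := rfl
@[simp] lemma zero_U : (0 : State).U = 0 := rfl
@[simp] lemma zero_H : (0 : State).H = 0 := rfl
@[simp] lemma zero_v : (0 : State).v = 0 := rfl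
@[simp] lemma zero_w : (0 : State).w = 0 := rfl
@[simp] lemma zero_h : (0 : State).h = 0 := rfl
@[simp] lemma add_ζ (Y Z : State) : (Y + Z).ζ = Y.ζ + Z.ζ := rfl
@[simp] lemma add_U (Y Z : State) : (Y + Z).U = Y.U + Z.U := rfl
@[simp] lemma add_H (Y Z : State) : (Y + Z).H = Y.H + Z.H := rfl
@[simp] lemma add_v (Y Z : State) : (Y + Z).v = Y.v + Z.v := rfl
@[simp] lemma add_w (Y Z : State) : (Y + Z).w = Y.w + Z.w := rfl
@[simp] lemma add_h (Y Z : State) : (Y + Z).h = Y.h + Z.h := rfl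
@[simp] lemma neg_ζ (Y : State) : (-Y).ζ = -Y.ζ := rfl
@[simp] lemma neg_U (Y : State) : (-Y).U = -Y.U := rfl
@[simp] lemma neg_H (Y : State) : (-Y).H = -Y.H := rfl
@[simp] lemma neg_v (Y : State) : (-Y).v = -Y.v := rfl
@[simp] lemma neg_w (Y : State) : (-Y).w = -Y.w := rfl
@[simp] lemma neg_h (Y : State) : (-Y).h = -Y.h := rfl
@[simp] lemma sub_ζ (Y Z : State) : (Y - Z).ζ = Y.ζ - Z.ζ := rfl
@[simp] lemma sub_U (Y Z : State) : (Y - Z).U = Y.U - Z.U := rfl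
@[simp] lemma sub_H (Y Z : State) : (Y - Z).H = Y.H - Z.H := rfl
@[simp] lemma sub_v (Y Z : State) : (Y - Z).v = Y.v - Z.v := rfl
@[simp] lemma sub_w (Y Z : State) : (Y - Z).w = Y.w - Z.w := rfl
@[simp] lemma sub_h (Y Z : State) : (Y - Z).h = Y.h - Z.h := rfl
@[simp] lemma smul_ζ (c : ℝ) (Y : State) : (c • Y).ζ = c • Y.ζ := rfl
@[simp] lemma smul_U (c : ℝ) (Y : State) : (c • Y).U = c • Y.U := rfl
@[simp] lemma smul_H (c : ℝ) (Y : State) : (c • Y).H = c • Y.H := rfl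
@[simp] lemma smul_v (c : ℝ) (Y : State) : (c • Y).v = c • Y.v := rfl
@[simp] lemma smul_w (c : ℝ) (Y : State) : (c • Y).w = c • Y.w := rfl
@[simp] lemma smul_h (c : ℝ) (Y : State) : (c • Y).h = c • Y.h := rfl

instance : AddCommGroup State where
  add_assoc _ _ _ := by ext <;> simp [add_assoc]
  zero_add _ := by ext <;> simp
  add_zero _ := by ext <;> simp
  nsmul := nsmulRec
  zsmul := zsmulRec
  neg_add_cancel _ := by ext <;> simp
  add_comm _ _ := by ext <;> simp [add_comm]
  sub_eq_add_neg _ _ := by ext <;> simp [sub_eq_add_neg]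

instance : Module ℝ State where
  one_smul _ := by ext <;> simp
  mul_smul _ _ _ := by ext <;> simp [mul_assoc]
  smul_zero _ := by ext <;> simp
  smul_add _ _ _ := by ext <;> simp [mul_add]
  add_smul _ _ _ := by ext <;> simp [add_mul]
  zero_smul _ := by ext <;> simp

end State

/-! ### Norm bounds for functions -/

/-- `f` is measurable and bounded everywhere by `c`. -/
def SupLe (f : ℝ → ℝ) (c : ℝ) : Prop := Measurable f ∧ ∀ ξ, |f ξ| ≤ c

/-- `f` is measurable and bounded almost everywhere by `c`. -/
def EssLe (f : ℝ → ℝ) (c : ℝ) : Prop :=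
  AEStronglyMeasurable f volume ∧ ∀ᵐ ξ, |f ξ| ≤ c

/-- `f` is measurable with `L²` norm at most `c`. -/
def L2Le (f : ℝ → ℝ) (c : ℝ) : Prop :=
  AEStronglyMeasurable f volume ∧ 0 ≤ c ∧ eLpNorm f 2 volume ≤ ENNReal.ofReal c

/-- Two notions `S` and `N` of boundedness of functions, such that `S`-bounded functions form
an algebra which acts on the `N`-bounded functions. -/
structure NormPair (S N : (ℝ → ℝ) → ℝ → Prop) : Prop where
  S_nonneg : ∀ {f c}, S f c → 0 ≤ c
  S_mono : ∀ {f c d}, S f c → c ≤ d → S f d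
  N_mono : ∀ {f c d}, N f c → c ≤ d → N f d
  S_add : ∀ {f g c d}, S f c → S g d → S (fun x => f x + g x) (c + d)
  N_add : ∀ {f g c d}, N f c → N g d → N (fun x => f x + g x) (c + d)
  S_mul : ∀ {f g c d}, S f c → S g d → S (fun x => f x * g x) (c * d)
  N_mul : ∀ {f g c d}, S f c → N g d → N (fun x => f x * g x) (c * d)
  S_const : ∀ a : ℝ, S (fun _ => a) |a|
  N_zero : N (fun _ => 0) 0

lemma SupLe.nonneg {f : ℝ → ℝ} {c : ℝ} (h : SupLe f c) : 0 ≤ c := (abs_nonneg _).trans (h.2 0)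

lemma EssLe.nonneg {f : ℝ → ℝ} {c : ℝ} (h : EssLe f c) : 0 ≤ c := by
  obtain ⟨x, hx⟩ := h.2.exists
  exact (abs_nonneg _).trans hx

lemma SupLe.essLe {f : ℝ → ℝ} {c : ℝ} (h : SupLe f c) : EssLe f c :=
  ⟨h.1.aestronglyMeasurable, ae_of_all _ h.2⟩

lemma L2Le.memLp {f : ℝ → ℝ} {c : ℝ} (h : L2Le f c) : MemLp f 2 volume :=
  ⟨h.1, h.2.2.trans_lt ENNReal.ofReal_lt_top⟩

lemma EssLe.memLp {f : ℝ → ℝ} {c : ℝ} (h : EssLe f c) : MemLp f ∞ volume :=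
  memLp_top_of_bound h.1 c (by simpa [Real.norm_eq_abs] using h.2)

lemma EssLe.eLpNorm_le {f : ℝ → ℝ} {c : ℝ} (h : EssLe f c) :
    eLpNorm f ∞ volume ≤ ENNReal.ofReal c := by
  have := eLpNorm_le_of_ae_bound (p := ∞) (μ := volume) (f := f) (C := c)
    (by simpa [Real.norm_eq_abs] using h.2)
  simpa using this

lemma essLe_of_eLpNorm_le {f : ℝ → ℝ} {c : ℝ} (hc : 0 ≤ c) (hf : AEStronglyMeasurable f volume)
    (h : eLpNorm f ∞ volume ≤ ENNReal.ofReal c) : EssLe f c := by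
  refine ⟨hf, ?_⟩
  rw [eLpNorm_exponent_top] at h
  filter_upwards [ae_le_eLpNormEssSup (f := f) (μ := volume)] with x hx
  have := hx.trans h
  rw [Real.enorm_eq_ofReal_abs] at this
  exact (ENNReal.ofReal_le_ofReal_iff hc).1 this

lemma EssLe.mul_l2Le {f g : ℝ → ℝ} {c d : ℝ} (hf : EssLe f c) (hg : L2Le g d) :
    L2Le (fun x => f x * g x) (c * d) := by
  refine ⟨hf.1.mul hg.1, mul_nonneg hf.nonneg hg.2.1, ?_⟩
  have h1 : eLpNorm (fun x => f x * g x) 2 volume ≤ ENNReal.ofReal c * eLpNorm g 2 volume := by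
    have := eLpNorm_le_mul_eLpNorm_of_ae_le_mul (μ := volume) (f := fun x => f x * g x) (g := g)
      (c := c) (by
        filter_upwards [hf.2] with x hx
        rw [norm_mul]
        exact mul_le_mul_of_nonneg_right hx (norm_nonneg _)) 2
    exact this
  rw [ENNReal.ofReal_mul hf.nonneg]
  exact h1.trans (mul_le_mul_right hg.2.2 _)

lemma normPair_sup : NormPair SupLe SupLe where
  S_nonneg h := h.nonneg
  S_mono h hcd := ⟨h.1, fun x => (h.2 x).trans hcd⟩
  N_mono h hcd := ⟨h.1, fun x => (h.2 x).trans hcd⟩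
  S_add h h' := ⟨h.1.add h'.1, fun x => (abs_add_le _ _).trans (add_le_add (h.2 x) (h'.2 x))⟩
  N_add h h' := ⟨h.1.add h'.1, fun x => (abs_add_le _ _).trans (add_le_add (h.2 x) (h'.2 x))⟩
  S_mul h h' := ⟨h.1.mul h'.1, fun x => by
    rw [abs_mul]; exact mul_le_mul (h.2 x) (h'.2 x) (abs_nonneg _) h.nonneg⟩
  N_mul h h' := ⟨h.1.mul h'.1, fun x => by
    rw [abs_mul]; exact mul_le_mul (h.2 x) (h'.2 x) (abs_nonneg _) h.nonneg⟩
  S_const a := ⟨measurable_const, fun _ => le_rfl⟩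
  N_zero := ⟨measurable_const, fun _ => by simp⟩

lemma normPair_essSup_l2 : NormPair EssLe L2Le where
  S_nonneg h := h.nonneg
  S_mono h hcd := ⟨h.1, h.2.mono fun _ hx => hx.trans hcd⟩
  N_mono h hcd := ⟨h.1, h.2.1.trans hcd, h.2.2.trans (ENNReal.ofReal_le_ofReal hcd)⟩
  S_add h h' := ⟨h.1.add h'.1, by
    filter_upwards [h.2, h'.2] with x hx hx'
    exact (abs_add_le _ _).trans (add_le_add hx hx')⟩
  N_add h h' := ⟨h.1.add h'.1, add_nonneg h.2.1 h'.2.1, by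
    rw [ENNReal.ofReal_add h.2.1 h'.2.1]
    exact (eLpNorm_add_le h.1 h'.1 one_le_two).trans (add_le_add h.2.2 h'.2.2)⟩
  S_mul h h' := ⟨h.1.mul h'.1, by
    filter_upwards [h.2, h'.2] with x hx hx'
    rw [abs_mul]; exact mul_le_mul hx hx' (abs_nonneg _) h.nonneg⟩
  N_mul h h' := h.mul_l2Le h'
  S_const a := ⟨aestronglyMeasurable_const, ae_of_all _ fun _ => le_rfl⟩
  N_zero := ⟨aestronglyMeasurable_const, le_rfl, by simp⟩

namespace NormPair

variable {S N : (ℝ → ℝ) → ℝ → Prop} {f g : ℝ → ℝ} {c d : ℝ}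

lemma S_smul (hp : NormPair S N) (a : ℝ) (hf : S f c) : S (fun x => a * f x) (|a| * c) :=
  hp.S_mul (hp.S_const a) hf

lemma N_smul (hp : NormPair S N) (a : ℝ) (hf : N f c) : N (fun x => a * f x) (|a| * c) :=
  hp.N_mul (hp.S_const a) hf

end NormPair

/-- All components of `Y` are bounded by `M`; `N` refers to the components which lie in `L²`. -/
structure Bnd (S N : (ℝ → ℝ) → ℝ → Prop) (M : ℝ) (Y : State) : Prop where
  ζ : S Y.ζ M
  U : S Y.U M
  U' : N Y.U M
  H : S Y.H M
  v : N Y.v M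
  w : N Y.w M
  h : N Y.h M

/-- `f` is bounded by `M` in both senses. -/
structure Bnd₂ (S N : (ℝ → ℝ) → ℝ → Prop) (M : ℝ) (f : ℝ → ℝ) : Prop where
  S : S f M
  N : N f M

/-- Boundedness in `F`. -/
abbrev FBnd : ℝ → State → Prop := Bnd EssLe L2Le

/-- Boundedness everywhere. -/
abbrev SupBnd : ℝ → State → Prop := Bnd SupLe SupLe

/-! ### Lipschitz bounds for the algebraic part of the system -/

section Lipschitz

variable {S N : (ℝ → ℝ) → ℝ → Prop} {γ M d B e c : ℝ} {X Z : State}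

lemma Bnd.nonneg (hp : NormPair S N) (hX : Bnd S N M X) : 0 ≤ M := hp.S_nonneg hX.U

lemma Bnd.mono (hp : NormPair S N) (hX : Bnd S N M X) (h : M ≤ c) : Bnd S N c X :=
  ⟨hp.S_mono hX.ζ h, hp.S_mono hX.U h, hp.N_mono hX.U' h, hp.S_mono hX.H h, hp.N_mono hX.v h,
    hp.N_mono hX.w h, hp.N_mono hX.h h⟩

lemma Bnd₂.mono (hp : NormPair S N) {f : ℝ → ℝ} (hX : Bnd₂ S N M f) (h : M ≤ c) : Bnd₂ S N c f :=
  ⟨hp.S_mono hX.S h, hp.N_mono hX.N h⟩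

lemma Bnd.add (hp : NormPair S N) (hX : Bnd S N M X) (hZ : Bnd S N d Z) :
    Bnd S N (M + d) (X + Z) :=
  ⟨hp.S_add hX.ζ hZ.ζ, hp.S_add hX.U hZ.U, hp.N_add hX.U' hZ.U', hp.S_add hX.H hZ.H,
    hp.N_add hX.v hZ.v, hp.N_add hX.w hZ.w, hp.N_add hX.h hZ.h⟩

lemma Bnd.smul (hp : NormPair S N) (hX : Bnd S N M X) (a : ℝ) : Bnd S N (|a| * M) (a • X) :=
  ⟨hp.S_smul a hX.ζ, hp.S_smul a hX.U, hp.N_smul a hX.U', hp.S_smul a hX.H, hp.N_smul a hX.v,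
    hp.N_smul a hX.w, hp.N_smul a hX.h⟩

lemma Bnd.sub (hp : NormPair S N) (hX : Bnd S N M X) (hZ : Bnd S N d Z) :
    Bnd S N (M + d) (X - Z) := by
  have h := hX.add hp (hZ.smul hp (-1))
  have e : X + (-1 : ℝ) • Z = X - Z := by module
  rw [e] at h
  simpa using h

lemma Bnd.sub_comm (hp : NormPair S N) (hX : Bnd S N M (X - Z)) : Bnd S N M (Z - X) := by
  have h := hX.smul hp (-1)
  have e : (-1 : ℝ) • (X - Z) = Z - X := by module
  simpa [e] using h

lemma Bnd.zero (hp : NormPair S N) (h : 0 ≤ M) : Bnd S N M 0 := by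
  have h1 : S (fun _ => 0) M := hp.S_mono (hp.S_const 0) (by simpa)
  have h2 : N (fun _ => 0) M := hp.N_mono hp.N_zero h
  exact ⟨h1, h1, h2, h1, h2, h2, h2⟩

lemma Bnd₂.zero (hp : NormPair S N) (h : 0 ≤ M) : Bnd₂ S N M (fun _ => 0) :=
  ⟨hp.S_mono (hp.S_const 0) (by simpa), hp.N_mono hp.N_zero h⟩

/-- Lipschitz constant of `source` on bounded sets. -/
def sourceLip (γ M : ℝ) : ℝ := |(3 - 2 * γ) / 2| * (2 * M + 3 * M ^ 2) + |γ / 2|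

lemma sourceLip_nonneg (hM : 0 ≤ M) : 0 ≤ sourceLip γ M := by
  unfold sourceLip; positivity

/-- The constant 1 in `q = 1 + v` has no `N`-bound, so `U² q` is split into `U²` and `U² v`. The
first needs an `N`-bound of the difference of the `U`, the second only its `S`-bound; this is why
`U` is controlled in both senses. -/
lemma source_sub_bnd (hp : NormPair S N) (hX : Bnd S N M X) (hZ : Bnd S N M Z)
    (hd : Bnd S N d (X - Z)) :
    N (fun η => source γ X η - source γ Z η) (sourceLip γ M * d) := by
  have s2 := hp.S_mul (hp.S_add hX.U hZ.U) hd.U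
  have h := hp.N_add (hp.N_add (hp.N_smul ((3 - 2 * γ) / 2)
    (hp.N_add (hp.N_mul (hp.S_add hX.U hZ.U) hd.U') (hp.N_mul s2 hX.v)))
    (hp.N_smul ((3 - 2 * γ) / 2) (hp.N_mul (hp.S_mul hZ.U hZ.U) hd.v)))
    (hp.N_smul (γ / 2) hd.h)
  convert h using 1
  · funext η
    simp only [source, State.q, State.sub_U, State.sub_v, State.sub_h, Pi.sub_apply]
    ring
  · unfold sourceLip; ring

@[simp] lemma source_zero (η : ℝ) : source γ 0 η = 0 := by simp [source]

lemma source_bnd (hp : NormPair S N) (hX : Bnd S N M X) :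
    N (source γ X) (sourceLip γ M * M) := by
  have := source_sub_bnd (γ := γ) hp hX (Bnd.zero hp (hX.nonneg hp)) (d := M) (by simpa using hX)
  simpa using this

/-- Lipschitz constant of `rhs` on bounded sets. -/
def rhsLip (γ M B : ℝ) : ℝ :=
  |γ| + 1 + 3 * M ^ 2 + 2 * M + 2 * B + |γ / 2| + |(3 - 2 * γ) / 2| * (2 * M + 3 * M ^ 2) + 1
    + M + B + 2 * (M + M ^ 2 + B + 2 * B * M) + 9 * M ^ 2 + 2 * M + 2 * B

lemma rhsLip_nonneg (hM : 0 ≤ M) (hB : 0 ≤ B) : 0 ≤ rhsLip γ M B := by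
  unfold rhsLip; positivity

/-- All terms are polynomial, so the difference telescopes into products with exactly one small
factor. Since `p`, `r`, `p'`, `r'` are arbitrary, the same estimate serves for the Lipschitz
property of `G`, for the comparison of `G` with `Gdisc`, and, with the zero state, for plain bounds.
-/
lemma rhs_sub_bnd (hp : NormPair S N) (hX : Bnd S N M X) (hZ : Bnd S N M Z)
    (hd : Bnd S N d (X - Z)) {p r p' r' : ℝ → ℝ}
    (hp' : Bnd₂ S N B p') (hr' : Bnd₂ S N B r')
    (hpe : Bnd₂ S N e (fun x => p x - p' x)) (hre : Bnd₂ S N e (fun x => r x - r' x)) :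
    Bnd S N (rhsLip γ M B * (d + e)) (rhs γ p r X - rhs γ p' r' Z) := by
  have M0 : 0 ≤ M := hX.nonneg hp
  have d0 : 0 ≤ d := hd.nonneg hp
  have B0 : 0 ≤ B := hp.S_nonneg hp'.S
  have e0 : 0 ≤ e := hp.S_nonneg hpe.S
  have sUU := hp.S_mul (hp.S_add hX.U hZ.U) hd.U
  have hζ := hp.S_smul γ hd.U
  have hv := hp.N_smul γ hd.w
  have hU := hp.S_smul (-1) hre.S
  have hU' := hp.N_smul (-1) hre.N
  have hH := hp.S_add
    (hp.S_mul (hp.S_add (hp.S_mul hX.U hX.U) (hp.S_mul (hp.S_add hX.U hZ.U) hZ.U)) hd.U)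
    (hp.S_smul (-2) (hp.S_add (hp.S_mul hpe.S hX.U) (hp.S_mul hp'.S hd.U)))
  have hw := hp.N_add (hp.N_add (hp.N_smul (γ / 2) hd.h) (hp.N_smul ((3 - 2 * γ) / 2)
      (hp.N_add (hp.N_add (hp.N_mul (hp.S_add hX.U hZ.U) hd.U') (hp.N_mul sUU hX.v))
      (hp.N_mul (hp.S_mul hZ.U hZ.U) hd.v))))
    (hp.N_smul (-1) (hp.N_add (hp.N_add hpe.N (hp.N_mul hpe.S hX.v)) (hp.N_mul hp'.S hd.v)))
  have hh := hp.N_add (hp.N_add (hp.N_smul (-2) (hp.N_add (hp.N_add (hp.N_add (hp.N_add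
      (hp.N_mul hre.S hX.U') (hp.N_mul (hp.S_mul hre.S hX.U) hX.v)) (hp.N_mul hr'.S hd.U'))
      (hp.N_mul (hp.S_mul hr'.S hd.U) hX.v)) (hp.N_mul (hp.S_mul hr'.S hZ.U) hd.v)))
    (hp.N_smul 3 (hp.N_add (hp.N_mul sUU hX.w) (hp.N_mul (hp.S_mul hZ.U hZ.U) hd.w))))
    (hp.N_smul (-2) (hp.N_add (hp.N_mul hpe.S hX.w) (hp.N_mul hp'.S hd.w)))
  have n1 : |(-1 : ℝ)| = 1 := by norm_num
  have n2 : |(-2 : ℝ)| = 2 := by norm_num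
  have n3 : |(3 : ℝ)| = 3 := by norm_num
  rw [n1] at hU hU' hw
  rw [n2] at hH hh
  rw [n3] at hh
  -- `rhsLip` collects the coefficients from all components. Subtracting the bound for a single
  -- component leaves a polynomial with nonnegative coefficients, which `positivity` recognises.
  have key {b : ℝ} (h : 0 ≤ rhsLip γ M B * (d + e) - b) := sub_nonneg.1 h
  constructor
  · convert hp.S_mono hζ (key ?_) using 1
    · funext x; simp [rhs]; ring
    · unfold rhsLip; ring_nf; positivity
  · convert hp.S_mono hU (key ?_) using 1
    · funext x; simp [rhs]; ring
    · unfold rhsLip; ring_nf; positivity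
  · convert hp.N_mono hU' (key ?_) using 1
    · funext x; simp [rhs]; ring
    · unfold rhsLip; ring_nf; positivity
  · convert hp.S_mono hH (key ?_) using 1
    · funext x; simp [rhs]; ring
    · unfold rhsLip; ring_nf; positivity
  · convert hp.N_mono hv (key ?_) using 1
    · funext x; simp [rhs]; ring
    · unfold rhsLip; ring_nf; positivity
  · convert hp.N_mono hw (key ?_) using 1
    · funext x; simp [rhs, State.q]; ring
    · unfold rhsLip; ring_nf; positivity
  · convert hp.N_mono hh (key ?_) using 1
    · funext x; simp [rhs, State.q]; ring
    · unfold rhsLip; ring_nf; positivity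

lemma rhs_zero : rhs γ (fun _ => 0) (fun _ => 0) 0 = 0 := by
  ext ξ <;> simp [rhs]

lemma rhs_bnd (hp : NormPair S N) (hX : Bnd S N M X) {p r : ℝ → ℝ}
    (hP : Bnd₂ S N B p) (hr : Bnd₂ S N B r) :
    Bnd S N (rhsLip γ M B * (M + B)) (rhs γ p r X) := by
  have B0 : 0 ≤ B := hp.S_nonneg hP.S
  have := rhs_sub_bnd (γ := γ) hp hX (Bnd.zero hp (hX.nonneg hp)) (d := M) (by simpa using hX)
    (Bnd₂.zero hp B0) (Bnd₂.zero hp B0) (p := p) (r := r) (e := B) (by simpa using hP)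
    (by simpa using hr)
  simpa [rhs_zero] using this

end Lipschitz

/-! ### The norm of `F` -/

lemma MemF.add {X Z : State} (hX : MemF X) (hZ : MemF Z) : MemF (X + Z) :=
  ⟨hX.1.add hZ.1, hX.2.add hZ.2, hX.3.add hZ.3, hX.4.add hZ.4, hX.5.add hZ.5, hX.6.add hZ.6,
    hX.7.add hZ.7⟩

lemma MemF.sub {X Z : State} (hX : MemF X) (hZ : MemF Z) : MemF (X - Z) :=
  ⟨hX.1.sub hZ.1, hX.2.sub hZ.2, hX.3.sub hZ.3, hX.4.sub hZ.4, hX.5.sub hZ.5, hX.6.sub hZ.6,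
    hX.7.sub hZ.7⟩

lemma MemF.smul {X : State} (hX : MemF X) (c : ℝ) : MemF (c • X) :=
  ⟨hX.1.const_smul c, hX.2.const_smul c, hX.3.const_smul c, hX.4.const_smul c, hX.5.const_smul c,
    hX.6.const_smul c, hX.7.const_smul c⟩

lemma MemF.normF_ne_top {X : State} (hX : MemF X) : normF X ≠ ∞ := by
  simp only [normF, ne_eq, ENNReal.add_eq_top, hX.1.eLpNorm_ne_top, hX.2.eLpNorm_ne_top,
    hX.3.eLpNorm_ne_top, hX.4.eLpNorm_ne_top, hX.5.eLpNorm_ne_top, hX.6.eLpNorm_ne_top,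
    hX.7.eLpNorm_ne_top, or_self, not_false_eq_true]

@[simp] lemma normF_zero : normF 0 = 0 := by simp [normF]

lemma normF_add_le {X Z : State} (hX : MemF X) (hZ : MemF Z) :
    normF (X + Z) ≤ normF X + normF Z := by
  have h1 := eLpNorm_add_le hX.1.1 hZ.1.1 (le_top (a := (1 : ℝ≥0∞)))
  have h2 := eLpNorm_add_le hX.2.1 hZ.2.1 one_le_two
  have h3 := eLpNorm_add_le hX.3.1 hZ.3.1 (le_top (a := (1 : ℝ≥0∞)))
  have h4 := eLpNorm_add_le hX.4.1 hZ.4.1 (le_top (a := (1 : ℝ≥0∞)))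
  have h5 := eLpNorm_add_le hX.5.1 hZ.5.1 one_le_two
  have h6 := eLpNorm_add_le hX.6.1 hZ.6.1 one_le_two
  have h7 := eLpNorm_add_le hX.7.1 hZ.7.1 one_le_two
  calc normF (X + Z) ≤ _ :=
        add_le_add (add_le_add (add_le_add (add_le_add (add_le_add (add_le_add h1 h2) h3) h4) h5)
          h6) h7
    _ = normF X + normF Z := by unfold normF; ring

lemma normF_smul (c : ℝ) (X : State) : normF (c • X) = ‖c‖ₑ * normF X := by
  simp only [normF, State.smul_ζ, State.smul_U, State.smul_H, State.smul_v, State.smul_w,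
    State.smul_h, eLpNorm_const_smul]
  ring

lemma normF_sub_comm (X Z : State) : normF (X - Z) = normF (Z - X) := by
  have e : (-1 : ℝ) • (X - Z) = Z - X := by module
  rw [← e, normF_smul]
  simp

lemma normF_sub_le {X Z : State} (hX : MemF X) (hZ : MemF Z) :
    normF (X - Z) ≤ normF X + normF Z := by
  have e : X + (-1 : ℝ) • Z = X - Z := by module
  rw [← e]
  refine (normF_add_le hX (hZ.smul _)).trans ?_
  rw [normF_smul]
  simp

lemma normF_triangle {X Y Z : State} (hX : MemF X) (hY : MemF Y) (hZ : MemF Z) :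
    normF (X - Z) ≤ normF (X - Y) + normF (Y - Z) := by
  have := normF_add_le (hX.sub hY) (hY.sub hZ)
  rwa [sub_add_sub_cancel] at this

lemma MemF.fBnd {X : State} {M : ℝ} (hX : MemF X) (hM : 0 ≤ M)
    (h : normF X ≤ ENNReal.ofReal M) : FBnd M X := by
  have key : ∀ {a : ℝ≥0∞}, a ≤ normF X → a ≤ ENNReal.ofReal M := fun ha => ha.trans h
  have l : ∀ a b c d e f g : ℝ≥0∞, a ≤ a + b + c + d + e + f + g ∧ b ≤ a + b + c + d + e + f + g ∧
      c ≤ a + b + c + d + e + f + g ∧ d ≤ a + b + c + d + e + f + g ∧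
      e ≤ a + b + c + d + e + f + g ∧ f ≤ a + b + c + d + e + f + g ∧
      g ≤ a + b + c + d + e + f + g := fun a b c d e f g =>
    ⟨le_add_right <| le_add_right <| le_add_right <| le_add_right <| le_add_right le_self_add,
      le_add_right <| le_add_right <| le_add_right <| le_add_right <| le_add_right le_add_self,
      le_add_right <| le_add_right <| le_add_right <| le_add_right le_add_self,
      le_add_right <| le_add_right <| le_add_right le_add_self,
      le_add_right <| le_add_right le_add_self, le_add_right le_add_self, le_add_self⟩
  obtain ⟨l1, l2, l3, l4, l5, l6, l7⟩ := l _ _ _ _ _ _ _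
  exact ⟨essLe_of_eLpNorm_le hM hX.1.1 (key l1), essLe_of_eLpNorm_le hM hX.3.1 (key l3),
    ⟨hX.2.1, hM, key l2⟩, essLe_of_eLpNorm_le hM hX.4.1 (key l4), ⟨hX.5.1, hM, key l5⟩,
    ⟨hX.6.1, hM, key l6⟩, ⟨hX.7.1, hM, key l7⟩⟩

lemma Bnd.memF {X : State} {M : ℝ} (h : FBnd M X) : MemF X :=
  ⟨h.ζ.memLp, h.U'.memLp, h.U.memLp, h.H.memLp, h.v.memLp, h.w.memLp, h.h.memLp⟩

/-- The norm of `F` has seven summands; this is the origin of every factor 7 below. -/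
lemma Bnd.normF_le {X : State} {M : ℝ} (h : FBnd M X) : normF X ≤ ENNReal.ofReal (7 * M) := by
  have M0 : 0 ≤ M := h.nonneg normPair_essSup_l2
  calc normF X ≤ ENNReal.ofReal M + ENNReal.ofReal M + ENNReal.ofReal M + ENNReal.ofReal M
        + ENNReal.ofReal M + ENNReal.ofReal M + ENNReal.ofReal M :=
        add_le_add (add_le_add (add_le_add (add_le_add (add_le_add (add_le_add
          h.ζ.eLpNorm_le h.U'.2.2) h.U.eLpNorm_le) h.H.eLpNorm_le) h.v.2.2) h.w.2.2) h.h.2.2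
    _ = 7 * ENNReal.ofReal M := by ring
    _ = ENNReal.ofReal (7 * M) := by
        rw [ENNReal.ofReal_mul (by norm_num)]; norm_num

/-! ### Convolution estimates -/

/-- Young's inequality `‖k * g‖₂ ≤ ‖k‖₁ ‖g‖₂`. -/
lemma lintegral_conv_sq_le {k g : ℝ → ℝ≥0∞} (hk : Measurable k) (hg : AEMeasurable g volume) :
    ∫⁻ ξ, (∫⁻ η, k (ξ - η) * g η) ^ 2 ≤ (∫⁻ x, k x) ^ 2 * ∫⁻ η, g η ^ 2 := by
  have hsh : ∀ ξ, Measurable fun η : ℝ => k (ξ - η) := fun ξ => hk.comp (by fun_prop)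
  have hI : ∀ ξ, ∫⁻ η, k (ξ - η) = ∫⁻ x, k x := fun ξ => lintegral_sub_left_eq_self k ξ
  have cs : ∀ ξ, (∫⁻ η, k (ξ - η) * g η) ^ 2 ≤
      (∫⁻ x, k x) * ∫⁻ η, k (ξ - η) * g η ^ 2 := by
    intro ξ
    -- Cauchy–Schwarz for the factorisation `k g = k^{1/2} · (k^{1/2} g)`. The first factor
    -- contributes `‖k‖₁`; Tonelli applied to the second yields `‖k‖₁ ‖g‖₂²`.
    have h := ENNReal.lintegral_mul_le_Lp_mul_Lq volume
      (Real.HolderConjugate.two_two) (f := fun η => k (ξ - η) ^ (1 / 2 : ℝ))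
      (g := fun η => k (ξ - η) ^ (1 / 2 : ℝ) * g η)
      ((hsh ξ).pow_const _).aemeasurable (((hsh ξ).pow_const _).aemeasurable.mul hg)
    have e1 : ∀ η, k (ξ - η) ^ (1 / 2 : ℝ) * (k (ξ - η) ^ (1 / 2 : ℝ) * g η)
        = k (ξ - η) * g η := by
      intro η
      rw [← mul_assoc, ← ENNReal.rpow_add_of_nonneg _ _ (by norm_num) (by norm_num)]
      norm_num
    have e2 : ∀ η, (k (ξ - η) ^ (1 / 2 : ℝ)) ^ (2 : ℝ) = k (ξ - η) := by
      intro η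
      rw [← ENNReal.rpow_mul]; norm_num
    simp only [Pi.mul_apply, e1, e2, ENNReal.mul_rpow_of_nonneg _ _ (zero_le_two (α := ℝ)), hI] at h
    calc (∫⁻ η, k (ξ - η) * g η) ^ 2 ≤ _ := pow_le_pow_left' h 2
      _ = _ := by
        rw [mul_pow, ← ENNReal.rpow_natCast, ← ENNReal.rpow_natCast, ← ENNReal.rpow_mul,
          ← ENNReal.rpow_mul]
        norm_num
  calc ∫⁻ ξ, (∫⁻ η, k (ξ - η) * g η) ^ 2
      ≤ ∫⁻ ξ, (∫⁻ x, k x) * ∫⁻ η, k (ξ - η) * g η ^ 2 := lintegral_mono cs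
    _ ≤ (∫⁻ x, k x) * ∫⁻ ξ, ∫⁻ η, k (ξ - η) * g η ^ 2 := by
        refine (lintegral_const_mul'' _ ?_).le
        refine AEMeasurable.lintegral_prod_right' (f := fun p : ℝ × ℝ => k (p.1 - p.2) * g p.2 ^ 2)
          (ν := volume) (μ := volume) ?_
        exact (hk.comp (by fun_prop)).aemeasurable.mul
          ((hg.comp_quasiMeasurePreserving Measure.quasiMeasurePreserving_snd).pow_const 2)
    _ = (∫⁻ x, k x) * ∫⁻ η, ∫⁻ ξ, k (ξ - η) * g η ^ 2 := by
        rw [lintegral_lintegral_swap]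
        exact (hk.comp (by fun_prop)).aemeasurable.mul
          ((hg.comp_quasiMeasurePreserving Measure.quasiMeasurePreserving_snd).pow_const 2)
    _ = (∫⁻ x, k x) ^ 2 * ∫⁻ η, g η ^ 2 := by
        rw [sq, mul_assoc]
        congr 1
        rw [← lintegral_const_mul'' _ (hg.pow_const 2)]
        congr 1; funext η
        have hm : Measurable fun ξ : ℝ => k (ξ - η) := hk.comp (by fun_prop)
        rw [lintegral_mul_const _ hm, lintegral_sub_right_eq_self k η]

lemma eLpNorm_two_eq (f : ℝ → ℝ) :
    eLpNorm f 2 volume = (∫⁻ x, ‖f x‖ₑ ^ 2) ^ (1 / 2 : ℝ) := by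
  rw [eLpNorm_eq_lintegral_rpow_enorm_toReal (by norm_num) (by norm_num)]
  norm_num

lemma eLpNorm_conv_le {k g : ℝ → ℝ} (hk : Measurable k) (hg : AEStronglyMeasurable g volume) :
    eLpNorm (fun ξ => ∫ η, k (ξ - η) * g η) 2 volume ≤ eLpNorm k 1 volume * eLpNorm g 2 volume := by
  have h := lintegral_conv_sq_le hk.enorm hg.enorm
  rw [eLpNorm_two_eq, eLpNorm_two_eq, eLpNorm_one_eq_lintegral_enorm]
  calc (∫⁻ ξ, ‖∫ η, k (ξ - η) * g η‖ₑ ^ 2) ^ (1 / 2 : ℝ)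
      ≤ (∫⁻ ξ, (∫⁻ η, ‖k (ξ - η)‖ₑ * ‖g η‖ₑ) ^ 2) ^ (1 / 2 : ℝ) := by
        refine ENNReal.rpow_le_rpow (lintegral_mono fun ξ => ?_) (by norm_num)
        refine pow_le_pow_left' ((enorm_integral_le_lintegral_enorm _).trans_eq ?_) 2
        simp only [enorm_mul]
    _ ≤ ((∫⁻ x, ‖k x‖ₑ) ^ 2 * ∫⁻ η, ‖g η‖ₑ ^ 2) ^ (1 / 2 : ℝ) :=
        ENNReal.rpow_le_rpow h (by norm_num)
    _ = _ := by
        rw [ENNReal.mul_rpow_of_nonneg _ _ (by norm_num), ← ENNReal.rpow_natCast,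
          ← ENNReal.rpow_mul]
        norm_num

lemma memLp_comp_sub_left {k : ℝ → ℝ} (hk : MemLp k 2 volume) (ξ : ℝ) :
    MemLp (fun η => k (ξ - η)) 2 volume :=
  hk.comp_measurePreserving (Measure.measurePreserving_sub_left volume ξ)

lemma integrable_conv {k g : ℝ → ℝ} (hk : MemLp k 2 volume) (hg : MemLp g 2 volume) (ξ : ℝ) :
    Integrable (fun η => k (ξ - η) * g η) volume :=
  (memLp_comp_sub_left hk ξ).integrable_mul hg

lemma enorm_conv_le {k g : ℝ → ℝ} (hk : MemLp k 2 volume) (hg : MemLp g 2 volume) (ξ : ℝ) :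
    ‖∫ η, k (ξ - η) * g η‖ₑ ≤ eLpNorm k 2 volume * eLpNorm g 2 volume := by
  have h1 := memLp_comp_sub_left hk ξ
  have e : eLpNorm (fun η => k (ξ - η)) 2 volume = eLpNorm k 2 volume :=
    eLpNorm_comp_measurePreserving (g := k) hk.1 (Measure.measurePreserving_sub_left volume ξ)
  rw [← e]
  have := eLpNorm_smul_le_mul_eLpNorm (p := 2) (q := 2) (r := 1) hg.1 h1.1
  refine (enorm_integral_le_lintegral_enorm _).trans ?_
  rw [eLpNorm_one_eq_lintegral_enorm] at this
  exact this

/-! ### The exponential kernel -/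

lemma integral_exp_neg_abs : ∫ x : ℝ, Real.exp (-|x|) = 2 := by
  rw [integral_comp_abs (f := fun x => Real.exp (-x)), integral_exp_neg_Ioi_zero]
  norm_num

lemma integrable_exp_neg_abs : Integrable (fun x : ℝ => Real.exp (-|x|)) :=
  Integrable.of_integral_ne_zero (by rw [integral_exp_neg_abs]; norm_num)

lemma measurable_exp_neg_abs : Measurable (fun x : ℝ => Real.exp (-|x|)) := by fun_prop

lemma exp_neg_abs_le_one (x : ℝ) : Real.exp (-|x|) ≤ 1 :=
  Real.exp_le_one_iff.2 (neg_nonpos.2 (abs_nonneg x))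

lemma eLpNorm_one_exp_neg_abs :
    eLpNorm (fun x : ℝ => Real.exp (-|x|)) 1 volume = ENNReal.ofReal 2 := by
  rw [eLpNorm_one_eq_lintegral_enorm, ← integral_exp_neg_abs,
    ofReal_integral_eq_lintegral_ofReal integrable_exp_neg_abs
      (ae_of_all _ fun x => (Real.exp_pos _).le)]
  simp only [Real.enorm_eq_ofReal (Real.exp_pos _).le]

lemma eLpNorm_two_exp_neg_abs_le :
    eLpNorm (fun x : ℝ => Real.exp (-|x|)) 2 volume ≤ ENNReal.ofReal 2 := by
  have h : ∫⁻ x : ℝ, ‖Real.exp (-|x|)‖ₑ ^ 2 ≤ ENNReal.ofReal 2 := by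
    rw [← eLpNorm_one_exp_neg_abs, eLpNorm_one_eq_lintegral_enorm]
    refine lintegral_mono fun x => ?_
    have : ‖Real.exp (-|x|)‖ₑ ≤ 1 := by
      rw [Real.enorm_eq_ofReal (Real.exp_pos _).le]
      exact ENNReal.ofReal_le_one.2 (exp_neg_abs_le_one x)
    calc ‖Real.exp (-|x|)‖ₑ ^ 2 = ‖Real.exp (-|x|)‖ₑ * ‖Real.exp (-|x|)‖ₑ := sq _
      _ ≤ ‖Real.exp (-|x|)‖ₑ * 1 := by gcongr
      _ = _ := mul_one _
  rw [eLpNorm_two_eq]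
  calc _ ≤ (ENNReal.ofReal 2) ^ (1 / 2 : ℝ) := ENNReal.rpow_le_rpow h (by norm_num)
    _ ≤ (ENNReal.ofReal 2) ^ (1 : ℝ) :=
        ENNReal.rpow_le_rpow_of_exponent_le (by norm_num) (by norm_num)
    _ = _ := ENNReal.rpow_one _

lemma memLp_exp_neg_abs : MemLp (fun x : ℝ => Real.exp (-|x|)) 2 volume :=
  ⟨measurable_exp_neg_abs.aestronglyMeasurable,
    eLpNorm_two_exp_neg_abs_le.trans_lt ENNReal.ofReal_lt_top⟩

/-- Convolution with the kernel `e^{-|ξ|}`. -/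
def smear (g : ℝ → ℝ) (ξ : ℝ) : ℝ := ∫ η, Real.exp (-|ξ - η|) * g η

lemma aestronglyMeasurable_conv {k g : ℝ → ℝ} (hk : Measurable k)
    (hg : AEStronglyMeasurable g volume) :
    AEStronglyMeasurable (fun ξ => ∫ η, k (ξ - η) * g η) volume := by
  refine AEStronglyMeasurable.integral_prod_right' (f := fun p : ℝ × ℝ => k (p.1 - p.2) * g p.2)
    (μ := volume) (ν := volume) ?_
  exact (hk.comp (by fun_prop)).aestronglyMeasurable.mul hg.comp_snd

/-- The L² bound is Young's inequality and uses `‖k‖₁`; the pointwise bound is Cauchy–Schwarz and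
uses `‖k‖₂`. Both are needed because `U`, whose time derivative is `-Q`, is measured in L² and in
L^∞. -/
lemma L2Le.conv {k g : ℝ → ℝ} {a b c : ℝ} (hk : Measurable k) (ha : 0 ≤ a)
    (h1 : eLpNorm k 1 volume ≤ ENNReal.ofReal a)
    (h2 : eLpNorm k 2 volume ≤ ENNReal.ofReal b) (hb : 0 ≤ b) (hg : L2Le g c) :
    L2Le (fun ξ => ∫ η, k (ξ - η) * g η) (a * c) ∧
      ∀ ξ, |∫ η, k (ξ - η) * g η| ≤ b * c := by
  refine ⟨⟨aestronglyMeasurable_conv hk hg.1, mul_nonneg ha hg.2.1, ?_⟩, fun ξ => ?_⟩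
  · rw [ENNReal.ofReal_mul ha]
    exact (eLpNorm_conv_le hk hg.1).trans (mul_le_mul' h1 hg.2.2)
  · have := (enorm_conv_le (k := k)
      ⟨hk.aestronglyMeasurable, h2.trans_lt ENNReal.ofReal_lt_top⟩ hg.memLp ξ).trans
      (mul_le_mul' h2 hg.2.2)
    rw [← ENNReal.ofReal_mul hb, Real.enorm_eq_ofReal_abs] at this
    exact (ENNReal.ofReal_le_ofReal_iff (mul_nonneg hb hg.2.1)).1 this

lemma L2Le.smear {g : ℝ → ℝ} {c : ℝ} (hg : L2Le g c) : Bnd₂ EssLe L2Le (2 * c) (smear g) := by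
  have h := L2Le.conv measurable_exp_neg_abs zero_le_two eLpNorm_one_exp_neg_abs.le
    eLpNorm_two_exp_neg_abs_le zero_le_two hg
  exact ⟨⟨h.1.1, ae_of_all _ h.2⟩, h.1⟩

lemma L2Le.integrable_smear {g : ℝ → ℝ} {c : ℝ} (hg : L2Le g c) (ξ : ℝ) :
    Integrable (fun η => Real.exp (-|ξ - η|) * g η) :=
  integrable_conv memLp_exp_neg_abs hg.memLp ξ

lemma integrable_exp_sub (ξ : ℝ) : Integrable (fun η => Real.exp (-|ξ - η|)) :=
  integrable_exp_neg_abs.comp_sub_left ξ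

lemma integral_exp_sub (ξ : ℝ) : ∫ η, Real.exp (-|ξ - η|) = 2 := by
  rw [integral_sub_left_eq_self (fun x => Real.exp (-|x|)), integral_exp_neg_abs]

lemma SupLe.integrable_smear {g : ℝ → ℝ} {c : ℝ} (hg : SupLe g c) (ξ : ℝ) :
    Integrable (fun η => Real.exp (-|ξ - η|) * g η) :=
  (integrable_exp_sub ξ).mul_bdd (c := c) hg.1.aestronglyMeasurable (ae_of_all _ hg.2)

lemma measurable_conv {k g : ℝ → ℝ} (hk : Measurable k) (hg : Measurable g) :
    Measurable (fun ξ => ∫ η, k (ξ - η) * g η) := by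
  refine (StronglyMeasurable.integral_prod_right
    (f := fun ξ η => k (ξ - η) * g η) (ν := volume) ?_).measurable
  exact ((hk.comp (by fun_prop)).mul (hg.comp measurable_snd)).stronglyMeasurable

lemma abs_smear_le {g : ℝ → ℝ} {c : ℝ} (hg : ∀ᵐ η, |g η| ≤ c) (ξ : ℝ) :
    |smear g ξ| ≤ 2 * c := by
  have h : ‖smear g ξ‖ ≤ ∫ η, Real.exp (-|ξ - η|) * c := by
    refine norm_integral_le_of_norm_le ((integrable_exp_sub ξ).mul_const c) ?_
    filter_upwards [hg] with η hη
    rw [norm_mul, Real.norm_eq_abs, Real.abs_exp]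
    exact mul_le_mul_of_nonneg_left hη (Real.exp_pos _).le
  rwa [integral_mul_const, integral_exp_sub] at h

lemma SupLe.smear {g : ℝ → ℝ} {c : ℝ} (hg : SupLe g c) : SupLe (smear g) (2 * c) :=
  ⟨measurable_conv measurable_exp_neg_abs hg.1, abs_smear_le (ae_of_all _ hg.2)⟩

/-! ### The potentials -/

lemma measurable_sign : Measurable Real.sign := by
  unfold Real.sign
  exact Measurable.ite measurableSet_Iio measurable_const
    (Measurable.ite measurableSet_Ioi measurable_const measurable_const)

lemma abs_sign_le (x : ℝ) : |Real.sign x| ≤ 1 := by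
  rcases Real.sign_apply_eq x with h | h | h <;> simp [h]

lemma sign_mul_self_eq (x : ℝ) : Real.sign x * x = |x| := by
  rcases lt_trichotomy x 0 with h | h | h
  · rw [Real.sign_of_neg h, abs_of_neg h]; ring
  · simp [h]
  · rw [Real.sign_of_pos h, abs_of_pos h]; ring

/-- The kernel `e^{-sgn(ξ-η)(y(ξ)-y(η))}`. -/
def ker (Y : State) (ξ η : ℝ) : ℝ := Real.exp (-(Real.sign (ξ - η) * (Y.y ξ - Y.y η)))

/-- The common form of the integrals in `P` and `Q`. -/
def pot (θ : ℝ → ℝ) (γ : ℝ) (Y : State) (ξ : ℝ) : ℝ :=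
  ∫ η, θ (ξ - η) * ker Y ξ η * source γ Y η

lemma P_eq (γ : ℝ) (Y : State) (ξ : ℝ) : P γ Y ξ = 1 / 2 * pot (fun _ => 1) γ Y ξ := by
  simp [P, pot, ker]

lemma Q_eq (γ : ℝ) (Y : State) (ξ : ℝ) : Q γ Y ξ = -(1 / 2) * pot Real.sign γ Y ξ := by
  simp [Q, pot, ker]

/-- Since `y = id + ζ` and `sgn(x) x = |x|`, the unbounded part of the exponent is exactly `-|ξ -
η|`, and a bounded `ζ` changes the kernel only by a bounded factor. -/
lemma ker_eq (Y : State) (ξ η : ℝ) :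
    ker Y ξ η = Real.exp (-|ξ - η|) * Real.exp (-(Real.sign (ξ - η) * (Y.ζ ξ - Y.ζ η))) := by
  rw [ker, ← Real.exp_add, ← sign_mul_self_eq]
  congr 1
  simp only [State.y]; ring

lemma ker_pos (Y : State) (ξ η : ℝ) : 0 < ker Y ξ η := Real.exp_pos _

lemma neg_sign_mul_le {M x y z : ℝ} (hx : |x| ≤ M) (hy : |y| ≤ M) :
    -(Real.sign z * (x - y)) ≤ 2 * M := by
  have h1 : |Real.sign z * (x - y)| ≤ 1 * (M + M) := by
    rw [abs_mul]
    refine mul_le_mul (abs_sign_le z) ?_ (abs_nonneg _) zero_le_one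
    exact (abs_sub _ _).trans (add_le_add hx hy)
  have := neg_le_abs (Real.sign z * (x - y))
  linarith

lemma ker_le {Y : State} {M ξ η : ℝ} (hξ : |Y.ζ ξ| ≤ M) (hη : |Y.ζ η| ≤ M) :
    ker Y ξ η ≤ Real.exp (2 * M) * Real.exp (-|ξ - η|) := by
  rw [ker_eq, mul_comm]
  exact mul_le_mul_of_nonneg_right (Real.exp_le_exp.2 (neg_sign_mul_le hξ hη)) (Real.exp_pos _).le

lemma abs_exp_sub_exp_le {a b c : ℝ} (ha : a ≤ c) (hb : b ≤ c) :
    |Real.exp a - Real.exp b| ≤ Real.exp c * |a - b| := by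
  have key : ∀ a b : ℝ, a ≤ c → b ≤ c → Real.exp a - Real.exp b ≤ Real.exp c * |a - b| := by
    intro a b ha _
    have h1 : Real.exp a - Real.exp b ≤ Real.exp a * (a - b) := by
      have h := Real.add_one_le_exp (b - a)
      have e : Real.exp b = Real.exp a * Real.exp (b - a) := by rw [← Real.exp_add]; ring_nf
      rw [e]
      nlinarith [Real.exp_pos a]
    refine h1.trans ((mul_le_mul_of_nonneg_left (le_abs_self _) (Real.exp_pos _).le).trans ?_)
    exact mul_le_mul_of_nonneg_right (Real.exp_le_exp.2 ha) (abs_nonneg _)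
  rw [abs_le]
  constructor
  · have := key b a hb ha
    rw [abs_sub_comm b a] at this
    linarith
  · exact key a b ha hb

lemma abs_ker_sub_le {X Z : State} {M d ξ η : ℝ} (h1 : |X.ζ ξ| ≤ M) (h2 : |X.ζ η| ≤ M)
    (h3 : |Z.ζ ξ| ≤ M) (h4 : |Z.ζ η| ≤ M) (h5 : |X.ζ ξ - Z.ζ ξ| ≤ d) (h6 : |X.ζ η - Z.ζ η| ≤ d) :
    |ker X ξ η - ker Z ξ η| ≤ Real.exp (2 * M) * (2 * d) * Real.exp (-|ξ - η|) := by
  rw [ker_eq, ker_eq, ← mul_sub, abs_mul, Real.abs_exp, mul_comm]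
  refine mul_le_mul_of_nonneg_right ?_ (Real.exp_pos _).le
  refine (abs_exp_sub_exp_le (neg_sign_mul_le h1 h2) (neg_sign_mul_le h3 h4)).trans ?_
  refine mul_le_mul_of_nonneg_left ?_ (Real.exp_pos _).le
  have e : -(Real.sign (ξ - η) * (X.ζ ξ - X.ζ η)) - -(Real.sign (ξ - η) * (Z.ζ ξ - Z.ζ η)) =
      -(Real.sign (ξ - η) * ((X.ζ ξ - Z.ζ ξ) - (X.ζ η - Z.ζ η))) := by ring
  rw [e, abs_neg, abs_mul]
  calc _ ≤ 1 * (d + d) := mul_le_mul (abs_sign_le _) ((abs_sub _ _).trans (add_le_add h5 h6))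
        (abs_nonneg _) zero_le_one
    _ = 2 * d := by ring

lemma aestronglyMeasurable_ker {Y : State} (hY : AEStronglyMeasurable Y.ζ volume) (ξ : ℝ) :
    AEStronglyMeasurable (fun η => ker Y ξ η) volume := by
  have h1 : Measurable fun η : ℝ => Real.sign (ξ - η) := measurable_sign.comp (by fun_prop)
  have h2 : AEStronglyMeasurable Y.y volume := aestronglyMeasurable_id.add hY
  exact Real.continuous_exp.comp_aestronglyMeasurable
    (h1.aestronglyMeasurable.mul (aestronglyMeasurable_const.sub h2)).neg

section Pot

variable {θ : ℝ → ℝ} {γ M d ξ : ℝ} {X Y Z : State}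

lemma integrable_pot (hθ : Measurable θ) (hθ1 : ∀ x, |θ x| ≤ 1)
    (hY : AEStronglyMeasurable Y.ζ volume) (hM : ∀ᵐ η, |Y.ζ η| ≤ M) (hξ : |Y.ζ ξ| ≤ M)
    (hs : AEStronglyMeasurable (source γ Y) volume)
    (hi : Integrable (fun η => Real.exp (-|ξ - η|) * source γ Y η)) :
    Integrable (fun η => θ (ξ - η) * ker Y ξ η * source γ Y η) := by
  have hm : Measurable fun η : ℝ => θ (ξ - η) := hθ.comp (by fun_prop)
  refine (hi.norm.const_mul (Real.exp (2 * M))).mono'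
    ((hm.aestronglyMeasurable.mul (aestronglyMeasurable_ker hY ξ)).mul hs) ?_
  filter_upwards [hM] with η hη
  rw [norm_mul, norm_mul, norm_mul, Real.norm_eq_abs, Real.norm_eq_abs (ker Y ξ η),
    abs_of_pos (ker_pos Y ξ η), Real.norm_of_nonneg (Real.exp_pos _).le, ← mul_assoc]
  refine mul_le_mul_of_nonneg_right ?_ (norm_nonneg _)
  calc |θ (ξ - η)| * ker Y ξ η ≤ 1 * (Real.exp (2 * M) * Real.exp (-|ξ - η|)) :=
        mul_le_mul (hθ1 _) (ker_le hξ hη) (ker_pos _ _ _).le zero_le_one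
    _ = _ := one_mul _

/-- The integrand is a product, so its difference is a change of source against a bounded kernel
plus a change of kernel against a fixed source. The bounds at `ξ` are separate hypotheses, so that
the estimate can be used almost everywhere as well as everywhere. -/
lemma abs_pot_sub_le (hθ : Measurable θ) (hθ1 : ∀ x, |θ x| ≤ 1)
    (hX : AEStronglyMeasurable X.ζ volume) (hZ : AEStronglyMeasurable Z.ζ volume)
    (hXM : ∀ᵐ η, |X.ζ η| ≤ M) (hZM : ∀ᵐ η, |Z.ζ η| ≤ M) (hd : ∀ᵐ η, |X.ζ η - Z.ζ η| ≤ d)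
    (hXξ : |X.ζ ξ| ≤ M) (hZξ : |Z.ζ ξ| ≤ M) (hdξ : |X.ζ ξ - Z.ζ ξ| ≤ d)
    (hsX : AEStronglyMeasurable (source γ X) volume)
    (hsZ : AEStronglyMeasurable (source γ Z) volume)
    (hiX : Integrable (fun η => Real.exp (-|ξ - η|) * source γ X η))
    (hiZ : Integrable (fun η => Real.exp (-|ξ - η|) * source γ Z η)) :
    |pot θ γ X ξ - pot θ γ Z ξ| ≤ smear (fun η => Real.exp (2 * M) *
      (|source γ X η - source γ Z η| + 2 * d * |source γ Z η|)) ξ := by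
  rw [pot, pot, ← integral_sub (integrable_pot hθ hθ1 hX hXM hXξ hsX hiX)
    (integrable_pot hθ hθ1 hZ hZM hZξ hsZ hiZ)]
  have i1 := (hiX.sub hiZ).norm
  have i2 := hiZ.norm
  rw [smear, ← Real.norm_eq_abs]
  refine norm_integral_le_of_norm_le ?_ ?_
  · refine ((i1.add (i2.const_mul (2 * d))).const_mul (Real.exp (2 * M))).congr
      (ae_of_all _ fun η => ?_)
    simp only [Pi.add_apply, Pi.sub_apply, ← mul_sub, norm_mul, Real.norm_eq_abs, Real.abs_exp]
    ring
  · filter_upwards [hXM, hZM, hd] with η h1 h2 h3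
    have e : θ (ξ - η) * ker X ξ η * source γ X η - θ (ξ - η) * ker Z ξ η * source γ Z η =
        θ (ξ - η) * (ker X ξ η * (source γ X η - source γ Z η) +
          (ker X ξ η - ker Z ξ η) * source γ Z η) := by ring
    rw [e, Real.norm_eq_abs, abs_mul]
    have k1 := ker_le hXξ h1
    have k2 := abs_ker_sub_le hXξ h1 hZξ h2 hdξ h3
    have k3 : |ker X ξ η * (source γ X η - source γ Z η) +
          (ker X ξ η - ker Z ξ η) * source γ Z η| ≤
        Real.exp (2 * M) * Real.exp (-|ξ - η|) * |source γ X η - source γ Z η| +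
        Real.exp (2 * M) * (2 * d) * Real.exp (-|ξ - η|) * |source γ Z η| := by
      refine (abs_add_le _ _).trans (add_le_add ?_ ?_)
      · rw [abs_mul, abs_of_pos (ker_pos _ _ _)]
        exact mul_le_mul_of_nonneg_right k1 (abs_nonneg _)
      · rw [abs_mul]
        exact mul_le_mul_of_nonneg_right k2 (abs_nonneg _)
    calc _ ≤ 1 * _ := mul_le_mul (hθ1 _) k3 (abs_nonneg _) zero_le_one
      _ = _ := by ring

@[simp] lemma pot_zero : pot θ γ 0 ξ = 0 := by simp [pot]

lemma abs_pot_le (hθ : Measurable θ) (hθ1 : ∀ x, |θ x| ≤ 1)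
    (hX : AEStronglyMeasurable X.ζ volume)
    (hXM : ∀ᵐ η, |X.ζ η| ≤ M) (hXξ : |X.ζ ξ| ≤ M)
    (hsX : AEStronglyMeasurable (source γ X) volume)
    (hiX : Integrable (fun η => Real.exp (-|ξ - η|) * source γ X η)) :
    |pot θ γ X ξ| ≤ smear (fun η => Real.exp (2 * M) * |source γ X η|) ξ := by
  have M0 : 0 ≤ M := (abs_nonneg _).trans hXξ
  have h := abs_pot_sub_le (X := X) (Z := 0) (γ := γ) (ξ := ξ) (d := M) hθ hθ1 hX
    aestronglyMeasurable_const hXM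
    (ae_of_all _ fun η => by simpa) (by simpa using hXM) hXξ (by simpa) (by simpa) hsX
    (aestronglyMeasurable_const (b := (0 : ℝ)).congr (by simp [EventuallyEq])) hiX (by simp)
  simpa using h

end Pot

/-! ### Lipschitz estimates for the potentials -/

lemma L2Le.abs {f : ℝ → ℝ} {c : ℝ} (hf : L2Le f c) : L2Le (fun x => |f x|) c :=
  ⟨hf.1.norm, hf.2.1, by
    rw [show (fun x => |f x|) = fun x => ‖f x‖ from rfl, eLpNorm_norm]; exact hf.2.2⟩

lemma L2Le.of_abs_le {f g : ℝ → ℝ} {c : ℝ} (hg : L2Le g c) (hf : AEStronglyMeasurable f volume)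
    (h : ∀ᵐ ξ, |f ξ| ≤ g ξ) : L2Le f c :=
  ⟨hf, hg.2.1, (eLpNorm_mono_ae_real (by simpa using h)).trans hg.2.2⟩

lemma EssLe.of_abs_le {f g : ℝ → ℝ} {c : ℝ} (hg : EssLe g c) (hf : AEStronglyMeasurable f volume)
    (h : ∀ᵐ ξ, |f ξ| ≤ g ξ) : EssLe f c :=
  ⟨hf, by filter_upwards [h, hg.2] with ξ h1 h2 using h1.trans ((le_abs_self _).trans h2)⟩

lemma SupLe.abs {f : ℝ → ℝ} {c : ℝ} (hf : SupLe f c) : SupLe (fun x => |f x|) c :=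
  ⟨hf.1.abs, by simpa using hf.2⟩

lemma SupLe.of_abs_le {f g : ℝ → ℝ} {c : ℝ} (hg : SupLe g c) (hf : Measurable f)
    (h : ∀ ξ, |f ξ| ≤ g ξ) : SupLe f c :=
  ⟨hf, fun ξ => (h ξ).trans ((le_abs_self _).trans (hg.2 ξ))⟩

lemma aestronglyMeasurable_pot {θ : ℝ → ℝ} {γ : ℝ} {Y : State} (hθ : Measurable θ)
    (hY : AEStronglyMeasurable Y.ζ volume) (hs : AEStronglyMeasurable (source γ Y) volume) :
    AEStronglyMeasurable (pot θ γ Y) volume := by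
  refine AEStronglyMeasurable.integral_prod_right'
    (f := fun p : ℝ × ℝ => θ (p.1 - p.2) * ker Y p.1 p.2 * source γ Y p.2)
    (μ := volume) (ν := volume) ?_
  have h2 : AEStronglyMeasurable Y.y volume := aestronglyMeasurable_id.add hY
  have h1 : Measurable fun p : ℝ × ℝ => Real.sign (p.1 - p.2) := measurable_sign.comp (by fun_prop)
  have h3 : Measurable fun p : ℝ × ℝ => θ (p.1 - p.2) := hθ.comp (by fun_prop)
  exact (h3.aestronglyMeasurable.mul (Real.continuous_exp.comp_aestronglyMeasurable
    (h1.aestronglyMeasurable.mul (h2.comp_fst.sub h2.comp_snd)).neg)).mul hs.comp_snd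

lemma measurable_pot {θ : ℝ → ℝ} {γ : ℝ} {Y : State} (hθ : Measurable θ)
    (hY : Measurable Y.ζ) (hs : Measurable (source γ Y)) : Measurable (pot θ γ Y) := by
  refine (StronglyMeasurable.integral_prod_right
    (f := fun ξ η => θ (ξ - η) * ker Y ξ η * source γ Y η) (ν := volume) ?_).measurable
  have h2 : Measurable Y.y := measurable_id.add hY
  have h1 : Measurable fun p : ℝ × ℝ => Real.sign (p.1 - p.2) := measurable_sign.comp (by fun_prop)
  have h3 : Measurable fun p : ℝ × ℝ => θ (p.1 - p.2) := hθ.comp (by fun_prop)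
  exact ((h3.mul (Real.measurable_exp.comp (h1.mul ((h2.comp measurable_fst).sub
    (h2.comp measurable_snd))).neg)).mul (hs.comp measurable_snd)).stronglyMeasurable

/-- Lipschitz constant of the potentials on bounded sets. -/
def potLip (γ M : ℝ) : ℝ := 2 * (Real.exp (2 * M) * (sourceLip γ M * (1 + 2 * M)))

lemma potLip_nonneg {γ M : ℝ} (hM : 0 ≤ M) : 0 ≤ potLip γ M := by
  have := sourceLip_nonneg (γ := γ) hM
  unfold potLip; positivity

/-- A pair of norms for which the potentials are Lipschitz on bounded sets. -/
structure PotPair (S N : (ℝ → ℝ) → ℝ → Prop) : Prop extends NormPair S N where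
  pot_sub : ∀ {θ : ℝ → ℝ} {γ M d : ℝ} {X Z : State}, Measurable θ → (∀ x, |θ x| ≤ 1) →
    Bnd S N M X → Bnd S N M Z → Bnd S N d (X - Z) →
    Bnd₂ S N (potLip γ M * d) (fun ξ => pot θ γ X ξ - pot θ γ Z ξ)

/-- The function being smeared in `abs_pot_sub_le`; smearing costs a further factor 2, the integral
of `e^{-|x|}`, which completes `potLip`. -/
lemma NormPair.pot_majorant {S N : (ℝ → ℝ) → ℝ → Prop} (hp : NormPair S N)
    (habs : ∀ {f c}, N f c → N (fun x => |f x|) c) {γ M d : ℝ} {X Z : State}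
    (hX : Bnd S N M X) (hZ : Bnd S N M Z) (hd : Bnd S N d (X - Z)) :
    N (fun η => Real.exp (2 * M) *
      (|source γ X η - source γ Z η| + 2 * d * |source γ Z η|))
      (Real.exp (2 * M) * (sourceLip γ M * (1 + 2 * M)) * d) := by
  have d0 := hd.nonneg hp
  have h := hp.N_smul (Real.exp (2 * M)) (hp.N_add (habs (source_sub_bnd (γ := γ) hp hX hZ hd))
    (hp.N_smul (2 * d) (habs (source_bnd (γ := γ) hp hZ))))
  convert h using 1
  rw [Real.abs_exp, abs_of_nonneg (by positivity)]
  ring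

lemma potPair_essSup_l2 : PotPair EssLe L2Le where
  toNormPair := normPair_essSup_l2
  pot_sub {θ γ M d X Z} hθ hθ1 hX hZ hd := by
    have hg := normPair_essSup_l2.pot_majorant (γ := γ) (fun h => h.abs) hX hZ hd
    have hsX := source_bnd (γ := γ) normPair_essSup_l2 hX
    have hsZ := source_bnd (γ := γ) normPair_essSup_l2 hZ
    have hm : AEStronglyMeasurable (fun ξ => pot θ γ X ξ - pot θ γ Z ξ) volume :=
      (aestronglyMeasurable_pot hθ hX.ζ.1 hsX.1).sub (aestronglyMeasurable_pot hθ hZ.ζ.1 hsZ.1)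
    have hle : ∀ᵐ ξ, |pot θ γ X ξ - pot θ γ Z ξ| ≤ smear (fun η => Real.exp (2 * M) *
        (|source γ X η - source γ Z η| + 2 * d * |source γ Z η|)) ξ := by
      filter_upwards [hX.ζ.2, hZ.ζ.2, hd.ζ.2] with ξ h1 h2 h3
      exact abs_pot_sub_le hθ hθ1 hX.ζ.1 hZ.ζ.1 hX.ζ.2 hZ.ζ.2 hd.ζ.2 h1 h2 h3 hsX.1 hsZ.1
        (hsX.integrable_smear ξ) (hsZ.integrable_smear ξ)
    have e : potLip γ M * d =
      2 * (Real.exp (2 * M) * (sourceLip γ M * (1 + 2 * M)) * d) := by unfold potLip; ring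
    rw [e]
    exact ⟨hg.smear.S.of_abs_le hm hle, hg.smear.N.of_abs_le hm hle⟩

lemma potPair_sup : PotPair SupLe SupLe where
  toNormPair := normPair_sup
  pot_sub {θ γ M d X Z} hθ hθ1 hX hZ hd := by
    have hg := normPair_sup.pot_majorant (γ := γ) (fun h => h.abs) hX hZ hd
    have hsX := source_bnd (γ := γ) normPair_sup hX
    have hsZ := source_bnd (γ := γ) normPair_sup hZ
    have hm : Measurable (fun ξ => pot θ γ X ξ - pot θ γ Z ξ) :=
      (measurable_pot hθ hX.ζ.1 hsX.1).sub (measurable_pot hθ hZ.ζ.1 hsZ.1)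
    have hle : ∀ ξ, |pot θ γ X ξ - pot θ γ Z ξ| ≤ smear (fun η => Real.exp (2 * M) *
        (|source γ X η - source γ Z η| + 2 * d * |source γ Z η|)) ξ := fun ξ =>
      abs_pot_sub_le hθ hθ1 hX.ζ.essLe.1 hZ.ζ.essLe.1 hX.ζ.essLe.2 hZ.ζ.essLe.2 hd.ζ.essLe.2
        (hX.ζ.2 ξ) (hZ.ζ.2 ξ) (hd.ζ.2 ξ) hsX.essLe.1 hsZ.essLe.1
        (hsX.integrable_smear ξ) (hsZ.integrable_smear ξ)
    have e : potLip γ M * d =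
      2 * (Real.exp (2 * M) * (sourceLip γ M * (1 + 2 * M)) * d) := by unfold potLip; ring
    rw [e]
    exact ⟨hg.smear.of_abs_le hm hle, hg.smear.of_abs_le hm hle⟩

/-! ### The exact vector field on bounded sets -/

section G

variable {S N : (ℝ → ℝ) → ℝ → Prop} {γ M d : ℝ} {X Z : State}

lemma Bnd₂.smul (hp : NormPair S N) {f : ℝ → ℝ} {c : ℝ} (hf : Bnd₂ S N c f) (a : ℝ) :
    Bnd₂ S N (|a| * c) (fun x => a * f x) := ⟨hp.S_smul a hf.S, hp.N_smul a hf.N⟩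

lemma P_sub_bnd (hp : PotPair S N) (hX : Bnd S N M X) (hZ : Bnd S N M Z)
    (hd : Bnd S N d (X - Z)) :
    Bnd₂ S N (potLip γ M * d) (fun ξ => P γ X ξ - P γ Z ξ) := by
  have h := hp.pot_sub (θ := fun _ => 1) (γ := γ) measurable_const (by simp) hX hZ hd
  have h0 := hp.S_nonneg h.S
  have h2 := (h.smul hp.toNormPair (1 / 2)).mono hp.toNormPair (c := potLip γ M * d) (by
    rw [abs_of_pos (by norm_num)]; linarith)
  simpa only [P_eq, mul_sub] using h2

lemma Q_sub_bnd (hp : PotPair S N) (hX : Bnd S N M X) (hZ : Bnd S N M Z)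
    (hd : Bnd S N d (X - Z)) :
    Bnd₂ S N (potLip γ M * d) (fun ξ => Q γ X ξ - Q γ Z ξ) := by
  have h := hp.pot_sub (θ := Real.sign) (γ := γ) measurable_sign abs_sign_le hX hZ hd
  have h0 := hp.S_nonneg h.S
  have h2 := (h.smul hp.toNormPair (-(1 / 2))).mono hp.toNormPair (c := potLip γ M * d) (by
    rw [abs_neg, abs_of_pos (by norm_num)]; linarith)
  simpa only [Q_eq, mul_sub] using h2

lemma P_zero (ξ : ℝ) : P γ 0 ξ = 0 := by simp [P_eq]

lemma Q_zero (ξ : ℝ) : Q γ 0 ξ = 0 := by simp [Q_eq]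

lemma P_bnd (hp : PotPair S N) (hX : Bnd S N M X) : Bnd₂ S N (potLip γ M * M) (P γ X) := by
  have := P_sub_bnd (γ := γ) hp hX (Bnd.zero hp.toNormPair (hX.nonneg hp.toNormPair)) (d := M)
    (by simpa using hX)
  simpa [P_zero] using this

lemma Q_bnd (hp : PotPair S N) (hX : Bnd S N M X) : Bnd₂ S N (potLip γ M * M) (Q γ X) := by
  have := Q_sub_bnd (γ := γ) hp hX (Bnd.zero hp.toNormPair (hX.nonneg hp.toNormPair)) (d := M)
    (by simpa using hX)
  simpa [Q_zero] using this

/-- Lipschitz constant of the vector fields on bounded sets. -/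
def GLip (γ M : ℝ) : ℝ := rhsLip γ M (potLip γ M * M) * (1 + potLip γ M)

lemma GLip_nonneg (hM : 0 ≤ M) : 0 ≤ GLip γ M := by
  have h1 := potLip_nonneg (γ := γ) hM
  have h2 := rhsLip_nonneg (γ := γ) hM (mul_nonneg h1 hM)
  unfold GLip; positivity

lemma G_sub_bnd (hp : PotPair S N) (hX : Bnd S N M X) (hZ : Bnd S N M Z)
    (hd : Bnd S N d (X - Z)) : Bnd S N (GLip γ M * d) (G γ X - G γ Z) := by
  have h := rhs_sub_bnd (γ := γ) hp.toNormPair hX hZ hd (P_bnd (γ := γ) hp hZ)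
    (Q_bnd (γ := γ) hp hZ) (P_sub_bnd (γ := γ) hp hX hZ hd) (Q_sub_bnd (γ := γ) hp hX hZ hd)
  have e : GLip γ M * d = rhsLip γ M (potLip γ M * M) * (d + potLip γ M * d) := by
    unfold GLip; ring
  rw [e]
  exact h

lemma G_zero : G γ 0 = 0 := by
  have h1 : P γ 0 = fun _ => 0 := funext P_zero
  have h2 : Q γ 0 = fun _ => 0 := funext Q_zero
  rw [G, h1, h2, rhs_zero]

lemma G_bnd (hp : PotPair S N) (hX : Bnd S N M X) : Bnd S N (GLip γ M * M) (G γ X) := by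
  have := G_sub_bnd (γ := γ) hp hX (Bnd.zero hp.toNormPair (hX.nonneg hp.toNormPair)) (d := M)
    (by simpa using hX)
  simpa [G_zero] using this

lemma MemF.exists_fBnd (hX : MemF X) : ∃ M, 0 ≤ M ∧ FBnd M X :=
  ⟨(normF X).toReal, ENNReal.toReal_nonneg,
    hX.fBnd ENNReal.toReal_nonneg (by rw [ENNReal.ofReal_toReal hX.normF_ne_top])⟩

lemma MemF.G (hX : MemF X) : MemF (G γ X) := by
  obtain ⟨M, _, h⟩ := hX.exists_fBnd
  exact (G_bnd potPair_essSup_l2 h).memF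

/-- `G` is Lipschitz on bounded subsets of `F`. -/
lemma normF_G_sub_le (hX : FBnd M X) (hZ : FBnd M Z) :
    normF (HyperelasticRod.G γ X - HyperelasticRod.G γ Z) ≤
      ENNReal.ofReal (7 * GLip γ M) * normF (X - Z) := by
  have hXZ := hX.memF.sub hZ.memF
  have h := (G_sub_bnd (γ := γ) potPair_essSup_l2 hX hZ
    (hXZ.fBnd ENNReal.toReal_nonneg (ENNReal.ofReal_toReal hXZ.normF_ne_top).ge)).normF_le
  have M0 := GLip_nonneg (γ := γ) (hX.nonneg normPair_essSup_l2)
  rw [← mul_assoc, ENNReal.ofReal_mul (by positivity),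
    ENNReal.ofReal_toReal hXZ.normF_ne_top] at h
  exact h

end G

/-! ### Grid functions -/

section Grid

variable {Δ : ℝ} {N : ℕ} {f g : ℝ → ℝ}

lemma mem_cell (hΔ : 0 < Δ) (ξ : ℝ) :
    ξ ∈ Ico ((⌊ξ / Δ⌋ : ℝ) * Δ) ((⌊ξ / Δ⌋ + 1 : ℝ) * Δ) := by
  constructor
  · exact (le_div_iff₀ hΔ).1 (Int.floor_le _)
  · exact (div_lt_iff₀ hΔ).1 (Int.lt_floor_add_one _)

lemma mem_cell_iff (hΔ : 0 < Δ) (i : ℤ) (ξ : ℝ) :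
    ξ ∈ Ico ((i : ℝ) * Δ) ((i + 1 : ℝ) * Δ) ↔ ⌊ξ / Δ⌋ = i := by
  rw [Int.floor_eq_iff, mem_Ico, le_div_iff₀ hΔ, div_lt_iff₀ hΔ]

lemma isStep_iff (hΔ : 0 < Δ) : IsStep Δ f ↔ ∀ ξ, f ξ = f (⌊ξ / Δ⌋ * Δ) := by
  constructor
  · intro h ξ
    exact h _ ξ (mem_cell hΔ ξ)
  · intro h i ξ hξ
    rw [h ξ, (mem_cell_iff hΔ i ξ).1 hξ]

lemma floor_grid (hΔ : 0 < Δ) (i : ℤ) : ⌊(i * Δ : ℝ) / Δ⌋ = i := by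
  rw [mul_div_cancel_right₀ _ hΔ.ne', Int.floor_intCast]

lemma sampleCut_eq (hΔ : 0 < Δ) (ξ : ℝ) :
    sampleCut Δ N f ξ =
      if -(N : ℤ) ≤ ⌊ξ / Δ⌋ ∧ ⌊ξ / Δ⌋ < N then f (⌊ξ / Δ⌋ * Δ) else 0 := by
  unfold sampleCut
  have h : ∀ i ∈ Finset.Ico (-(N : ℤ)) (N : ℤ),
      (Ico ((i : ℝ) * Δ) (((i : ℝ) + 1) * Δ)).indicator (fun _ => f (i * Δ)) ξ =
        if i = ⌊ξ / Δ⌋ then f (i * Δ) else 0 := by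
    intro i _
    rw [indicator_apply]
    simp only [mem_cell_iff hΔ, eq_comm]
  rw [Finset.sum_congr rfl h, Finset.sum_ite_eq']
  simp only [Finset.mem_Ico]

lemma floor_mem_iff (hΔ : 0 < Δ) (ξ : ℝ) :
    (-(N : ℤ) ≤ ⌊ξ / Δ⌋ ∧ ⌊ξ / Δ⌋ < N) ↔ ξ ∈ Ico (-(N * Δ)) (N * Δ) := by
  rw [Int.le_floor, Int.floor_lt, le_div_iff₀ hΔ, div_lt_iff₀ hΔ, mem_Ico]
  push_cast
  rw [neg_mul]

lemma isStep_sampleCut (hΔ : 0 < Δ) : IsStep Δ (sampleCut Δ N f) := by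
  rw [isStep_iff hΔ]
  intro ξ
  rw [sampleCut_eq hΔ, sampleCut_eq hΔ, floor_grid hΔ]

lemma sampleCut_of_notMem (hΔ : 0 < Δ) {ξ : ℝ} (h : ξ ∉ Ico (-(N * Δ)) (N * Δ)) :
    sampleCut Δ N f ξ = 0 := by
  rw [sampleCut_eq hΔ, if_neg (by rwa [floor_mem_iff hΔ])]

lemma sampleCut_of_mem (hΔ : 0 < Δ) {ξ : ℝ} (h : ξ ∈ Ico (-(N * Δ)) (N * Δ)) :
    sampleCut Δ N f ξ = f (⌊ξ / Δ⌋ * Δ) := by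
  rw [sampleCut_eq hΔ, if_pos (by rwa [floor_mem_iff hΔ])]

lemma measurable_sampleCut : Measurable (sampleCut Δ N f) := by
  unfold sampleCut
  refine Finset.measurable_sum _ fun i _ => ?_
  exact measurable_const.indicator measurableSet_Ico

lemma IsStep.measurable (hΔ : 0 < Δ) (h : IsStep Δ f) : Measurable f := by
  have e : f = (fun n : ℤ => f (n * Δ)) ∘ fun ξ => ⌊ξ / Δ⌋ := by
    funext ξ
    exact (isStep_iff hΔ).1 h ξ
  rw [e]
  exact measurable_from_top.comp (Int.measurable_floor.comp (by fun_prop))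

lemma volume_cell (i : ℤ) : volume (Ico ((i : ℝ) * Δ) ((i + 1 : ℝ) * Δ)) = ENNReal.ofReal Δ := by
  rw [Real.volume_Ico]; congr 1; ring

/-- A violation at one point would persist on its whole cell, which has positive measure. -/
lemma IsStep.abs_le_of_ae (hΔ : 0 < Δ) (h : IsStep Δ f) {c : ℝ} (hc : ∀ᵐ ξ, |f ξ| ≤ c) (ξ : ℝ) :
    |f ξ| ≤ c := by
  by_contra hlt
  have h0 : volume (Ico ((⌊ξ / Δ⌋ : ℝ) * Δ) ((⌊ξ / Δ⌋ + 1 : ℝ) * Δ)) = 0 := by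
    refine measure_mono_null (fun η hη => ?_) hc
    simp only [mem_compl_iff, mem_ofPred_eq]
    rwa [h _ η hη, ← h _ ξ (mem_cell hΔ ξ)]
  rw [volume_cell, ENNReal.ofReal_eq_zero] at h0
  linarith

/-- The inverse inequality for step functions: one cell alone contributes `|f ξ| √Δ` to the norm. It
degenerates as `Δ → 0` and serves only for existence on a fixed grid, not for the error estimate. -/
lemma IsStep.abs_le_of_l2 (hΔ : 0 < Δ) (h : IsStep Δ f) {c : ℝ} (hc : L2Le f c) (ξ : ℝ) :
    |f ξ| ≤ c / √Δ := by
  set I := Ico ((⌊ξ / Δ⌋ : ℝ) * Δ) ((⌊ξ / Δ⌋ + 1 : ℝ) * Δ)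
  have h1 : eLpNorm (I.indicator fun _ => f ξ) 2 volume ≤ ENNReal.ofReal c := by
    refine (eLpNorm_mono (fun η => ?_)).trans hc.2.2
    by_cases hη : η ∈ I
    · rw [indicator_of_mem hη, h _ η hη, ← h _ ξ (mem_cell hΔ ξ)]
    · rw [indicator_of_notMem hη]; simp
  rw [eLpNorm_indicator_const measurableSet_Ico (by norm_num) (by norm_num), volume_cell,
    Real.enorm_eq_ofReal_abs, ENNReal.ofReal_rpow_of_pos hΔ, ← ENNReal.ofReal_mul (abs_nonneg _),
    ENNReal.ofReal_le_ofReal_iff hc.2.1] at h1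
  rw [le_div_iff₀ (Real.sqrt_pos.2 hΔ), Real.sqrt_eq_rpow]
  simpa using h1

end Grid

/-! ### The error of sampling a potential -/

/-- `θ` is constant on either half line. -/
structure IsSignLike (θ : ℝ → ℝ) : Prop where
  meas : Measurable θ
  bound : ∀ x, |θ x| ≤ 1
  pos : ∀ x y, 0 < x → 0 < y → θ x = θ y
  neg : ∀ x y, x < 0 → y < 0 → θ x = θ y

lemma isSignLike_one : IsSignLike fun _ => 1 :=
  ⟨measurable_const, by simp, fun _ _ _ _ => rfl, fun _ _ _ _ => rfl⟩

lemma isSignLike_sign : IsSignLike Real.sign :=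
  ⟨measurable_sign, abs_sign_le, fun _ _ h h' => by rw [Real.sign_of_pos h, Real.sign_of_pos h'],
    fun _ _ h h' => by rw [Real.sign_of_neg h, Real.sign_of_neg h']⟩

/-- The kernel which controls the error of sampling. -/
def sampleKer (M Δ : ℝ) (x : ℝ) : ℝ :=
  3 * Δ * Real.exp (2 * M) * Real.exp (-|x|) + 2 * (Icc 0 Δ).indicator (fun _ => 1) x

lemma measurable_sampleKer (M Δ : ℝ) : Measurable (sampleKer M Δ) :=
  (measurable_exp_neg_abs.const_mul _).add
    ((measurable_const.indicator measurableSet_Icc).const_mul _)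

/-- The exponential part has norm of order `Δ` for both exponents. The indicator of an interval of
length `Δ` has L¹ norm `Δ` but L² norm `√Δ`, so the rate `√Δ` is dictated by the sup norm of the
sampling error. -/
lemma eLpNorm_sampleKer_le {M Δ : ℝ} (hΔ : 0 ≤ Δ) (hΔ1 : Δ ≤ 1) {p : ℝ≥0∞} (hp : p = 1 ∨ p = 2) :
    eLpNorm (sampleKer M Δ) p volume ≤ ENNReal.ofReal ((6 * Real.exp (2 * M) + 2) * √Δ) := by
  have hΔs : Δ ≤ √Δ := by
    rw [Real.le_sqrt hΔ hΔ]; nlinarith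
  have hp1 : 1 ≤ p := by rcases hp with h | h <;> simp [h]
  have h1 : eLpNorm (fun x => (3 * Δ * Real.exp (2 * M)) • Real.exp (-|x|)) p volume ≤
      ENNReal.ofReal (6 * Real.exp (2 * M) * √Δ) := by
    rw [show (fun x => (3 * Δ * Real.exp (2 * M)) • Real.exp (-|x|)) =
      (3 * Δ * Real.exp (2 * M)) • fun x => Real.exp (-|x|) from rfl, eLpNorm_const_smul]
    have : eLpNorm (fun x : ℝ => Real.exp (-|x|)) p volume ≤ ENNReal.ofReal 2 := by
      rcases hp with rfl | rfl
      exacts [eLpNorm_one_exp_neg_abs.le, eLpNorm_two_exp_neg_abs_le]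
    refine (mul_le_mul' le_rfl this).trans ?_
    rw [Real.enorm_eq_ofReal (by positivity), ← ENNReal.ofReal_mul (by positivity)]
    apply ENNReal.ofReal_le_ofReal
    nlinarith [Real.exp_pos (2 * M)]
  have h2 : eLpNorm (fun x => (2 : ℝ) • (Icc 0 Δ).indicator (fun _ => (1 : ℝ)) x) p volume ≤
      ENNReal.ofReal (2 * √Δ) := by
    rw [show (fun x => (2 : ℝ) • (Icc 0 Δ).indicator (fun _ => (1 : ℝ)) x) =
      (2 : ℝ) • (Icc 0 Δ).indicator (fun _ => (1 : ℝ)) from rfl, eLpNorm_const_smul]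
    have : eLpNorm ((Icc 0 Δ).indicator (fun _ => (1 : ℝ))) p volume ≤ ENNReal.ofReal (√Δ) := by
      rcases hp with rfl | rfl
      · rw [eLpNorm_indicator_const measurableSet_Icc (by norm_num) (by norm_num), Real.volume_Icc]
        simpa using ENNReal.ofReal_le_ofReal hΔs
      · rw [eLpNorm_indicator_const measurableSet_Icc (by norm_num) (by norm_num), Real.volume_Icc,
          sub_zero, ENNReal.ofReal_rpow_of_nonneg hΔ (by norm_num), Real.sqrt_eq_rpow]
        simp
    refine (mul_le_mul' le_rfl this).trans ?_
    rw [Real.enorm_eq_ofReal (by positivity), ← ENNReal.ofReal_mul (by positivity)]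
  have hm1 : AEStronglyMeasurable (fun x => (3 * Δ * Real.exp (2 * M)) • Real.exp (-|x|)) volume :=
    (measurable_exp_neg_abs.const_mul _).aestronglyMeasurable
  have hm2 : AEStronglyMeasurable
      (fun x => (2 : ℝ) • (Icc 0 Δ).indicator (fun _ => (1 : ℝ)) x) volume :=
    ((measurable_const.indicator measurableSet_Icc).const_mul _).aestronglyMeasurable
  refine (eLpNorm_add_le hm1 hm2 hp1).trans ((add_le_add h1 h2).trans_eq ?_)
  rw [← ENNReal.ofReal_add (by positivity) (by positivity)]
  congr 1; ring

lemma ker_of_lt {Y : State} {ξ η : ℝ} (h : η < ξ) : ker Y ξ η = Real.exp (-(Y.y ξ - Y.y η)) := by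
  rw [ker, Real.sign_of_pos (sub_pos.2 h), one_mul]

lemma ker_of_gt {Y : State} {ξ η : ℝ} (h : ξ < η) : ker Y ξ η = Real.exp (Y.y ξ - Y.y η) := by
  rw [ker, Real.sign_of_neg (sub_neg.2 h)]; ring_nf

lemma abs_sub_exp_neg_mul_le {a k : ℝ} (hk : 0 ≤ k) (ha : 0 ≤ a) :
    |k - Real.exp (-a) * k| ≤ a * k := by
  have h1 : Real.exp (-a) ≤ 1 := Real.exp_le_one_iff.2 (by linarith)
  have h2 := Real.add_one_le_exp (-a)
  rw [abs_of_nonneg (by nlinarith)]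
  nlinarith

/-- As `ζ` is constant between the sampling point `c` and `ξ`, one has `y(ξ) - y(c) = ξ - c ≤ Δ`.
For `η` outside `[c, ξ]` the sign does not change and the two kernels differ by a factor
`e^{±(ξ-c)}`. For `η` inside, `θ` may jump, but both kernels are at most 1, so the error is at most
2 on an interval of length at most `Δ`. -/
lemma abs_ker_sub_sample_le {θ : ℝ → ℝ} (hθ : IsSignLike θ) {Z : State} {M Δ c ξ η : ℝ}
    (hΔ1 : Δ ≤ 1) (hξ : ξ ∈ Ico c (c + Δ)) (hconst : ∀ η ∈ Icc c ξ, Z.ζ η = Z.ζ c)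
    (hc : |Z.ζ c| ≤ M) (hη : |Z.ζ η| ≤ M) (h1 : η ≠ c) (h2 : η ≠ ξ) :
    |θ (ξ - η) * ker Z ξ η - θ (c - η) * ker Z c η| ≤ sampleKer M Δ (ξ - η) := by
  have hξc : Z.ζ ξ = Z.ζ c := hconst ξ ⟨hξ.1, le_rfl⟩
  have hξM : |Z.ζ ξ| ≤ M := hξc ▸ hc
  have hy : Z.y ξ = Z.y c + (ξ - c) := by simp only [State.y, hξc]; ring
  have hd0 : 0 ≤ ξ - c := by linarith [hξ.1]
  have hd1 : ξ - c ≤ Δ := by linarith [hξ.2]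
  have hind : 0 ≤ (Icc 0 Δ).indicator (fun _ => (1 : ℝ)) (ξ - η) :=
    indicator_nonneg (fun _ _ => zero_le_one) _
  have hE := Real.exp_pos (-|ξ - η|)
  have hEM := Real.exp_pos (2 * M)
  have hk := ker_le hξM hη
  have hk0 := ker_pos Z ξ η
  have hcase : ∀ {a b : ℝ}, |a - b| ≤ 3 * Δ * ker Z ξ η → ∀ t, |t| ≤ 1 →
      |t * a - t * b| ≤ sampleKer M Δ (ξ - η) := by
    intro a b hab t ht
    rw [← mul_sub, abs_mul]
    have h3 : 3 * Δ * ker Z ξ η ≤ 3 * Δ * (Real.exp (2 * M) * Real.exp (-|ξ - η|)) :=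
      mul_le_mul_of_nonneg_left hk (by linarith)
    calc |t| * |a - b| ≤ 1 * |a - b| := mul_le_mul_of_nonneg_right ht (abs_nonneg _)
      _ ≤ sampleKer M Δ (ξ - η) := by
        unfold sampleKer
        nlinarith
  rcases lt_or_gt_of_ne h1 with hlt | hgt
  · have hlt2 : η < ξ := hlt.trans_le hξ.1
    rw [hθ.pos (ξ - η) (c - η) (by linarith) (by linarith)]
    refine hcase ?_ _ (hθ.bound _)
    have e : ker Z ξ η = Real.exp (-(ξ - c)) * ker Z c η := by
      rw [ker_of_lt hlt, ker_of_lt hlt2, ← Real.exp_add, hy]; ring_nf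
    have e2 : ker Z c η = Real.exp (ξ - c) * ker Z ξ η := by
      rw [e, ← mul_assoc, ← Real.exp_add]; simp
    have h3 := abs_sub_exp_neg_mul_le (ker_pos Z c η).le hd0
    rw [← e, abs_sub_comm] at h3
    -- For `η < c` the kernel at `c` is the larger one. Comparison with the kernel at `ξ` costs `e^Δ
    -- ≤ e ≤ 3`, which explains the 3 in `sampleKer`.
    have h4 : ker Z c η ≤ 3 * ker Z ξ η := by
      rw [e2]
      refine mul_le_mul_of_nonneg_right ?_ hk0.le
      calc Real.exp (ξ - c) ≤ Real.exp 1 := Real.exp_le_exp.2 (by linarith)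
        _ ≤ 3 := by linarith [Real.exp_one_lt_d9]
    have := ker_pos Z c η
    nlinarith
  · rcases lt_or_gt_of_ne h2 with hlt | hgt2
    · have hηI : η ∈ Icc c ξ := ⟨hgt.le, hlt.le⟩
      have k1 : ker Z ξ η ≤ 1 := by
        rw [ker_of_lt hlt]
        refine Real.exp_le_one_iff.2 ?_
        simp only [State.y, hξc, hconst η hηI]; linarith
      have k2 : ker Z c η ≤ 1 := by
        rw [ker_of_gt hgt]
        refine Real.exp_le_one_iff.2 ?_
        simp only [State.y, hconst η hηI]; linarith
      have hin : ξ - η ∈ Icc 0 Δ := ⟨by linarith, by linarith⟩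
      unfold sampleKer
      rw [indicator_of_mem hin]
      have b1 : |θ (ξ - η) * ker Z ξ η| ≤ 1 * 1 := by
        rw [abs_mul, abs_of_pos hk0]
        exact mul_le_mul (hθ.bound _) k1 hk0.le zero_le_one
      have b2 : |θ (c - η) * ker Z c η| ≤ 1 * 1 := by
        rw [abs_mul, abs_of_pos (ker_pos Z c η)]
        exact mul_le_mul (hθ.bound _) k2 (ker_pos _ _ _).le zero_le_one
      have b3 : 0 ≤ 3 * Δ * Real.exp (2 * M) * Real.exp (-|ξ - η|) := by
        have : 0 ≤ Δ := by linarith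
        positivity
      have := abs_sub (θ (ξ - η) * ker Z ξ η) (θ (c - η) * ker Z c η)
      linarith
    · rw [hθ.neg (ξ - η) (c - η) (by linarith) (by linarith)]
      refine hcase ?_ _ (hθ.bound _)
      have e : ker Z c η = Real.exp (-(ξ - c)) * ker Z ξ η := by
        rw [ker_of_gt hgt, ker_of_gt hgt2, ← Real.exp_add, hy]; ring_nf
      have h3 := abs_sub_exp_neg_mul_le hk0.le hd0
      rw [← e] at h3
      nlinarith

lemma abs_pot_sub_sample_le {θ : ℝ → ℝ} (hθ : IsSignLike θ) {γ : ℝ} {Z : State} {M Δ c ξ : ℝ}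
    (hΔ1 : Δ ≤ 1) (hξ : ξ ∈ Ico c (c + Δ)) (hconst : ∀ η ∈ Icc c ξ, Z.ζ η = Z.ζ c)
    (hM : ∀ η, |Z.ζ η| ≤ M) (hm : Measurable Z.ζ) {K : ℝ} (hs : L2Le (source γ Z) K) :
    |pot θ γ Z ξ - pot θ γ Z c| ≤ ∫ η, sampleKer M Δ (ξ - η) * |source γ Z η| := by
  have hi : ∀ x, Integrable (fun η => θ (x - η) * ker Z x η * source γ Z η) := fun x =>
    integrable_pot hθ.meas hθ.bound hm.aestronglyMeasurable (ae_of_all _ hM) (hM x) hs.1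
      (hs.integrable_smear x)
  have hΔ : 0 ≤ Δ := by linarith [hξ.1, hξ.2]
  have hk : MemLp (sampleKer M Δ) 2 volume := ⟨(measurable_sampleKer M Δ).aestronglyMeasurable,
    (eLpNorm_sampleKer_le hΔ hΔ1 (Or.inr rfl)).trans_lt ENNReal.ofReal_lt_top⟩
  rw [pot, pot, ← integral_sub (hi ξ) (hi c), ← Real.norm_eq_abs]
  refine norm_integral_le_of_norm_le (integrable_conv hk hs.abs.memLp ξ) ?_
  have hne : ∀ a : ℝ, ∀ᵐ η, η ≠ a := fun a => by simp [ae_iff]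
  filter_upwards [hne c, hne ξ] with η h1 h2
  rw [← sub_mul, norm_mul, Real.norm_eq_abs, Real.norm_eq_abs]
  exact mul_le_mul_of_nonneg_right
    (abs_ker_sub_sample_le hθ hΔ1 hξ hconst (hM c) (hM η) h1 h2) (abs_nonneg _)

/-- Constant in the estimate of the sampling error. -/
def sampleConst (γ M : ℝ) : ℝ := (6 * Real.exp (2 * M) + 2) * (sourceLip γ M * M)

/-- The sampling error is dominated by the convolution of `sampleKer` with `|source γ Z|`, to which
`L2Le.conv` applies. A majorant is provided rather than a bound for the error, since the cut-off is
still to be taken into account. -/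
lemma pot_sample_bnd {θ : ℝ → ℝ} (hθ : IsSignLike θ) {γ : ℝ} {Z : State} {M Δ : ℝ}
    (hΔ : 0 < Δ) (hΔ1 : Δ ≤ 1) (hZ : FBnd M Z) (hstep : IsStep Δ Z.ζ) :
    ∃ g : ℝ → ℝ, Bnd₂ EssLe L2Le (sampleConst γ M * √Δ) g ∧
      ∀ ξ, |pot θ γ Z ξ - pot θ γ Z (⌊ξ / Δ⌋ * Δ)| ≤ g ξ := by
  have hs := source_bnd (γ := γ) normPair_essSup_l2 hZ
  have h0 : 0 ≤ (6 * Real.exp (2 * M) + 2) * √Δ := by positivity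
  have h := L2Le.conv (measurable_sampleKer M Δ) h0
    (eLpNorm_sampleKer_le hΔ.le hΔ1 (Or.inl rfl)) (eLpNorm_sampleKer_le hΔ.le hΔ1 (Or.inr rfl))
    h0 hs.abs
  have e : sampleConst γ M * √Δ =
      (6 * Real.exp (2 * M) + 2) * √Δ * (sourceLip γ M * M) := by unfold sampleConst; ring
  rw [e]
  refine ⟨_, ⟨⟨h.1.1, ae_of_all _ h.2⟩, h.1⟩, fun ξ => ?_⟩
  have hc := mem_cell hΔ ξ
  refine abs_pot_sub_sample_le hθ hΔ1 ⟨hc.1, ?_⟩ (fun η hη => ?_) (hstep.abs_le_of_ae hΔ hZ.ζ.2)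
    (hstep.measurable hΔ) hs
  · linarith [hc.2]
  · exact hstep _ η ⟨hη.1, hη.2.trans_lt hc.2⟩

/-! ### Consistency of the discretised vector field -/

/-- The function `f` cut off inside `[-R, R)`. -/
def outside (R : ℝ) (f : ℝ → ℝ) : ℝ → ℝ := (Ico (-R) R)ᶜ.indicator f

/-- Inside `[-R, R)` the error passes through `g`: stability, then sampling of `g`. Outside, the
sampled function is zero and the whole of `f` is lost. Thus decay is required of `f` only, which is
a potential of the exact solution. -/
lemma sub_sampleCut_bnd {f g k : ℝ → ℝ} {a b c Δ : ℝ} {N : ℕ} (hΔ : 0 < Δ)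
    (hf : AEStronglyMeasurable f volume)
    (h1 : Bnd₂ EssLe L2Le a (fun ξ => f ξ - g ξ)) (h2 : Bnd₂ EssLe L2Le b k)
    (h3 : ∀ ξ, |g ξ - g (⌊ξ / Δ⌋ * Δ)| ≤ k ξ) (h4 : Bnd₂ EssLe L2Le c (outside (N * Δ) f)) :
    Bnd₂ EssLe L2Le (a + b + c) (fun ξ => f ξ - sampleCut Δ N g ξ) := by
  have hp := normPair_essSup_l2
  have hm : AEStronglyMeasurable (fun ξ => f ξ - sampleCut Δ N g ξ) volume :=
    hf.sub measurable_sampleCut.aestronglyMeasurable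
  have hle : ∀ ξ, |f ξ - sampleCut Δ N g ξ| ≤ |f ξ - g ξ| + k ξ + |outside (N * Δ) f ξ| := by
    intro ξ
    have k0 : 0 ≤ k ξ := (abs_nonneg _).trans (h3 ξ)
    by_cases hξ : ξ ∈ Ico (-(N * Δ)) (N * Δ)
    · rw [sampleCut_of_mem hΔ hξ]
      have := abs_add_le (f ξ - g ξ) (g ξ - g (⌊ξ / Δ⌋ * Δ))
      rw [sub_add_sub_cancel] at this
      have := h3 ξ
      have := abs_nonneg (outside (N * Δ) f ξ)
      linarith
    · rw [sampleCut_of_notMem hΔ hξ, sub_zero, outside, indicator_of_mem (by exact hξ)]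
      have := abs_nonneg (f ξ - g ξ)
      linarith
  have hS : EssLe (fun ξ => |f ξ - g ξ| + k ξ + |outside (N * Δ) f ξ|) (a + b + c) :=
    hp.S_add (hp.S_add ⟨h1.S.1.norm, by simpa using h1.S.2⟩ h2.S)
      ⟨h4.S.1.norm, by simpa using h4.S.2⟩
  have hN := hp.N_add (hp.N_add h1.N.abs h2.N) h4.N.abs
  exact ⟨hS.of_abs_le hm (ae_of_all _ hle), hN.of_abs_le hm (ae_of_all _ hle)⟩

lemma L2Le.of_support {f : ℝ → ℝ} {c R : ℝ} (hR : 0 ≤ R) (hf : SupLe f c)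
    (h0 : ∀ ξ, ξ ∉ Ico (-R) R → f ξ = 0) : L2Le f (c * √(2 * R)) := by
  refine ⟨hf.1.aestronglyMeasurable, mul_nonneg hf.nonneg (Real.sqrt_nonneg _), ?_⟩
  have h : eLpNorm f 2 volume ≤ eLpNorm ((Ico (-R) R).indicator fun _ => c) 2 volume := by
    refine eLpNorm_mono_real (fun ξ => ?_)
    by_cases hξ : ξ ∈ Ico (-R) R
    · rw [indicator_of_mem hξ]; exact hf.2 ξ
    · rw [indicator_of_notMem hξ, h0 ξ hξ]; simp
  refine h.trans_eq ?_
  rw [eLpNorm_indicator_const measurableSet_Ico (by norm_num) (by norm_num), Real.volume_Ico,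
    ENNReal.ofReal_rpow_of_nonneg (by linarith) (by norm_num), Real.enorm_eq_ofReal hf.nonneg,
    ← ENNReal.ofReal_mul hf.nonneg, Real.sqrt_eq_rpow]
  congr 2
  norm_num
  ring_nf

lemma exists_sampleCut_sup (Δ : ℝ) (N : ℕ) (f : ℝ → ℝ) : ∃ c, SupLe (sampleCut Δ N f) c := by
  refine ⟨∑ i ∈ Finset.Ico (-(N : ℤ)) (N : ℤ), |f (i * Δ)|, measurable_sampleCut, fun ξ => ?_⟩
  unfold sampleCut
  refine (Finset.abs_sum_le_sum_abs _ _).trans (Finset.sum_le_sum fun i _ => ?_)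
  by_cases h : ξ ∈ Ico ((i : ℝ) * Δ) (((i : ℝ) + 1) * Δ)
  · rw [indicator_of_mem h]
  · rw [indicator_of_notMem h]; simp

lemma exists_sampleCut_bnd {Δ : ℝ} (hΔ : 0 < Δ) (N : ℕ) (f : ℝ → ℝ) :
    ∃ B, Bnd₂ EssLe L2Le B (sampleCut Δ N f) := by
  obtain ⟨c, hc⟩ := exists_sampleCut_sup Δ N f
  have h := L2Le.of_support (R := N * Δ) (by positivity) hc
    (fun ξ hξ => sampleCut_of_notMem hΔ hξ)
  exact ⟨max c (c * √(2 * (N * Δ))), normPair_essSup_l2.S_mono hc.essLe (le_max_left _ _),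
    normPair_essSup_l2.N_mono h (le_max_right _ _)⟩

lemma MemF.Gdisc {γ Δ : ℝ} (hΔ : 0 < Δ) {N : ℕ} {Z : State} (hZ : MemF Z) :
    MemF (Gdisc γ Δ N Z) := by
  obtain ⟨M, _, h⟩ := hZ.exists_fBnd
  obtain ⟨B, hB⟩ := exists_sampleCut_bnd hΔ N (P γ Z)
  obtain ⟨B', hB'⟩ := exists_sampleCut_bnd hΔ N (Q γ Z)
  exact (rhs_bnd normPair_essSup_l2 h (hB.mono normPair_essSup_l2 (le_max_left B B'))
    (hB'.mono normPair_essSup_l2 (le_max_right B B'))).memF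

/-- The constant in front of the consistency error. -/
def consistConst (γ M : ℝ) : ℝ := 7 * (rhsLip γ M (potLip γ M * M) * (sampleConst γ M + 1))

/-- Stability and consistency in one estimate: a term proportional to the distance `d` for
Grönwall's inequality, plus the sampling error `√Δ` and the tail `ε` of the potentials of `Y`. -/
lemma normF_G_sub_Gdisc_le {γ Δ M d ε : ℝ} {N : ℕ} {Y Z : State} (hΔ : 0 < Δ) (hΔ1 : Δ ≤ 1)
    (hY : FBnd M Y) (hZ : FBnd M Z) (hd : FBnd d (Y - Z)) (hstep : IsStep Δ Z.ζ)
    (hP : Bnd₂ EssLe L2Le ε (outside (N * Δ) (P γ Y)))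
    (hQ : Bnd₂ EssLe L2Le ε (outside (N * Δ) (Q γ Y))) :
    normF (G γ Y - Gdisc γ Δ N Z) ≤
      ENNReal.ofReal (7 * GLip γ M * d + consistConst γ M * (√Δ + ε)) := by
  have hp := normPair_essSup_l2
  have hpp := potPair_essSup_l2
  have ε0 : 0 ≤ ε := hP.S.nonneg
  have M0 : 0 ≤ M := hY.nonneg hp
  obtain ⟨k1, hk1, hk1'⟩ := pot_sample_bnd (γ := γ) isSignLike_one hΔ hΔ1 hZ hstep
  obtain ⟨k2, hk2, hk2'⟩ := pot_sample_bnd (γ := γ) isSignLike_sign hΔ hΔ1 hZ hstep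
  have e1 : Bnd₂ EssLe L2Le (potLip γ M * d + sampleConst γ M * √Δ + ε)
      (fun ξ => P γ Y ξ - sampleCut Δ N (P γ Z) ξ) := by
    refine sub_sampleCut_bnd hΔ (P_bnd (γ := γ) hpp hY).S.1 (P_sub_bnd hpp hY hZ hd) hk1
      (fun ξ => ?_) hP
    rw [P_eq, P_eq, ← mul_sub, abs_mul, abs_of_pos (by norm_num)]
    have := hk1' ξ
    have := abs_nonneg (pot (fun _ => 1) γ Z ξ - pot (fun _ => 1) γ Z (⌊ξ / Δ⌋ * Δ))
    linarith
  have e2 : Bnd₂ EssLe L2Le (potLip γ M * d + sampleConst γ M * √Δ + ε)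
      (fun ξ => Q γ Y ξ - sampleCut Δ N (Q γ Z) ξ) := by
    refine sub_sampleCut_bnd hΔ (Q_bnd (γ := γ) hpp hY).S.1 (Q_sub_bnd hpp hY hZ hd) hk2
      (fun ξ => ?_) hQ
    rw [Q_eq, Q_eq, ← mul_sub, abs_mul, abs_neg, abs_of_pos (by norm_num)]
    have := hk2' ξ
    have := abs_nonneg (pot Real.sign γ Z ξ - pot Real.sign γ Z (⌊ξ / Δ⌋ * Δ))
    linarith
  have flip : ∀ {f g : ℝ → ℝ} {c : ℝ}, Bnd₂ EssLe L2Le c (fun ξ => f ξ - g ξ) →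
      Bnd₂ EssLe L2Le c (fun ξ => g ξ - f ξ) := fun h => by
    simpa using h.smul hp (-1)
  have h := (rhs_sub_bnd (γ := γ) hp hZ hY (hd.sub_comm hp) (P_bnd (γ := γ) hpp hY)
    (Q_bnd (γ := γ) hpp hY) (flip e1) (flip e2)).normF_le
  rw [normF_sub_comm]
  refine h.trans (ENNReal.ofReal_le_ofReal ?_)
  have hr := rhsLip_nonneg (γ := γ) M0 (mul_nonneg (potLip_nonneg (γ := γ) M0) M0)
  have hs : 0 ≤ sampleConst γ M := by
    have := sourceLip_nonneg (γ := γ) M0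
    unfold sampleConst; positivity
  have h3 : 0 ≤ sampleConst γ M * ε := by positivity
  have h4 : 0 ≤ √Δ := Real.sqrt_nonneg _
  unfold GLip consistConst
  have : rhsLip γ M (potLip γ M * M) * (sampleConst γ M * √Δ + ε) ≤
      rhsLip γ M (potLip γ M * M) * ((sampleConst γ M + 1) * (√Δ + ε)) :=
    mul_le_mul_of_nonneg_left (by nlinarith) hr
  linarith

/-! ### A Grönwall estimate for solutions in `F` -/

/-- The norm of `F` as a real number. -/
def nF (Y : State) : ℝ := (normF Y).toReal

lemma ofReal_nF {Y : State} (h : MemF Y) : ENNReal.ofReal (nF Y) = normF Y :=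
  ENNReal.ofReal_toReal h.normF_ne_top

lemma nF_nonneg (Y : State) : 0 ≤ nF Y := ENNReal.toReal_nonneg

lemma tendsto_nF_of_normF {ι : Type*} {l : Filter ι} {f : ι → State}
    (h : Tendsto (fun i => normF (f i)) l (𝓝 0)) : Tendsto (fun i => nF (f i)) l (𝓝 0) := by
  have := (ENNReal.tendsto_toReal ENNReal.zero_ne_top).comp h
  rwa [ENNReal.toReal_zero] at this

lemma nF_add_le {X Z : State} (hX : MemF X) (hZ : MemF Z) : nF (X + Z) ≤ nF X + nF Z := by
  unfold nF
  rw [← ENNReal.toReal_add hX.normF_ne_top hZ.normF_ne_top]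
  exact ENNReal.toReal_mono (ENNReal.add_ne_top.2 ⟨hX.normF_ne_top, hZ.normF_ne_top⟩)
    (normF_add_le hX hZ)

lemma nF_smul (c : ℝ) (X : State) : nF (c • X) = |c| * nF X := by
  unfold nF
  rw [normF_smul, ENNReal.toReal_mul, toReal_enorm, Real.norm_eq_abs]

lemma nF_sub_le {X Z : State} (hX : MemF X) (hZ : MemF Z) : nF (X - Z) ≤ nF X + nF Z := by
  unfold nF
  rw [← ENNReal.toReal_add hX.normF_ne_top hZ.normF_ne_top]
  exact ENNReal.toReal_mono (ENNReal.add_ne_top.2 ⟨hX.normF_ne_top, hZ.normF_ne_top⟩)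
    (normF_sub_le hX hZ)

/-- Grönwall's inequality, in a form which needs the differential inequality only as long as the
function is at most `1`. -/
lemma le_of_liminf_deriv_right_le_of_le_one {f f' : ℝ → ℝ} {δ L e τ : ℝ} (hL : 0 ≤ L)
    (he : 0 ≤ e) (hδ : 0 ≤ δ) (hf : ContinuousOn f (Icc 0 τ))
    (hf' : ∀ x ∈ Ico 0 τ, ∀ r, f' x < r → ∃ᶠ z in 𝓝[>] x, (z - x)⁻¹ * (f z - f x) < r)
    (h0 : f 0 ≤ δ) (bound : ∀ x ∈ Ico 0 τ, f x ≤ 1 → f' x ≤ L * f x + e)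
    (small : (δ + e * τ) * Real.exp (L * τ) ≤ 1 / 2) :
    ∀ x ∈ Icc 0 τ, f x ≤ (δ + e * τ) * Real.exp (L * τ) := by
  have gb : ∀ x ∈ Icc 0 τ, gronwallBound δ L e x ≤ (δ + e * τ) * Real.exp (L * τ) := by
    intro x hx
    have h1 : 1 ≤ Real.exp (L * x) := Real.one_le_exp (mul_nonneg hL hx.1)
    have h2 : Real.exp (L * x) ≤ Real.exp (L * τ) :=
      Real.exp_le_exp.2 (mul_le_mul_of_nonneg_left hx.2 hL)
    have h3 : gronwallBound δ L e x ≤ (δ + e * x) * Real.exp (L * x) := by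
      rcases hL.eq_or_lt with rfl | hL
      · simp [gronwallBound_K0]
      · rw [gronwallBound_of_K_ne_0 hL.ne']
        have h4 : Real.exp (L * x) - 1 ≤ L * x * Real.exp (L * x) := by
          have h := Real.add_one_le_exp (-(L * x))
          have e1 : Real.exp (-(L * x)) * Real.exp (L * x) = 1 := by
            rw [← Real.exp_add]; simp
          nlinarith [Real.exp_pos (L * x)]
        have h5 : e / L * (Real.exp (L * x) - 1) ≤ e / L * (L * x * Real.exp (L * x)) :=
          mul_le_mul_of_nonneg_left h4 (by positivity)
        have h6 : e / L * (L * x * Real.exp (L * x)) = e * x * Real.exp (L * x) := by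
          field_simp
        simp only
        linarith
    refine h3.trans (mul_le_mul ?_ h2 (Real.exp_pos _).le ?_)
    · linarith [mul_le_mul_of_nonneg_left hx.2 he]
    · have := mul_nonneg he (hx.1.trans hx.2)
      linarith
  have main : ∀ σ ∈ Icc 0 τ, (∀ x ∈ Ico 0 σ, f x ≤ 1) →
      f σ ≤ (δ + e * τ) * Real.exp (L * τ) := by
    intro σ hσ h1
    have hsub : Ico 0 σ ⊆ Ico 0 τ := Ico_subset_Ico_right hσ.2
    have := le_gronwallBound_of_liminf_deriv_right_le (δ := δ) (K := L) (ε := e)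
      (hf.mono (Icc_subset_Icc_right hσ.2)) (fun x hx => hf' x (hsub hx)) h0
      (fun x hx => bound x (hsub hx) (h1 x hx)) σ ⟨hσ.1, le_rfl⟩
    rw [sub_zero] at this
    exact this.trans (gb σ hσ)
  have all : ∀ x ∈ Icc 0 τ, f x ≤ 1 := by
    by_contra hcon
    push Not at hcon
    -- At the first time where `f` reaches 1 the Grönwall bound is already available, because `f ≤
    -- 1` before; but that bound is at most 1/2.
    obtain ⟨t, ht, hft⟩ := hcon
    have hK : IsCompact (Icc 0 τ ∩ f ⁻¹' Ici 1) :=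
      isCompact_Icc.of_isClosed_subset (hf.preimage_isClosed_of_isClosed isClosed_Icc isClosed_Ici)
        inter_subset_left
    obtain ⟨σ, hσ, hmin⟩ := hK.exists_isLeast ⟨t, ht, hft.le⟩
    have hσ1 : 1 ≤ f σ := hσ.2
    have := main σ hσ.1 fun x hx => by
      by_contra hx1
      have := hmin ⟨⟨hx.1, hx.2.le.trans hσ.1.2⟩, (not_le.1 hx1).le⟩
      linarith [hx.2]
    linarith
  exact fun x hx => main x hx fun y hy => all y ⟨hy.1, hy.2.le.trans hx.2⟩

section Solutions

variable {V W : State → State} {τ : ℝ} {X₀ Z₀ : State} {X Z : ℝ → State}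

lemma IsSolution.tendsto_nF (hX : IsSolution V τ X₀ X)
    (hV : ∀ t ∈ Icc 0 τ, MemF (V (X t))) {t : ℝ} (ht : t ∈ Icc 0 τ) :
    Tendsto (fun s => nF (X s - X t)) (𝓝[Icc 0 τ] t) (𝓝 0) := by
  have h1 := hX.hasDeriv t ht
  have h2 : Tendsto (fun s => nF ((s - t)⁻¹ • (X s - X t) - V (X t))) (𝓝[Icc 0 τ \ {t}] t) (𝓝 0) :=
    tendsto_nF_of_normF h1
  have h3 : Tendsto (fun s => |s - t| *
      (nF ((s - t)⁻¹ • (X s - X t) - V (X t)) + nF (V (X t)))) (𝓝[Icc 0 τ \ {t}] t) (𝓝 0) := by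
    have h4 : Tendsto (fun s => |s - t|) (𝓝[Icc 0 τ \ {t}] t) (𝓝 0) := by
      have : Continuous fun s : ℝ => |s - t| := by fun_prop
      simpa using (this.tendsto t).mono_left (nhdsWithin_le_nhds (s := Icc 0 τ \ {t}))
    simpa using h4.mul (h2.add_const (nF (V (X t))))
  have h5 : Tendsto (fun s => nF (X s - X t)) (𝓝[Icc 0 τ \ {t}] t) (𝓝 0) := by
    refine tendsto_of_tendsto_of_tendsto_of_le_of_le' tendsto_const_nhds h3
      (Eventually.of_forall fun s => nF_nonneg _) ?_
    filter_upwards [self_mem_nhdsWithin] with s hs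
    have hne : s - t ≠ 0 := sub_ne_zero.2 hs.2
    have e : X s - X t = (s - t) • (((s - t)⁻¹ • (X s - X t) - V (X t)) + V (X t)) := by
      rw [sub_add_cancel, smul_smul, mul_inv_cancel₀ hne, one_smul]
    have hm := ((hX.memF s hs.1).sub (hX.memF t ht)).smul (s - t)⁻¹
    calc nF (X s - X t)
        = |s - t| * nF (((s - t)⁻¹ • (X s - X t) - V (X t)) + V (X t)) := by
          rw [← nF_smul, ← e]
      _ ≤ _ := mul_le_mul_of_nonneg_left (nF_add_le (hm.sub (hV t ht)) (hV t ht)) (abs_nonneg _)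
  have h6 : 𝓝[Icc 0 τ] t ≤ 𝓝[Icc 0 τ \ {t}] t ⊔ pure t := by
    rw [← nhdsWithin_singleton, ← nhdsWithin_union]
    refine nhdsWithin_mono t ?_
    intro x hx
    by_cases hxt : x = t
    · exact Or.inr hxt
    · exact Or.inl ⟨hx, hxt⟩
  refine Tendsto.mono_left (Tendsto.sup h5 ?_) h6
  rw [tendsto_pure_left]
  intro s hs
  have : nF (X t - X t) = 0 := by simp [nF]
  rw [this]
  exact mem_of_mem_nhds hs

lemma abs_nF_sub_nF_le {A B C D : State} (hA : MemF A) (hB : MemF B) (hC : MemF C)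
    (hD : MemF D) : |nF (A - B) - nF (C - D)| ≤ nF (A - C) + nF (B - D) := by
  have h1 : nF (A - B) ≤ nF (C - D) + (nF (A - C) + nF (B - D)) := by
    have e : A - B = (C - D) + ((A - C) - (B - D)) := by abel
    rw [e]
    exact (nF_add_le (hC.sub hD) ((hA.sub hC).sub (hB.sub hD))).trans
      (add_le_add le_rfl (nF_sub_le (hA.sub hC) (hB.sub hD)))
  have h2 : nF (C - D) ≤ nF (A - B) + (nF (A - C) + nF (B - D)) := by
    have e : C - D = (A - B) - ((A - C) - (B - D)) := by abel
    rw [e]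
    exact (nF_sub_le (hA.sub hB) ((hA.sub hC).sub (hB.sub hD))).trans
      (add_le_add le_rfl (nF_sub_le (hA.sub hC) (hB.sub hD)))
  rw [abs_le]; constructor <;> linarith

/-- Stability: two solutions of nearby equations remain close. -/
theorem IsSolution.nF_sub_le (hX : IsSolution V τ X₀ X) (hZ : IsSolution W τ Z₀ Z)
    (hV : ∀ t ∈ Icc 0 τ, MemF (V (X t))) (hW : ∀ t ∈ Icc 0 τ, MemF (W (Z t)))
    {L e : ℝ} (hL : 0 ≤ L) (he : 0 ≤ e)
    (h : ∀ t ∈ Icc 0 τ, nF (X t - Z t) ≤ 1 →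
      nF (V (X t) - W (Z t)) ≤ L * nF (X t - Z t) + e)
    (small : (nF (X₀ - Z₀) + e * τ) * Real.exp (L * τ) ≤ 1 / 2) :
    ∀ t ∈ Icc 0 τ, nF (X t - Z t) ≤ (nF (X₀ - Z₀) + e * τ) * Real.exp (L * τ) := by
  refine le_of_liminf_deriv_right_le_of_le_one (f' := fun t => nF (V (X t) - W (Z t))) hL he
    (nF_nonneg _) ?_ ?_ (by rw [hX.init, hZ.init]) (fun t ht => h t (Ico_subset_Icc_self ht)) small
  · intro t ht
    have h1 := (hX.tendsto_nF hV ht).add (hZ.tendsto_nF hW ht)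
    rw [add_zero] at h1
    refine tendsto_iff_dist_tendsto_zero.2 (tendsto_of_tendsto_of_tendsto_of_le_of_le'
      tendsto_const_nhds h1 (Eventually.of_forall fun s => dist_nonneg) ?_)
    filter_upwards [self_mem_nhdsWithin] with s hs
    rw [Real.dist_eq]
    exact abs_nF_sub_nF_le (hX.memF s hs) (hZ.memF s hs) (hX.memF t ht) (hZ.memF t ht)
  · intro t ht r hr
    have htI := Ico_subset_Icc_self ht
    have hsub : 𝓝[>] t ≤ 𝓝[Icc 0 τ \ {t}] t := by
      rw [← nhdsWithin_Ioc_eq_nhdsGT ht.2]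
      exact nhdsWithin_mono t fun s hs => ⟨⟨ht.1.trans hs.1.le, hs.2⟩, hs.1.ne'⟩
    have h1 : Tendsto (fun s => nF ((s - t)⁻¹ • (X s - X t) - V (X t))) (𝓝[Icc 0 τ \ {t}] t)
        (𝓝 0) :=
      tendsto_nF_of_normF (hX.hasDeriv t htI)
    have h2 : Tendsto (fun s => nF ((s - t)⁻¹ • (Z s - Z t) - W (Z t))) (𝓝[Icc 0 τ \ {t}] t)
        (𝓝 0) :=
      tendsto_nF_of_normF (hZ.hasDeriv t htI)
    have h3 := ((h1.add h2).add_const (nF (V (X t) - W (Z t)))).mono_left hsub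
    rw [add_zero, zero_add] at h3
    -- By the triangle inequality, the difference quotient of the norm is at most the norm of the
    -- difference of the vector fields plus two remainders that tend to zero.
    refine Eventually.frequently ?_
    filter_upwards [h3.eventually_lt_const hr, self_mem_nhdsWithin,
      hsub self_mem_nhdsWithin] with s hs hst hsI
    have hpos : 0 < s - t := sub_pos.2 hst
    refine lt_of_le_of_lt ?_ hs
    rw [inv_mul_le_iff₀ hpos, sub_le_iff_le_add]
    have hVt := hV t htI
    have hWt := hW t htI
    have mX := (((hX.memF s hsI.1).sub (hX.memF t htI)).smul (s - t)⁻¹).sub hVt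
    have mZ := (((hZ.memF s hsI.1).sub (hZ.memF t htI)).smul (s - t)⁻¹).sub hWt
    have e1 : X s - Z s = (s - t) • ((((s - t)⁻¹ • (X s - X t) - V (X t)) -
        ((s - t)⁻¹ • (Z s - Z t) - W (Z t))) + (V (X t) - W (Z t))) + (X t - Z t) := by
      have : (s - t) • ((((s - t)⁻¹ • (X s - X t) - V (X t)) -
        ((s - t)⁻¹ • (Z s - Z t) - W (Z t))) + (V (X t) - W (Z t))) =
          ((s - t) * (s - t)⁻¹) • ((X s - X t) - (Z s - Z t)) := by module
      rw [this, mul_inv_cancel₀ hpos.ne', one_smul]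
      abel
    calc nF (X s - Z s) ≤ (s - t) * nF ((((s - t)⁻¹ • (X s - X t) - V (X t)) -
        ((s - t)⁻¹ • (Z s - Z t) - W (Z t))) + (V (X t) - W (Z t))) + nF (X t - Z t) := by
          conv_lhs => rw [e1]
          refine (nF_add_le (((mX.sub mZ).add (hVt.sub hWt)).smul _)
            ((hX.memF t htI).sub (hZ.memF t htI))).trans ?_
          rw [nF_smul, abs_of_pos hpos]
      _ ≤ _ := by
          refine add_le_add (mul_le_mul_of_nonneg_left ?_ hpos.le) le_rfl
          exact (nF_add_le (mX.sub mZ) (hVt.sub hWt)).trans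
            (add_le_add (HyperelasticRod.nF_sub_le mX mZ) le_rfl)

end Solutions

/-! ### Existence for ordinary differential equations under an a priori bound -/

section Banach

variable {E : Type*} [NormedAddCommGroup E]

/-- A cut-off function, `1` on the ball of radius `B` and `0` outside that of radius `B + 1`. -/
def cutoff (B : ℝ) (x : E) : ℝ := max 0 (min 1 (B + 1 - ‖x‖))

lemma cutoff_nonneg (B : ℝ) (x : E) : 0 ≤ cutoff B x := le_max_left _ _

lemma cutoff_le_one (B : ℝ) (x : E) : cutoff B x ≤ 1 := max_le zero_le_one (min_le_left _ _)

lemma cutoff_eq_one {B : ℝ} {x : E} (h : ‖x‖ ≤ B) : cutoff B x = 1 := by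
  rw [cutoff, min_eq_left (by linarith), max_eq_right zero_le_one]

lemma cutoff_eq_zero {B : ℝ} {x : E} (h : B + 1 ≤ ‖x‖) : cutoff B x = 0 := by
  rw [cutoff, max_eq_left]
  exact (min_le_right _ _).trans (by linarith)

lemma abs_cutoff_sub_le (B : ℝ) (x y : E) : |cutoff B x - cutoff B y| ≤ ‖x - y‖ := by
  have h1 : |cutoff B x - cutoff B y| ≤ |(B + 1 - ‖x‖) - (B + 1 - ‖y‖)| := by
    unfold cutoff
    rw [max_comm 0, max_comm 0, min_comm 1, min_comm 1]
    refine (abs_max_sub_max_le_abs _ _ _).trans ((abs_min_sub_min_le_max _ _ _ _).trans ?_)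
    simp
  refine h1.trans ?_
  rw [show (B + 1 - ‖x‖) - (B + 1 - ‖y‖) = -(‖x‖ - ‖y‖) by ring, abs_neg]
  exact abs_norm_sub_norm_le x y

/-- On the large ball this is the product rule for Lipschitz functions. If one point lies outside,
the cut-off vanishes there, and its own Lipschitz bound controls the value at the other point. -/
lemma exists_lipschitz_cutoff [NormedSpace ℝ E] {V : E → E} {B : ℝ} (hB : 0 ≤ B) {L : ℝ≥0}
    (hV : LipschitzOnWith L V (Metric.closedBall 0 (B + 1))) :
    ∃ b K : ℝ≥0, LipschitzWith K (fun x => cutoff B x • V x) ∧ ∀ x, ‖cutoff B x • V x‖ ≤ b := by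
  have hbound : ∀ x ∈ Metric.closedBall (0 : E) (B + 1), ‖V x‖ ≤ ‖V 0‖ + L * (B + 1) := by
    intro x hx
    have h1 := hV.dist_le_mul x hx 0 (Metric.mem_closedBall_self (by linarith))
    rw [dist_eq_norm] at h1
    have h2 := norm_le_norm_add_norm_sub' (V x) (V 0)
    have h3 : dist x 0 ≤ B + 1 := hx
    have := mul_le_mul_of_nonneg_left h3 L.2
    simp only [NNReal.val_eq_coe] at this
    linarith
  set b : ℝ≥0 := ⟨‖V 0‖ + L * (B + 1), by positivity⟩ with hb
  have hb' : (b : ℝ) = ‖V 0‖ + L * (B + 1) := rfl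
  have hzero : ∀ x ∉ Metric.closedBall (0 : E) (B + 1), cutoff B x = 0 := fun x hx =>
    cutoff_eq_zero (by simpa using (not_le.1 (by simpa using hx)).le)
  refine ⟨b, b + L, LipschitzWith.of_dist_le_mul fun x y => ?_, fun x => ?_⟩
  · have main : ∀ x y, y ∉ Metric.closedBall (0 : E) (B + 1) →
        ‖cutoff B x • V x - cutoff B y • V y‖ ≤ (b + L) * ‖x - y‖ := by
      intro x y hy
      rw [hzero y hy, zero_smul, sub_zero]
      by_cases hx : x ∈ Metric.closedBall (0 : E) (B + 1)
      · have h1 := abs_cutoff_sub_le B x y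
        rw [hzero y hy, sub_zero] at h1
        rw [norm_smul, Real.norm_eq_abs]
        have h2 := mul_le_mul h1 (hbound x hx) (norm_nonneg _) (norm_nonneg _)
        have := mul_nonneg L.2 (norm_nonneg (x - y))
        simp only [NNReal.val_eq_coe] at this
        rw [hb']
        linarith
      · rw [hzero x hx, zero_smul, norm_zero]; positivity
    rw [dist_eq_norm, dist_eq_norm]
    push_cast
    by_cases hy : y ∈ Metric.closedBall (0 : E) (B + 1)
    · by_cases hx : x ∈ Metric.closedBall (0 : E) (B + 1)
      · have e : cutoff B x • V x - cutoff B y • V y =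
            (cutoff B x - cutoff B y) • V x + cutoff B y • (V x - V y) := by module
        rw [e]
        refine (norm_add_le _ _).trans ?_
        rw [norm_smul, norm_smul, Real.norm_eq_abs, Real.norm_eq_abs,
          abs_of_nonneg (cutoff_nonneg B y), add_mul]
        refine add_le_add ?_ ?_
        · rw [mul_comm (b : ℝ), hb']
          exact mul_le_mul (abs_cutoff_sub_le B x y) (hbound x hx) (norm_nonneg _) (norm_nonneg _)
        · have h1 := hV.dist_le_mul x hx y hy
          rw [dist_eq_norm, dist_eq_norm] at h1
          calc cutoff B y * ‖V x - V y‖ ≤ 1 * ‖V x - V y‖ :=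
                mul_le_mul_of_nonneg_right (cutoff_le_one B y) (norm_nonneg _)
            _ ≤ _ := by rwa [one_mul]
      · rw [norm_sub_rev, norm_sub_rev x y]
        exact main y x hx
    · exact main x y hy
  · by_cases hx : x ∈ Metric.closedBall (0 : E) (B + 1)
    · rw [norm_smul, Real.norm_eq_abs, abs_of_nonneg (cutoff_nonneg B x), hb']
      calc _ ≤ 1 * ‖V x‖ := mul_le_mul_of_nonneg_right (cutoff_le_one B x) (norm_nonneg _)
        _ ≤ _ := by rw [one_mul]; exact hbound x hx
    · rw [hzero x hx, zero_smul, norm_zero]; positivity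

/-- The field cut off outside the ball of radius `M + 1` is bounded and globally Lipschitz, so a
single application of Picard–Lindelöf reaches time `T`. While its solution stays in that ball it
solves the original equation, and the a priori bound improves `M + 1` to `M`; by continuity it never
leaves. -/
theorem exists_solution_of_apriori [NormedSpace ℝ E] [CompleteSpace E] {V : E → E}
    (hV : ∀ M : ℝ, ∃ L : ℝ≥0, LipschitzOnWith L V (Metric.closedBall 0 M)) {T M : ℝ} (hT : 0 < T)
    {x₀ : E} (hx₀ : ‖x₀‖ ≤ M)
    (hap : ∀ τ ∈ Ioc 0 T, ∀ X : ℝ → E, X 0 = x₀ →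
      (∀ t ∈ Icc 0 τ, HasDerivWithinAt X (V (X t)) (Icc 0 τ) t) →
      (∀ t ∈ Icc 0 τ, ‖X t‖ ≤ M + 1) → ∀ t ∈ Icc 0 τ, ‖X t‖ ≤ M) :
    ∃ X : ℝ → E, X 0 = x₀ ∧ (∀ t ∈ Icc 0 T, HasDerivWithinAt X (V (X t)) (Icc 0 T) t) ∧
      ∀ t ∈ Icc 0 T, ‖X t‖ ≤ M := by
  have M0 : 0 ≤ M := (norm_nonneg _).trans hx₀
  obtain ⟨L, hL⟩ := hV (M + 1 + 1)
  obtain ⟨b, K, hK, hb⟩ := exists_lipschitz_cutoff (by linarith) hL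
  have hPL : IsPicardLindelof (fun _ x => cutoff (M + 1) x • V x) (tmin := 0) (tmax := T)
      ⟨0, le_rfl, hT.le⟩ x₀ (b * ⟨T, hT.le⟩) 0 b K := by
    refine ⟨fun t _ => hK.lipschitzOnWith, fun x _ => continuousOn_const, fun t _ x _ => hb x, ?_⟩
    simp only [sub_zero, sub_self, max_eq_left hT.le, NNReal.coe_zero]
    exact le_rfl
  obtain ⟨X, hX0, hX⟩ := hPL.exists_eq_forall_mem_Icc_hasDerivWithinAt₀
  simp only at hX0 hX
  have hcont : ContinuousOn (fun t => ‖X t‖) (Icc 0 T) := fun t ht =>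
    (hX t ht).continuousWithinAt.norm
  have key : ∀ σ ∈ Icc 0 T, (∀ t ∈ Icc 0 σ, ‖X t‖ ≤ M + 1) →
      ∀ t ∈ Icc 0 σ, HasDerivWithinAt X (V (X t)) (Icc 0 σ) t := by
    intro σ hσ h t ht
    have h1 := (hX t ⟨ht.1, ht.2.trans hσ.2⟩).mono (Icc_subset_Icc_right hσ.2)
    rwa [cutoff_eq_one (h t ht), one_smul] at h1
  have hM : ∀ t ∈ Icc 0 T, ‖X t‖ ≤ M := by
    by_contra hcon
    push Not at hcon
    obtain ⟨t₁, ht₁, hlt⟩ := hcon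
    -- A level strictly above `M`, attained by the norm and not exceeding `M + 1`. Up to the first
    -- time it is attained the cut-off is inactive, so `hap` yields the contradiction there.
    set c := min (M + 1) ‖X t₁‖ with hc
    have hcM : M < c := lt_min (by linarith) hlt
    have ivt : ∀ s ∈ Icc 0 T, c ≤ ‖X s‖ → ∃ r ∈ Icc 0 s, ‖X r‖ = c := by
      intro s hs hcs
      exact intermediate_value_Icc hs.1 (hcont.mono (Icc_subset_Icc_right hs.2))
        ⟨by rw [hX0]; exact hx₀.trans hcM.le, hcs⟩
    have hK : IsCompact (Icc 0 T ∩ (fun t => ‖X t‖) ⁻¹' {c}) :=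
      isCompact_Icc.of_isClosed_subset
        (hcont.preimage_isClosed_of_isClosed isClosed_Icc isClosed_singleton) inter_subset_left
    obtain ⟨r, hr, hrc⟩ := ivt t₁ ht₁ (min_le_right _ _)
    obtain ⟨σ, hσ, hmin⟩ := hK.exists_isLeast ⟨r, ⟨hr.1, hr.2.trans ht₁.2⟩, hrc⟩
    have hσc : ‖X σ‖ = c := hσ.2
    have hle : ∀ t ∈ Icc 0 σ, ‖X t‖ ≤ M + 1 := by
      intro t ht
      refine le_trans ?_ (min_le_left (M + 1) ‖X t₁‖)
      rw [← hc]
      by_contra hlt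
      obtain ⟨r, hr, hrc⟩ := ivt t ⟨ht.1, ht.2.trans hσ.1.2⟩ (not_le.1 hlt).le
      have h1 := hmin ⟨⟨hr.1, hr.2.trans (ht.2.trans hσ.1.2)⟩, hrc⟩
      have : t = σ := le_antisymm ht.2 (h1.trans hr.2)
      rw [this, hσc] at hlt
      exact hlt le_rfl
    have hσ0 : 0 < σ := by
      refine hσ.1.1.lt_of_ne fun h => ?_
      rw [← h, hX0] at hσc
      linarith
    have := hap σ ⟨hσ0, hσ.1.2⟩ X hX0 (key σ hσ.1 hle) hle σ ⟨hσ0.le, le_rfl⟩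
    linarith
  exact ⟨X, hX0, key T ⟨hT.le, le_rfl⟩ fun t ht => (hM t ht).trans (by linarith), hM⟩

end Banach

/-! ### Solutions in spaces of bounded functions -/

/-- All components of `Y` are bounded everywhere by `M`. -/
def PtBnd (M : ℝ) (Y : State) : Prop :=
  ∀ ξ, |Y.ζ ξ| ≤ M ∧ |Y.U ξ| ≤ M ∧ |Y.H ξ| ≤ M ∧ |Y.v ξ| ≤ M ∧ |Y.w ξ| ≤ M ∧ |Y.h ξ| ≤ M

/-- All components of `Y` are measurable. -/
structure StateMeas (Y : State) : Prop where
  ζ : Measurable Y.ζ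
  U : Measurable Y.U
  H : Measurable Y.H
  v : Measurable Y.v
  w : Measurable Y.w
  h : Measurable Y.h

lemma StateMeas.supBnd {M : ℝ} {Y : State} (h : StateMeas Y) (hb : PtBnd M Y) : SupBnd M Y :=
  ⟨⟨h.ζ, fun ξ => (hb ξ).1⟩, ⟨h.U, fun ξ => (hb ξ).2.1⟩, ⟨h.U, fun ξ => (hb ξ).2.1⟩,
    ⟨h.H, fun ξ => (hb ξ).2.2.1⟩, ⟨h.v, fun ξ => (hb ξ).2.2.2.1⟩, ⟨h.w, fun ξ => (hb ξ).2.2.2.2.1⟩,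
    ⟨h.h, fun ξ => (hb ξ).2.2.2.2.2⟩⟩

lemma Bnd.ptBnd {M : ℝ} {Y : State} (h : SupBnd M Y) : PtBnd M Y := fun ξ =>
  ⟨h.ζ.2 ξ, h.U.2 ξ, h.H.2 ξ, h.v.2 ξ, h.w.2 ξ, h.h.2 ξ⟩

lemma Bnd.stateMeas {M : ℝ} {Y : State} (h : SupBnd M Y) : StateMeas Y :=
  ⟨h.ζ.1, h.U.1, h.H.1, h.v.1, h.w.1, h.h.1⟩

/-- A linear class of measurable states, closed under uniform convergence. -/
structure ClosedClass (A : State → Prop) : Prop where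
  zero : A 0
  add : ∀ {X Z}, A X → A Z → A (X + Z)
  smul : ∀ (c : ℝ) {X}, A X → A (c • X)
  meas : ∀ {X}, A X → StateMeas X
  closed : ∀ {X}, (∀ ε > 0, ∃ Z, A Z ∧ PtBnd ε (X - Z)) → A X

lemma ClosedClass.sub {A : State → Prop} (hA : ClosedClass A) {X Z : State} (hX : A X) (hZ : A Z) :
    A (X - Z) := by
  have e : X - Z = X + (-1 : ℝ) • Z := by module
  rw [e]
  exact hA.add hX (hA.smul _ hZ)

/-- `Y` solves `Y_t = 𝒱(Y)` on `[0, τ]`, with values in `A`, uniformly in space. -/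
structure SupSol (A : State → Prop) (𝒱 : State → State) (τ : ℝ) (Y₀ : State) (Y : ℝ → State) :
    Prop where
  init : Y 0 = Y₀
  mem : ∀ t ∈ Icc 0 τ, A (Y t)
  deriv : ∀ t ∈ Icc 0 τ, ∀ ε > 0, ∀ᶠ s in 𝓝[Icc 0 τ] t,
    PtBnd (ε * |s - t|) (Y s - Y t - (s - t) • 𝒱 (Y t))

/-- The Banach space of bounded sextuples of functions on the line. -/
abbrev BddState := lp (fun _ : Fin 6 × ℝ => ℝ) ∞

/-- The state given by a bounded sextuple. -/
def toState (x : BddState) : State :=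
  ⟨fun ξ => x (0, ξ), fun ξ => x (1, ξ), fun ξ => x (2, ξ), fun ξ => x (3, ξ), fun ξ => x (4, ξ),
    fun ξ => x (5, ξ)⟩

lemma toState_sub (x y : BddState) : toState (x - y) = toState x - toState y := rfl

lemma norm_bddState_le_iff {x : BddState} {M : ℝ} (hM : 0 ≤ M) : ‖x‖ ≤ M ↔ PtBnd M (toState x) := by
  constructor
  · intro h ξ
    have key : ∀ i, |x i| ≤ M := fun i => (lp.norm_apply_le_norm ENNReal.top_ne_zero x i).trans h
    exact ⟨key _, key _, key _, key _, key _, key _⟩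
  · intro h
    refine lp.norm_le_of_forall_le hM fun i => ?_
    obtain ⟨i, ξ⟩ := i
    obtain ⟨h0, h1, h2, h3, h4, h5⟩ := h ξ
    fin_cases i <;> assumption

lemma exists_toState {Y : State} {M : ℝ} (h : PtBnd M Y) : ∃ x : BddState, toState x = Y := by
  have key : ∀ p : Fin 6 × ℝ, ‖![Y.ζ, Y.U, Y.H, Y.v, Y.w, Y.h] p.1 p.2‖ ≤ M := by
    rintro ⟨i, ξ⟩
    obtain ⟨h0, h1, h2, h3, h4, h5⟩ := h ξ
    fin_cases i <;> assumption
  exact ⟨⟨fun p => ![Y.ζ, Y.U, Y.H, Y.v, Y.w, Y.h] p.1 p.2,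
    memℓp_infty ⟨M, by rintro _ ⟨p, rfl⟩; exact key p⟩⟩, rfl⟩

/-- The subspace of bounded states in a closed class. -/
def ClosedClass.space {A : State → Prop} (hA : ClosedClass A) : Submodule ℝ BddState where
  carrier := {x | A <| toState x}
  add_mem' hx hy := hA.add hx hy
  zero_mem' := hA.zero
  smul_mem' c _ hx := hA.smul c hx

lemma ClosedClass.isClosed_space {A : State → Prop} (hA : ClosedClass A) :
    IsClosed (hA.space : Set BddState) := by
  refine isClosed_of_closure_subset fun x hx => hA.closed fun ε hε => ?_
  obtain ⟨z, hz, hxz⟩ := Metric.mem_closure_iff.1 hx ε hε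
  rw [dist_eq_norm] at hxz
  exact ⟨toState z, hz, (norm_bddState_le_iff (x := x - z) hε.le).1 hxz.le⟩

/-- A closed class is a closed subspace of a space with the sup norm over all points, not the
essential supremum. Evaluation at `ξ` is therefore continuous, and the solution satisfies an
ordinary differential equation at every single `ξ`, without exceptional null sets depending on time.
-/
theorem exists_supSol {A : State → Prop} (hA : ClosedClass A) {𝒱 : State → State}
    (hmap : ∀ {Y M}, A Y → SupBnd M Y → A (𝒱 Y)) (h0 : 𝒱 0 = 0)
    (hlip : ∀ M, 0 ≤ M → ∃ L : ℝ, 0 ≤ L ∧ ∀ {X Z d}, A X → A Z → SupBnd M X → SupBnd M Z →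
      SupBnd d (X - Z) → SupBnd (L * d) (𝒱 X - 𝒱 Z))
    {T M : ℝ} (hT : 0 < T) {Y₀ : State} (hY₀ : A Y₀) (hM : SupBnd M Y₀)
    (hap : ∀ τ ∈ Ioc 0 T, ∀ Y, SupSol A 𝒱 τ Y₀ Y → (∀ t ∈ Icc 0 τ, SupBnd (M + 1) (Y t)) →
      ∀ t ∈ Icc 0 τ, SupBnd M (Y t)) :
    ∃ Y, SupSol A 𝒱 T Y₀ Y ∧ ∀ t ∈ Icc 0 T, SupBnd M (Y t) := by
  have M0 : 0 ≤ M := hM.nonneg normPair_sup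
  have bnd : ∀ x : hA.space, SupBnd ‖x‖ (toState (x : BddState)) := fun x =>
    (hA.meas x.2).supBnd ((norm_bddState_le_iff (norm_nonneg _)).1 le_rfl)
  have bnd' : ∀ (x : hA.space) {c : ℝ}, 0 ≤ c →
      (‖x‖ ≤ c ↔ SupBnd c (toState (x : BddState))) := fun x c hc =>
    ⟨fun h => (bnd x).mono normPair_sup h, fun h => (norm_bddState_le_iff hc).2 h.ptBnd⟩
  have hbdd : ∀ x : hA.space, ∃ y : hA.space,
      toState (y : BddState) = 𝒱 (toState (x : BddState)) := by
    intro x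
    obtain ⟨L, -, hL⟩ := hlip ‖x‖ (norm_nonneg _)
    have h1 := hL x.2 hA.zero (bnd x) (Bnd.zero normPair_sup (norm_nonneg _)) (d := ‖x‖)
      (by simpa using bnd x)
    rw [h0, sub_zero] at h1
    obtain ⟨y, hy⟩ := exists_toState h1.ptBnd
    exact ⟨⟨y, show A <| toState y from hy ▸ hmap x.2 (bnd x)⟩, hy⟩
  choose V hV using hbdd
  have : CompleteSpace hA.space := hA.isClosed_space.completeSpace_coe
  have hVlip : ∀ M : ℝ, ∃ L : ℝ≥0, LipschitzOnWith L V (Metric.closedBall 0 M) := by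
    intro M
    rcases lt_or_ge M 0 with hM | hM
    · exact ⟨0, by simp [Metric.closedBall_eq_empty.2 hM, LipschitzOnWith]⟩
    obtain ⟨L, hL0, hL⟩ := hlip M hM
    refine ⟨⟨L, hL0⟩, LipschitzOnWith.of_dist_le_mul fun x hx z hz => ?_⟩
    rw [mem_closedBall_zero_iff] at hx hz
    rw [dist_eq_norm, dist_eq_norm]
    have h1 := hL x.2 z.2 ((bnd' x hM).1 hx) ((bnd' z hM).1 hz) (bnd (x - z))
    refine (bnd' (V x - V z) (mul_nonneg hL0 (norm_nonneg _))).2 ?_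
    rw [Submodule.coe_sub, toState_sub, hV, hV]
    exact h1
  obtain ⟨y₀, hy₀⟩ := exists_toState hM.ptBnd
  have hy₀A : y₀ ∈ hA.space := show A <| toState y₀ from hy₀ ▸ hY₀
  have conv : ∀ τ (X : ℝ → hA.space), X 0 = ⟨y₀, hy₀A⟩ →
      (∀ t ∈ Icc 0 τ, HasDerivWithinAt X (V (X t)) (Icc 0 τ) t) →
      SupSol A 𝒱 τ Y₀ (fun t => toState (X t : BddState)) := by
    intro τ X hX0 hX
    refine ⟨by simp only [hX0, hy₀], fun t _ => (X t).2, fun t ht ε hε => ?_⟩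
    have h1 := Asymptotics.isLittleO_iff.1 (hasDerivWithinAt_iff_isLittleO.1 (hX t ht)) hε
    filter_upwards [h1] with s hs
    rw [Real.norm_eq_abs, bnd' _ (by positivity)] at hs
    rw [← hV]
    exact hs.ptBnd
  obtain ⟨X, hX0, hX, hXM⟩ := exists_solution_of_apriori hVlip hT (x₀ := ⟨y₀, hy₀A⟩) (M := M)
    ((bnd' _ M0).2 (by simpa [hy₀] using hM)) (fun τ hτ X hX0 hX hXM t ht => by
      refine (bnd' _ M0).2 ?_
      exact hap τ hτ _ (conv τ X hX0 hX)
        (fun t ht => (bnd' _ (by linarith)).1 (hXM t ht)) t ht)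
  exact ⟨_, conv T X hX0 hX, fun t ht => (bnd' _ M0).1 (hXM t ht)⟩

/-! ### Primitives of locally integrable functions -/

/-- `f` is a primitive of the locally integrable function `g`. -/
structure Prim (f g : ℝ → ℝ) : Prop where
  int : ∀ a b, IntervalIntegrable g volume a b
  eq : ∀ a b, ∫ x in a..b, g x = f b - f a

namespace Prim

variable {f g f' g' : ℝ → ℝ}

lemma ac (h : Prim f f') (a b : ℝ) : AbsolutelyContinuousOnInterval f a b := by
  have h1 := (h.int a b).absolutelyContinuousOnInterval_intervalIntegral (c := a) left_mem_uIcc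
  have h2 : AbsolutelyContinuousOnInterval (fun _ : ℝ => f a) a b :=
    (LipschitzWith.const (f a)).lipschitzOnWith.absolutelyContinuousOnInterval (K := 0)
  have e : f = fun x => (∫ t in a..x, f' t) + f a := funext fun x => by rw [h.eq a x]; ring
  rw [e]
  exact h1.fun_add h2

lemma continuous (h : Prim f f') : Continuous f := by
  rw [continuous_iff_continuousAt]
  intro x
  refine ((h.ac (x - 1) (x + 1)).continuousOn).continuousAt ?_
  rw [uIcc_of_le (by linarith)]
  exact Icc_mem_nhds (by linarith) (by linarith)

lemma ae_hasDerivAt (h : Prim f f') : ∀ᵐ x, HasDerivAt f (f' x) x := by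
  have hl : LocallyIntegrable f' volume := fun x =>
    ⟨Icc (x - 1) (x + 1), Icc_mem_nhds (by linarith) (by linarith),
      (intervalIntegrable_iff_integrableOn_Icc_of_le (by linarith)).1 (h.int _ _)⟩
  filter_upwards [LocallyIntegrable.ae_hasDerivAt_integral hl] with x hx
  have e : f = fun x => (∫ t in 0..x, f' t) + f 0 := funext fun x => by rw [h.eq 0 x]; ring
  rw [e]
  exact (hx 0).add_const _

/-- Being a primitive is the same as absolute continuity together with the derivative almost
everywhere. Both properties pass to sums, products and exponentials, and this gives the calculus
rules below. -/
lemma of_ac (h : ∀ a b, AbsolutelyContinuousOnInterval f a b)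
    (h' : ∀ᵐ x, HasDerivAt f (f' x) x) : Prim f f' := by
  have e : deriv f =ᵐ[volume] f' := h'.mono fun x hx => hx.deriv
  refine ⟨fun a b => ?_, fun a b => ?_⟩
  · exact (h a b).intervalIntegrable_deriv.congr_ae (ae_restrict_of_ae e)
  · rw [← (h a b).integral_deriv_eq_sub]
    exact intervalIntegral.integral_congr_ae (e.mono fun x hx _ => hx.symm)

lemma add (hf : Prim f f') (hg : Prim g g') : Prim (fun x => f x + g x) (fun x => f' x + g' x) :=
  of_ac (fun a b => (hf.ac a b).fun_add (hg.ac a b)) (by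
    filter_upwards [hf.ae_hasDerivAt, hg.ae_hasDerivAt] with x h1 h2 using h1.add h2)

lemma mul (hf : Prim f f') (hg : Prim g g') :
    Prim (fun x => f x * g x) (fun x => f' x * g x + f x * g' x) :=
  of_ac (fun a b => (hf.ac a b).fun_mul (hg.ac a b)) (by
    filter_upwards [hf.ae_hasDerivAt, hg.ae_hasDerivAt] with x h1 h2 using h1.mul h2)

lemma const_mul (hf : Prim f f') (c : ℝ) : Prim (fun x => c * f x) (fun x => c * f' x) :=
  of_ac (fun a b => (hf.ac a b).const_mul c) (by
    filter_upwards [hf.ae_hasDerivAt] with x h1 using h1.const_mul c)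

lemma congr (hf : Prim f f') (h : ∀ x, f x = g x) (h' : ∀ x, f' x = g' x) : Prim g g' := by
  rwa [← funext h, ← funext h']

lemma abs_sub_le (hf : Prim f f') {C : ℝ} (hC : ∀ x, |f' x| ≤ C) (x y : ℝ) :
    |f x - f y| ≤ C * |x - y| := by
  rw [← hf.eq y x, ← Real.norm_eq_abs]
  exact intervalIntegral.norm_integral_le_of_norm_le_const fun t _ => hC t

lemma exp (hf : Prim f f') {C : ℝ} (hC : ∀ x, |f' x| ≤ C) :
    Prim (fun x => Real.exp (f x)) (fun x => Real.exp (f x) * f' x) := by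
  refine of_ac (fun a b => ?_) ?_
  · obtain ⟨D, hD⟩ := (hf.ac a b).exists_bound
    have C0 : 0 ≤ C := (abs_nonneg _).trans (hC 0)
    refine LipschitzOnWith.absolutelyContinuousOnInterval (K := ⟨Real.exp D * C, by positivity⟩)
      (LipschitzOnWith.of_dist_le_mul fun x hx y hy => ?_)
    rw [Real.dist_eq, Real.dist_eq]
    refine (abs_exp_sub_exp_le ((le_abs_self _).trans (hD x hx))
      ((le_abs_self _).trans (hD y hy))).trans ?_
    change _ ≤ Real.exp D * C * |x - y|
    rw [mul_assoc]
    exact mul_le_mul_of_nonneg_left (hf.abs_sub_le hC x y) (Real.exp_pos _).le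
  · filter_upwards [hf.ae_hasDerivAt] with x h1 using h1.exp

lemma id : Prim (fun x => x) (fun _ => 1) :=
  ⟨fun _ _ => intervalIntegrable_const, fun a b => by simp⟩

end Prim

/-! ### States with the differential relations -/

/-- Bounded measurable states with `y_ξ = q`, `U_ξ = w`, `H_ξ = h`. -/
structure ExactClass (Y : State) : Prop where
  bdd : ∃ M, SupBnd M Y
  ζ : Prim Y.ζ Y.v
  U : Prim Y.U Y.w
  H : Prim Y.H Y.h

lemma SupLe.intervalIntegrable {f : ℝ → ℝ} {c : ℝ} (h : SupLe f c) (a b : ℝ) :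
    IntervalIntegrable f volume a b := by
  refine (intervalIntegrable_const (c := c) (a := a) (b := b)).mono_fun'
    h.1.aestronglyMeasurable (ae_of_all _ h.2)

lemma measurable_of_approx {f : ℝ → ℝ}
    (h : ∀ ε > 0, ∃ g : ℝ → ℝ, Measurable g ∧ ∀ ξ, |f ξ - g ξ| ≤ ε) : Measurable f := by
  choose g hg using fun n : ℕ => h (1 / (n + 1 : ℝ)) (by positivity)
  refine measurable_of_tendsto_metrizable (fun n => (hg n).1) (tendsto_pi_nhds.2 fun ξ => ?_)
  rw [tendsto_iff_dist_tendsto_zero]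
  refine squeeze_zero (fun _ => dist_nonneg) (fun n => ?_) tendsto_one_div_add_atTop_nhds_zero_nat
  rw [dist_comm, Real.dist_eq]
  exact (hg n).2 ξ

lemma PtBnd.add {a b : ℝ} {X Z : State} (hX : PtBnd a X) (hZ : PtBnd b Z) :
    PtBnd (a + b) (X + Z) := fun ξ => by
  obtain ⟨h1, h2, h3, h4, h5, h6⟩ := hX ξ
  obtain ⟨g1, g2, g3, g4, g5, g6⟩ := hZ ξ
  exact ⟨(abs_add_le _ _).trans (add_le_add h1 g1), (abs_add_le _ _).trans (add_le_add h2 g2),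
    (abs_add_le _ _).trans (add_le_add h3 g3), (abs_add_le _ _).trans (add_le_add h4 g4),
    (abs_add_le _ _).trans (add_le_add h5 g5), (abs_add_le _ _).trans (add_le_add h6 g6)⟩

lemma stateMeas_of_approx {X : State} (h : ∀ ε > 0, ∃ Z, StateMeas Z ∧ PtBnd ε (X - Z)) :
    StateMeas X := by
  constructor <;> refine measurable_of_approx fun ε hε => ?_ <;> obtain ⟨Z, hZ, hb⟩ := h ε hε
  · exact ⟨_, hZ.ζ, fun ξ => (hb ξ).1⟩
  · exact ⟨_, hZ.U, fun ξ => (hb ξ).2.1⟩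
  · exact ⟨_, hZ.H, fun ξ => (hb ξ).2.2.1⟩
  · exact ⟨_, hZ.v, fun ξ => (hb ξ).2.2.2.1⟩
  · exact ⟨_, hZ.w, fun ξ => (hb ξ).2.2.2.2.1⟩
  · exact ⟨_, hZ.h, fun ξ => (hb ξ).2.2.2.2.2⟩

/-- Uniform convergence of functions and derivatives on a bounded interval passes to the limit in
the fundamental theorem of calculus; this makes the differential relations a closed condition. -/
lemma prim_of_approx {f f' : ℝ → ℝ} {M : ℝ} (hf' : SupLe f' M)
    (h : ∀ ε > 0, ∃ g g' : ℝ → ℝ, Prim g g' ∧ (∀ ξ, |f ξ - g ξ| ≤ ε) ∧ ∀ ξ, |f' ξ - g' ξ| ≤ ε) :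
    Prim f f' := by
  refine ⟨hf'.intervalIntegrable, fun a b => ?_⟩
  have key : ∀ ε > 0, |(∫ x in a..b, f' x) - (f b - f a)| ≤ ε * (|b - a| + 2) := by
    intro ε hε
    obtain ⟨g, g', hg, h1, h2⟩ := h ε hε
    have h3 : |(∫ x in a..b, f' x) - ∫ x in a..b, g' x| ≤ ε * |b - a| := by
      rw [← intervalIntegral.integral_sub (hf'.intervalIntegrable a b) (hg.int a b),
        ← Real.norm_eq_abs]
      exact intervalIntegral.norm_integral_le_of_norm_le_const fun x _ => h2 x
    rw [hg.eq] at h3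
    have ha := h1 a
    have hb := h1 b
    rw [abs_le] at *
    constructor <;> linarith [h3.1, h3.2, ha.1, ha.2, hb.1, hb.2]
  have hpos : 0 < |b - a| + 2 := by positivity
  rw [← sub_eq_zero, ← abs_nonpos_iff]
  refine le_of_forall_pos_le_add fun ε hε => ?_
  have := key (ε / (|b - a| + 2)) (by positivity)
  rwa [div_mul_cancel₀ _ hpos.ne', ← zero_add ε] at this

lemma exactClass_closedClass : ClosedClass ExactClass where
  zero := by
    have : Prim (0 : ℝ → ℝ) 0 := ⟨fun _ _ => intervalIntegrable_const (c := (0 : ℝ)),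
      fun _ _ => by simp⟩
    exact ⟨⟨0, Bnd.zero normPair_sup le_rfl⟩, this, this, this⟩
  add := fun {X Z} hX hZ => by
    obtain ⟨M, hM⟩ := hX.bdd
    obtain ⟨M', hM'⟩ := hZ.bdd
    exact ⟨⟨_, hM.add normPair_sup hM'⟩, hX.ζ.add hZ.ζ, hX.U.add hZ.U, hX.H.add hZ.H⟩
  smul := fun c {X} hX => by
    obtain ⟨M, hM⟩ := hX.bdd
    exact ⟨⟨_, hM.smul normPair_sup c⟩, hX.ζ.const_mul c, hX.U.const_mul c, hX.H.const_mul c⟩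
  meas := fun {X} hX => by
    obtain ⟨M, hM⟩ := hX.bdd
    exact hM.stateMeas
  closed := fun {X} h => by
    have hm : StateMeas X := stateMeas_of_approx fun ε hε => by
      obtain ⟨Z, hZ, hb⟩ := h ε hε
      obtain ⟨M, hM⟩ := hZ.bdd
      exact ⟨Z, hM.stateMeas, hb⟩
    obtain ⟨Z, hZ, hb⟩ := h 1 one_pos
    obtain ⟨M, hM⟩ := hZ.bdd
    have hX : SupBnd (1 + M) X := hm.supBnd (by
      have h1 := hb.add hM.ptBnd
      rwa [sub_add_cancel] at h1)
    refine ⟨⟨_, hX⟩, prim_of_approx hX.v fun ε hε => ?_, prim_of_approx hX.w fun ε hε => ?_,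
      prim_of_approx hX.h fun ε hε => ?_⟩ <;> obtain ⟨Z, hZ, hb⟩ := h ε hε
    · exact ⟨_, _, hZ.ζ, fun ξ => (hb ξ).1, fun ξ => (hb ξ).2.2.2.1⟩
    · exact ⟨_, _, hZ.U, fun ξ => (hb ξ).2.1, fun ξ => (hb ξ).2.2.2.2.1⟩
    · exact ⟨_, _, hZ.H, fun ξ => (hb ξ).2.2.1, fun ξ => (hb ξ).2.2.2.2.2⟩

section ExactClass

variable {γ : ℝ} {Y : State}

lemma ExactClass.prim_y (hY : ExactClass Y) : Prim Y.y Y.q :=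
  (hY.ζ.add Prim.id).congr (fun _ => by simp [State.y, add_comm])
    (fun _ => by simp [State.q, add_comm])

/-- The left part of the potential `P`. -/
def leftPot (γ : ℝ) (Y : State) (ξ : ℝ) : ℝ :=
  Real.exp (-Y.y ξ) * ∫ η in Iic ξ, Real.exp (Y.y η) * source γ Y η

/-- The right part of the potential `P`. -/
def rightPot (γ : ℝ) (Y : State) (ξ : ℝ) : ℝ :=
  Real.exp (Y.y ξ) * ∫ η in Ioi ξ, Real.exp (-Y.y η) * source γ Y η

lemma ExactClass.integrable_pot (hY : ExactClass Y) {θ : ℝ → ℝ} (hθ : Measurable θ)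
    (hθ1 : ∀ x, |θ x| ≤ 1) (ξ : ℝ) :
    Integrable (fun η => θ (ξ - η) * ker Y ξ η * source γ Y η) := by
  obtain ⟨M, hM⟩ := hY.bdd
  have hs := source_bnd (γ := γ) normPair_sup hM
  exact HyperelasticRod.integrable_pot hθ hθ1 hM.ζ.essLe.1 hM.ζ.essLe.2 (hM.ζ.2 ξ)
    hs.essLe.1 (hs.integrable_smear ξ)

lemma ker_of_le {ξ η : ℝ} (h : η ≤ ξ) :
    ker Y ξ η = Real.exp (-Y.y ξ) * Real.exp (Y.y η) := by
  rw [← Real.exp_add]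
  rcases h.eq_or_lt with rfl | h
  · simp [ker]
  · rw [ker_of_lt h]; ring_nf

lemma ker_of_gt' {ξ η : ℝ} (h : ξ < η) :
    ker Y ξ η = Real.exp (Y.y ξ) * Real.exp (-Y.y η) := by
  rw [← Real.exp_add, ker_of_gt h]; ring_nf

lemma ExactClass.integrableOn_Iic (hY : ExactClass Y) (ξ : ℝ) :
    IntegrableOn (fun η => Real.exp (Y.y η) * source γ Y η) (Iic ξ) := by
  have h := ((hY.integrable_pot (γ := γ) (θ := fun _ => 1) measurable_const (by simp) ξ).const_mul
    (Real.exp (Y.y ξ))).integrableOn (s := Iic ξ)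
  refine h.congr_fun (fun η hη => ?_) measurableSet_Iic
  simp only [one_mul, ker_of_le (mem_Iic.1 hη)]
  rw [← mul_assoc, ← mul_assoc, ← Real.exp_add]
  simp

lemma ExactClass.integrableOn_Ioi (hY : ExactClass Y) (ξ : ℝ) :
    IntegrableOn (fun η => Real.exp (-Y.y η) * source γ Y η) (Ioi ξ) := by
  have h := ((hY.integrable_pot (γ := γ) (θ := fun _ => 1) measurable_const (by simp) ξ).const_mul
    (Real.exp (-Y.y ξ))).integrableOn (s := Ioi ξ)
  refine h.congr_fun (fun η hη => ?_) measurableSet_Ioi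
  simp only [one_mul, ker_of_gt' (mem_Ioi.1 hη)]
  rw [← mul_assoc, ← mul_assoc, ← Real.exp_add]
  simp

/-- On either side of `ξ` the kernel factors into a function of `ξ` and one of `η`. Hence both
potentials are combinations of two integrals with a variable end point, which can be differentiated.
-/
lemma ExactClass.pot_eq (hY : ExactClass Y) {θ : ℝ → ℝ} (hθ : Measurable θ)
    (hθ1 : ∀ x, |θ x| ≤ 1) {a b : ℝ} (ha : ∀ x, 0 < x → θ x = a) (hb : ∀ x, x < 0 → θ x = b)
    (ξ : ℝ) : pot θ γ Y ξ = a * leftPot γ Y ξ + b * rightPot γ Y ξ := by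
  have hi := hY.integrable_pot (γ := γ) hθ hθ1 ξ
  rw [pot, ← intervalIntegral.integral_Iic_add_Ioi (b := ξ) hi.integrableOn hi.integrableOn,
    leftPot, rightPot]
  congr 1
  -- Removing the end point `η = ξ` makes the value of `θ` at 0 irrelevant.
  · rw [← mul_assoc, ← integral_const_mul, integral_Iic_eq_integral_Iio,
      integral_Iic_eq_integral_Iio]
    refine setIntegral_congr_fun measurableSet_Iio fun η hη => ?_
    have h : η < ξ := hη
    simp only [ha (ξ - η) (sub_pos.2 h), ker_of_le h.le]
    ring
  · rw [← mul_assoc, ← integral_const_mul]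
    refine setIntegral_congr_fun measurableSet_Ioi fun η hη => ?_
    have h : ξ < η := hη
    simp only [hb (ξ - η) (sub_neg.2 h), ker_of_gt' h]
    ring

lemma ExactClass.q_bound (hY : ExactClass Y) : ∃ C, ∀ x, |Y.q x| ≤ C := by
  obtain ⟨M, hM⟩ := hY.bdd
  refine ⟨1 + M, fun x => (abs_add_le _ _).trans ?_⟩
  rw [abs_one]
  linarith [hM.v.2 x]

lemma ExactClass.intervalIntegrable_mul_source (hY : ExactClass Y) {f : ℝ → ℝ}
    (hf : Continuous f) (a b : ℝ) :
    IntervalIntegrable (fun η => f η * source γ Y η) volume a b := by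
  obtain ⟨M, hM⟩ := hY.bdd
  exact ((source_bnd (γ := γ) normPair_sup hM).intervalIntegrable a b).continuousOn_mul
    hf.continuousOn

lemma ExactClass.prim_leftPot (hY : ExactClass Y) :
    Prim (leftPot γ Y) (fun ξ => source γ Y ξ - Y.q ξ * leftPot γ Y ξ) := by
  obtain ⟨C, hC⟩ := hY.q_bound
  have hy := hY.prim_y
  have h1 : Prim (fun ξ => ∫ η in Iic ξ, Real.exp (Y.y η) * source γ Y η)
      (fun η => Real.exp (Y.y η) * source γ Y η) :=
    ⟨hY.intervalIntegrable_mul_source (Real.continuous_exp.comp hy.continuous), fun a b =>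
      (intervalIntegral.integral_Iic_sub_Iic (hY.integrableOn_Iic a) (hY.integrableOn_Iic b)).symm⟩
  have h2 := (hy.const_mul (-1)).exp (C := C) (fun x => by simpa using hC x)
  refine (h2.mul h1).congr (fun x => by simp [leftPot]) (fun x => ?_)
  have e : Real.exp (-1 * Y.y x) * Real.exp (Y.y x) = 1 := by rw [← Real.exp_add]; simp
  simp only [leftPot]
  rw [← neg_one_mul (Y.y x)]
  linear_combination (source γ Y x) * e

lemma ExactClass.prim_rightPot (hY : ExactClass Y) :
    Prim (rightPot γ Y) (fun ξ => -source γ Y ξ + Y.q ξ * rightPot γ Y ξ) := by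
  obtain ⟨C, hC⟩ := hY.q_bound
  have hy := hY.prim_y
  have hc : Continuous fun ξ => Real.exp (-Y.y ξ) := Real.continuous_exp.comp hy.continuous.neg
  have h1 : Prim (fun ξ => ∫ η in Ioi ξ, Real.exp (-Y.y η) * source γ Y η)
      (fun η => -(Real.exp (-Y.y η) * source γ Y η)) := by
    refine ⟨fun a b => (hY.intervalIntegrable_mul_source hc a b).neg, fun a b => ?_⟩
    rw [intervalIntegral.integral_neg, ← intervalIntegral.integral_Ioi_sub_Ioi'
      (hY.integrableOn_Ioi a) (hY.integrableOn_Ioi b)]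
    ring
  refine ((hy.exp hC).mul h1).congr (fun x => by simp [rightPot]) (fun x => ?_)
  have e : Real.exp (Y.y x) * Real.exp (-Y.y x) = 1 := by rw [← Real.exp_add]; simp
  simp only [rightPot]
  linear_combination (-source γ Y x) * e

lemma ExactClass.P_eq (hY : ExactClass Y) (ξ : ℝ) :
    P γ Y ξ = 1 / 2 * (leftPot γ Y ξ + rightPot γ Y ξ) := by
  rw [HyperelasticRod.P_eq, hY.pot_eq (a := 1) (b := 1) measurable_const (by simp) (by simp)
    (by simp)]
  ring

lemma ExactClass.Q_eq (hY : ExactClass Y) (ξ : ℝ) :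
    Q γ Y ξ = -(1 / 2) * (leftPot γ Y ξ - rightPot γ Y ξ) := by
  rw [HyperelasticRod.Q_eq, hY.pot_eq (a := 1) (b := -1) measurable_sign abs_sign_le
    (fun x => Real.sign_of_pos) (fun x => Real.sign_of_neg)]
  ring

lemma ExactClass.prim_P (hY : ExactClass Y) : Prim (P γ Y) (fun ξ => Q γ Y ξ * Y.q ξ) :=
  ((hY.prim_leftPot (γ := γ).add hY.prim_rightPot).const_mul (1 / 2)).congr
    (fun x => (hY.P_eq x).symm) (fun x => by rw [hY.Q_eq]; ring)

lemma ExactClass.prim_Q (hY : ExactClass Y) :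
    Prim (Q γ Y) (fun ξ => P γ Y ξ * Y.q ξ - source γ Y ξ) :=
  ((hY.prim_leftPot (γ := γ).add (hY.prim_rightPot.const_mul (-1))).const_mul (-(1 / 2))).congr
    (fun x => by rw [hY.Q_eq]; ring) (fun x => by rw [hY.P_eq]; ring)

/-- The system for `v, w, h` is the `ξ`-derivative of the one for `ζ, U, H`: with `P_ξ = Q q` and
`Q_ξ = P q - source`, differentiating `-Q` and `U³ - 2PU` gives precisely the last two components.
So the relations `y_ξ = q`, `U_ξ = w`, `H_ξ = h` need not be propagated; they hold in the space
where the equation is solved. -/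
lemma ExactClass.G (hY : ExactClass Y) : ExactClass (G γ Y) := by
  obtain ⟨M, hM⟩ := hY.bdd
  refine ⟨⟨_, G_bnd potPair_sup hM⟩, hY.U.const_mul γ, ?_, ?_⟩
  · refine (hY.prim_Q (γ := γ).const_mul (-1)).congr (fun x => ?_) (fun x => ?_)
    · simp [HyperelasticRod.G, rhs]
    · simp only [HyperelasticRod.G, rhs, source]; ring
  · refine (((hY.U.mul hY.U).mul hY.U).add ((hY.prim_P (γ := γ).mul hY.U).const_mul (-2))).congr
      (fun x => ?_) (fun x => ?_)
    · simp only [HyperelasticRod.G, rhs]; ring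
    · simp only [HyperelasticRod.G, rhs]; ring

end ExactClass

/-! ### Differential inequalities -/

section DiffIneq

variable {f f' g g' : ℝ → ℝ} {τ : ℝ}

lemma sub_le_sub_of_deriv_le (hf : ∀ t ∈ Icc 0 τ, HasDerivWithinAt f (f' t) (Icc 0 τ) t)
    (hg : ∀ t ∈ Icc 0 τ, HasDerivWithinAt g (g' t) (Icc 0 τ) t)
    (hle : ∀ t ∈ Icc 0 τ, f' t ≤ g' t) {t : ℝ} (ht : t ∈ Icc 0 τ) : f t - f 0 ≤ g t - g 0 := by
  have hd : ∀ t ∈ Icc 0 τ, HasDerivWithinAt (fun s => g s - f s) (g' t - f' t) (Icc 0 τ) t :=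
    fun t ht => (hg t ht).sub (hf t ht)
  have hm : MonotoneOn (fun s => g s - f s) (Icc 0 τ) := by
    refine monotoneOn_of_deriv_nonneg (convex_Icc 0 τ)
      (fun t ht => (hd t ht).continuousWithinAt) (fun t ht => ?_) (fun t ht => ?_)
    · exact ((hd t (interior_subset ht)).differentiableWithinAt).mono interior_subset
    · have h1 := (hd t (interior_subset ht)).hasDerivAt (mem_interior_iff_mem_nhds.1 ht)
      rw [h1.deriv]
      exact sub_nonneg.2 (hle t (interior_subset ht))
  have h0 : (0 : ℝ) ∈ Icc 0 τ := ⟨le_rfl, ht.1.trans ht.2⟩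
  have := hm h0 ht ht.1
  simp only at this
  linarith

lemma hasDerivWithinAt_exp_mul (c t : ℝ) (s : Set ℝ) :
    HasDerivWithinAt (fun x => Real.exp (c * x)) (c * Real.exp (c * t)) s t := by
  have h := ((hasDerivAt_id t).const_mul c).exp.hasDerivWithinAt (s := s)
  simp only [id, mul_one] at h
  rwa [mul_comm] at h

lemma le_exp_mul_of_deriv_le {C : ℝ}
    (hf : ∀ t ∈ Icc 0 τ, HasDerivWithinAt f (f' t) (Icc 0 τ) t)
    (hle : ∀ t ∈ Icc 0 τ, f' t ≤ C * f t) {t : ℝ} (ht : t ∈ Icc 0 τ) :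
    f t ≤ Real.exp (C * t) * f 0 := by
  have h := sub_le_sub_of_deriv_le
    (fun t ht => (hasDerivWithinAt_exp_mul (-C) t _).mul (hf t ht))
    (fun t _ => hasDerivWithinAt_const t _ (0 : ℝ))
    (fun t ht => by
      have := mul_le_mul_of_nonneg_left (hle t ht) (Real.exp_pos (-C * t)).le
      linarith) ht
  simp only [Pi.mul_apply, mul_zero, Real.exp_zero, one_mul, sub_self] at h
  have e : f t = Real.exp (C * t) * (Real.exp (-C * t) * f t) := by
    rw [← mul_assoc, ← Real.exp_add]; simp
  rw [e]
  exact mul_le_mul_of_nonneg_left (by linarith) (Real.exp_pos _).le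

lemma exp_mul_le_of_le_deriv {C : ℝ}
    (hf : ∀ t ∈ Icc 0 τ, HasDerivWithinAt f (f' t) (Icc 0 τ) t)
    (hle : ∀ t ∈ Icc 0 τ, C * f t ≤ f' t) {t : ℝ} (ht : t ∈ Icc 0 τ) :
    Real.exp (C * t) * f 0 ≤ f t := by
  have := le_exp_mul_of_deriv_le (f := fun t => -f t) (f' := fun t => -f' t) (C := C)
    (fun t ht => (hf t ht).neg) (fun t ht => by linarith [hle t ht]) ht
  linarith

/-- A function with `|f'| ≤ C |f|` does not change its sign. -/
lemma nonneg_of_abs_deriv_le {C : ℝ}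
    (hf : ∀ t ∈ Icc 0 τ, HasDerivWithinAt f (f' t) (Icc 0 τ) t)
    (hle : ∀ t ∈ Icc 0 τ, |f' t| ≤ C * |f t|) (h0 : 0 ≤ f 0) {t : ℝ} (ht : t ∈ Icc 0 τ) :
    0 ≤ f t := by
  have hsq : ∀ t ∈ Icc 0 τ,
      HasDerivWithinAt (fun s => f s * f s) (f' t * f t + f t * f' t) (Icc 0 τ) t :=
    fun t ht => (hf t ht).mul (hf t ht)
  have hb : ∀ t ∈ Icc 0 τ, |f' t * f t| ≤ C * (f t * f t) := by
    intro t ht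
    rw [abs_mul, ← abs_mul_abs_self (f t), ← mul_assoc]
    exact mul_le_mul_of_nonneg_right (hle t ht) (abs_nonneg _)
  have up := fun {t : ℝ} (ht : t ∈ Icc 0 τ) => le_exp_mul_of_deriv_le (C := 2 * C) hsq
    (fun t ht => by linarith [(abs_le.1 (hb t ht)).2, mul_comm (f t) (f' t)]) ht
  have lo := fun {t : ℝ} (ht : t ∈ Icc 0 τ) => exp_mul_le_of_le_deriv (C := -(2 * C)) hsq
    (fun t ht => by linarith [(abs_le.1 (hb t ht)).1, mul_comm (f t) (f' t)]) ht
  -- The square of `f` lies between `e^{∓2Ct} f(0)²`: it stays zero if it starts at zero, and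
  -- otherwise never vanishes, which excludes a change of sign.
  rcases h0.eq_or_lt with h0 | h0
  · have := up ht
    rw [← h0] at this
    have h2 : f t * f t = 0 := le_antisymm (by linarith) (mul_self_nonneg _)
    rw [mul_self_eq_zero.1 h2]
  · by_contra hneg
    push Not at hneg
    have hc : ContinuousOn f (Icc 0 t) := fun s hs =>
      ((hf s ⟨hs.1, hs.2.trans ht.2⟩).continuousWithinAt).mono (Icc_subset_Icc_right ht.2)
    obtain ⟨s, hs, hs0⟩ := intermediate_value_Icc' ht.1 hc ⟨hneg.le, h0.le⟩
    have := lo ⟨hs.1, hs.2.trans ht.2⟩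
    rw [hs0] at this
    have : 0 < Real.exp (-(2 * C) * s) * (f 0 * f 0) := by positivity
    linarith

lemma abs_sub_le_of_abs_deriv_le {D : ℝ}
    (hf : ∀ t ∈ Icc 0 τ, HasDerivWithinAt f (f' t) (Icc 0 τ) t)
    (hle : ∀ t ∈ Icc 0 τ, |f' t| ≤ D) {s t : ℝ} (hs : s ∈ Icc 0 τ) (ht : t ∈ Icc 0 τ) :
    |f t - f s| ≤ D * |t - s| :=
  (convex_Icc 0 τ).norm_image_sub_le_of_norm_hasDerivWithin_le hf hle hs ht

end DiffIneq

lemma smear_mono {f g : ℝ → ℝ} {a b : ℝ} (hf : SupLe f a) (hg : SupLe g b) (h : ∀ ξ, f ξ ≤ g ξ)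
    (ξ : ℝ) : smear f ξ ≤ smear g ξ :=
  integral_mono (hf.integrable_smear ξ) (hg.integrable_smear ξ) fun η =>
    mul_le_mul_of_nonneg_left (h η) (Real.exp_pos _).le

lemma smear_nonneg {f : ℝ → ℝ} (h : ∀ ξ, 0 ≤ f ξ) (ξ : ℝ) : 0 ≤ smear f ξ :=
  integral_nonneg fun η => mul_nonneg (Real.exp_pos _).le (h η)

lemma smear_add {f g : ℝ → ℝ} {a b : ℝ} (hf : SupLe f a) (hg : SupLe g b) (ξ : ℝ) :
    smear (fun x => f x + g x) ξ = smear f ξ + smear g ξ := by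
  unfold smear
  rw [← integral_add (hf.integrable_smear ξ) (hg.integrable_smear ξ)]
  simp only [mul_add]

lemma smear_const_mul (f : ℝ → ℝ) (a ξ : ℝ) : smear (fun x => a * f x) ξ = a * smear f ξ := by
  unfold smear
  rw [← integral_const_mul]
  congr 1; ext η; ring

lemma smear_const (a ξ : ℝ) : smear (fun _ => a) ξ = 2 * a := by
  unfold smear
  rw [integral_mul_const, integral_exp_sub]

/-- Comparison principle for differential inequalities with a smearing term. -/
theorem le_of_deriv_le_smear {φ φ' : ℝ → ℝ → ℝ} {τ C c β M m : ℝ} {B G : ℝ → ℝ}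
    (hφ : ∀ t ∈ Icc 0 τ, SupLe (φ t) M)
    (hd : ∀ t ∈ Icc 0 τ, ∀ ξ, HasDerivWithinAt (fun s => φ s ξ) (φ' t ξ) (Icc 0 τ) t)
    (hle : ∀ t ∈ Icc 0 τ, ∀ ξ, φ' t ξ ≤ C * (φ t ξ + B ξ * smear (φ t) ξ))
    (hC : 0 < C) (hB : ∀ ξ, 0 ≤ B ξ) (hBβ : ∀ ξ, B ξ ≤ β) (hG : SupLe G m) (hG0 : ∀ ξ, 0 ≤ G ξ)
    (hφG : ∀ ξ, φ 0 ξ ≤ G ξ) (hBG : ∀ ξ, B ξ * smear G ξ ≤ c * G ξ) (hc : 2 * β ≤ c)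
    {t : ℝ} (ht : t ∈ Icc 0 τ) (ξ : ℝ) :
    φ t ξ ≤ 2 * Real.exp (2 * (C * (1 + c)) * t) * G ξ := by
  have c0 : 0 ≤ c := by linarith [hB 0, hBβ 0]
  set l := 2 * (C * (1 + c)) with hl
  have l0 : 0 < l := by positivity
  have M0 : 0 ≤ M := (hφ t ht).nonneg
  -- Adding `ε` makes the comparison function bounded below, so that `φ ≤ M ≤ (M/ε)(G + ε)` can
  -- start the iteration. The condition `2β ≤ c` ensures that smearing the constant `ε` is absorbed
  -- too.
  have main : ∀ ε > 0, ∀ t ∈ Icc 0 τ, ∀ ξ, φ t ξ ≤ 2 * Real.exp (l * t) * (G ξ + ε) := by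
    intro ε hε
    have hGε : SupLe (fun ξ => G ξ + ε) (m + |ε|) := normPair_sup.S_add hG (normPair_sup.S_const ε)
    have hsm : ∀ ξ, B ξ * smear (fun ξ => G ξ + ε) ξ ≤ c * (G ξ + ε) := by
      intro ξ
      rw [smear_add hG (normPair_sup.S_const ε), smear_const]
      have := mul_le_mul_of_nonneg_right (hBβ ξ) hε.le
      nlinarith [hBG ξ]
    -- Inserting a bound with factor `a` into the differential inequality and integrating in time
    -- returns the factor `1 + a/2`, because the rate `l` is twice `C(1 + c)`. The iteration
    -- converges to its fixed point 2.
    have step : ∀ n : ℕ, ∀ t ∈ Icc 0 τ, ∀ ξ,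
        φ t ξ ≤ (2 + M / ε / 2 ^ n) * Real.exp (l * t) * (G ξ + ε) := by
      intro n
      induction n with
      | zero =>
        intro t ht ξ
        have h1 : 1 ≤ Real.exp (l * t) := Real.one_le_exp (mul_nonneg l0.le ht.1)
        have h2 : M = M / ε * ε := by field_simp
        have h3 : 0 ≤ M / ε := by positivity
        calc φ t ξ ≤ M := (le_abs_self _).trans ((hφ t ht).2 ξ)
          _ = M / ε * 1 * ε := by rw [mul_one, ← h2]
          _ ≤ (2 + M / ε / 2 ^ 0) * Real.exp (l * t) * (G ξ + ε) := by
              have := hG0 ξ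
              gcongr
              · simp
              · linarith
      | succ n ih =>
        intro t ht ξ
        set a := 2 + M / ε / 2 ^ n with ha
        have a0 : 0 ≤ a := by positivity
        have hder : ∀ s ∈ Icc 0 τ, φ' s ξ ≤ a / 2 * (G ξ + ε) * (l * Real.exp (l * s)) := by
          intro s hs
          have h1 : smear (φ s) ξ ≤ a * Real.exp (l * s) * smear (fun ξ => G ξ + ε) ξ := by
            rw [← smear_const_mul]
            exact smear_mono (hφ s hs) (normPair_sup.S_smul _ hGε) (ih s hs) ξ
          have h2 := mul_le_mul_of_nonneg_left h1 (hB ξ)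
          have h3 := mul_le_mul_of_nonneg_left (hsm ξ) (mul_nonneg a0 (Real.exp_pos (l * s)).le)
          have h4 := ih s hs ξ
          calc φ' s ξ ≤ C * (φ s ξ + B ξ * smear (φ s) ξ) := hle s hs ξ
            _ ≤ C * (a * Real.exp (l * s) * (G ξ + ε)
                  + a * Real.exp (l * s) * (c * (G ξ + ε))) :=
                mul_le_mul_of_nonneg_left (by linarith) hC.le
            _ = _ := by rw [hl]; ring
        have h5 := sub_le_sub_of_deriv_le (fun t ht => hd t ht ξ)
          (fun t _ => (hasDerivWithinAt_exp_mul l t (Icc 0 τ)).const_mul (a / 2 * (G ξ + ε)))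
          hder ht
        simp only [mul_zero, Real.exp_zero] at h5
        have h6 : 1 ≤ Real.exp (l * t) := Real.one_le_exp (mul_nonneg l0.le ht.1)
        have h7 : 0 ≤ G ξ + ε := by linarith [hG0 ξ]
        have h8 := mul_nonneg h7 (sub_nonneg.2 h6)
        have h9 : 2 + M / ε / 2 ^ (n + 1) = 1 + a / 2 := by rw [ha, pow_succ]; field_simp; ring
        rw [h9]
        nlinarith [hφG ξ, mul_nonneg a0 h7]
    intro t ht ξ
    have hlim : Tendsto (fun n : ℕ => (2 + M / ε / 2 ^ n) * Real.exp (l * t) * (G ξ + ε)) atTop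
        (𝓝 ((2 + 0) * Real.exp (l * t) * (G ξ + ε))) := by
      refine Tendsto.mul_const _ (Tendsto.mul_const _ (Tendsto.const_add _ ?_))
      exact tendsto_const_nhds.div_atTop (tendsto_pow_atTop_atTop_of_one_lt one_lt_two)
    rw [add_zero] at hlim
    exact ge_of_tendsto' hlim fun n => step n t ht ξ
  have hlim : Tendsto (fun ε : ℝ => 2 * Real.exp (l * t) * (G ξ + ε)) (𝓝[>] 0)
      (𝓝 (2 * Real.exp (l * t) * (G ξ + 0))) :=
    ((tendsto_id.const_add _).const_mul _).mono_left nhdsWithin_le_nhds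
  rw [add_zero] at hlim
  exact ge_of_tendsto hlim (by
    filter_upwards [self_mem_nhdsWithin] with ε hε using main ε hε t ht ξ)

/-! ### Pointwise evolution of solutions -/

lemma SupSol.hasDeriv {A : State → Prop} {𝒱 : State → State} {τ : ℝ} {Y₀ : State} {Y : ℝ → State}
    (h : SupSol A 𝒱 τ Y₀ Y) {t : ℝ} (ht : t ∈ Icc 0 τ) (ξ : ℝ) :
    HasDerivWithinAt (fun s => (Y s).ζ ξ) ((𝒱 (Y t)).ζ ξ) (Icc 0 τ) t ∧
    HasDerivWithinAt (fun s => (Y s).U ξ) ((𝒱 (Y t)).U ξ) (Icc 0 τ) t ∧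
    HasDerivWithinAt (fun s => (Y s).H ξ) ((𝒱 (Y t)).H ξ) (Icc 0 τ) t ∧
    HasDerivWithinAt (fun s => (Y s).v ξ) ((𝒱 (Y t)).v ξ) (Icc 0 τ) t ∧
    HasDerivWithinAt (fun s => (Y s).w ξ) ((𝒱 (Y t)).w ξ) (Icc 0 τ) t ∧
    HasDerivWithinAt (fun s => (Y s).h ξ) ((𝒱 (Y t)).h ξ) (Icc 0 τ) t := by
  refine ⟨?_, ?_, ?_, ?_, ?_, ?_⟩ <;> rw [hasDerivWithinAt_iff_isLittleO] <;>
    refine Asymptotics.isLittleO_iff.2 fun ε hε => ?_ <;>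
    filter_upwards [h.deriv t ht ε hε] with s hs <;> rw [Real.norm_eq_abs, Real.norm_eq_abs]
  · exact (hs ξ).1
  · exact (hs ξ).2.1
  · exact (hs ξ).2.2.1
  · exact (hs ξ).2.2.2.1
  · exact (hs ξ).2.2.2.2.1
  · exact (hs ξ).2.2.2.2.2

/-! ### Admissible states -/

/-- The pointwise relations of `𝒢`, everywhere on the line. -/
structure Adm (Y : State) : Prop where
  inv : ∀ ξ, Y.q ξ * Y.h ξ = Y.U ξ ^ 2 * Y.q ξ ^ 2 + Y.w ξ ^ 2
  q_nonneg : ∀ ξ, 0 ≤ Y.q ξ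
  h_nonneg : ∀ ξ, 0 ≤ Y.h ξ

/-- The energy density `U² + h`. -/
def energy (Y : State) (ξ : ℝ) : ℝ := Y.U ξ ^ 2 + Y.h ξ

/-- The factor in the bound of `source` by `h`. -/
def sourceConst (γ : ℝ) : ℝ := |(3 - 2 * γ) / 2| + |γ / 2|

lemma sourceConst_nonneg (γ : ℝ) : 0 ≤ sourceConst γ := by unfold sourceConst; positivity

namespace Adm

variable {Y : State} {γ M : ℝ}

lemma w_sq_le (hY : Adm Y) (ξ : ℝ) : Y.w ξ ^ 2 ≤ Y.q ξ * Y.h ξ := by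
  rw [hY.inv ξ]
  exact le_add_of_nonneg_left (by positivity)

/-- Divide the invariant `q h = U² q² + w²` by `q`; where `q = 0` the left side vanishes. Hence the
source is dominated by the energy `h` alone. -/
lemma U_sq_mul_q_le (hY : Adm Y) (ξ : ℝ) : Y.U ξ ^ 2 * Y.q ξ ≤ Y.h ξ := by
  rcases (hY.q_nonneg ξ).eq_or_lt with h | h
  · rw [← h, mul_zero]; exact hY.h_nonneg ξ
  · refine le_of_mul_le_mul_left ?_ h
    rw [hY.inv ξ]
    nlinarith [sq_nonneg (Y.w ξ)]

/-- `(U q ± w)² ≥ 0` and the invariant give `2 q |U w| ≤ q h`; where `q = 0` the invariant forces `w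
= 0`. As `2 U w` is the derivative of `U²`, this controls `U²` by the energy. -/
lemma two_abs_U_mul_w_le (hY : Adm Y) (ξ : ℝ) : |2 * (Y.U ξ * Y.w ξ)| ≤ Y.h ξ := by
  rcases (hY.q_nonneg ξ).eq_or_lt with h | h
  · have h1 := hY.w_sq_le ξ
    rw [← h, zero_mul] at h1
    have h2 : Y.w ξ = 0 := by nlinarith [sq_nonneg (Y.w ξ)]
    simpa [h2] using hY.h_nonneg ξ
  · have h1 := hY.inv ξ
    rw [abs_le]
    constructor <;> refine le_of_mul_le_mul_left ?_ h
    · nlinarith [sq_nonneg (Y.U ξ * Y.q ξ + Y.w ξ)]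
    · nlinarith [sq_nonneg (Y.U ξ * Y.q ξ - Y.w ξ)]

lemma abs_source_le (hY : Adm Y) (ξ : ℝ) : |source γ Y ξ| ≤ sourceConst γ * Y.h ξ := by
  have h0 := hY.h_nonneg ξ
  have h1 : 0 ≤ Y.U ξ ^ 2 * Y.q ξ := mul_nonneg (sq_nonneg _) (hY.q_nonneg ξ)
  rw [source, sourceConst, add_mul]
  refine (abs_add_le _ _).trans (add_le_add ?_ ?_)
  · rw [mul_assoc, abs_mul, abs_of_nonneg h1]
    exact mul_le_mul_of_nonneg_left (hY.U_sq_mul_q_le ξ) (abs_nonneg _)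
  · rw [abs_mul, abs_of_nonneg h0]

lemma energy_nonneg (hY : Adm Y) (ξ : ℝ) : 0 ≤ energy Y ξ :=
  add_nonneg (sq_nonneg _) (hY.h_nonneg ξ)

lemma h_le_energy (Y : State) (ξ : ℝ) : Y.h ξ ≤ energy Y ξ := le_add_of_nonneg_left (sq_nonneg _)

lemma U_sq_le_energy (hY : Adm Y) (ξ : ℝ) : Y.U ξ ^ 2 ≤ energy Y ξ :=
  le_add_of_nonneg_right (hY.h_nonneg ξ)

end Adm

lemma Bnd.energy {Y : State} {M : ℝ} (h : SupBnd M Y) : SupLe (energy Y) (M * M + M) :=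
  normPair_sup.S_add (by simpa only [sq] using normPair_sup.S_mul h.U h.U) h.h

/-- The factor in the bound of the potentials by the smeared energy density. -/
def potConst (γ M : ℝ) : ℝ := Real.exp (2 * M) * sourceConst γ

lemma potConst_nonneg (γ M : ℝ) : 0 ≤ potConst γ M :=
  mul_nonneg (Real.exp_pos _).le (sourceConst_nonneg γ)

/-! ### Potentials of admissible states in terms of the energy -/

section Potentials

variable {Y : State} {γ M : ℝ} {θ : ℝ → ℝ}

lemma Adm.abs_pot_le_smear (hY : Adm Y) (hM : SupBnd M Y) (hθ : Measurable θ)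
    (hθ1 : ∀ x, |θ x| ≤ 1) (ξ : ℝ) : |pot θ γ Y ξ| ≤ potConst γ M * smear (energy Y) ξ := by
  have hs := source_bnd (γ := γ) normPair_sup hM
  refine (abs_pot_le hθ hθ1 hM.ζ.essLe.1 hM.ζ.essLe.2 (hM.ζ.2 ξ) hs.essLe.1
    (hs.integrable_smear ξ)).trans ?_
  rw [← smear_const_mul]
  refine smear_mono (a := |Real.exp (2 * M)| * _) (normPair_sup.S_smul _ hs.abs)
    (normPair_sup.S_smul _ hM.energy) (fun η => ?_) ξ
  rw [potConst, mul_assoc]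
  refine mul_le_mul_of_nonneg_left ((hY.abs_source_le η).trans ?_) (Real.exp_pos _).le
  exact mul_le_mul_of_nonneg_left (Adm.h_le_energy Y η) (sourceConst_nonneg γ)

lemma Adm.abs_P_le_smear (hY : Adm Y) (hM : SupBnd M Y) (ξ : ℝ) :
    |P γ Y ξ| ≤ potConst γ M * smear (energy Y) ξ := by
  have h := hY.abs_pot_le_smear (γ := γ) hM (θ := fun _ => 1) measurable_const (by simp) ξ
  rw [P_eq, abs_mul]
  refine le_trans ?_ h
  norm_num
  linarith [abs_nonneg (pot (fun _ => 1) γ Y ξ)]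

lemma Adm.abs_Q_le_smear (hY : Adm Y) (hM : SupBnd M Y) (ξ : ℝ) :
    |Q γ Y ξ| ≤ potConst γ M * smear (energy Y) ξ := by
  have h := hY.abs_pot_le_smear (γ := γ) hM measurable_sign abs_sign_le ξ
  rw [Q_eq, abs_mul]
  refine le_trans ?_ h
  norm_num
  linarith [abs_nonneg (pot Real.sign γ Y ξ)]

/-- Because `q ≥ 0`, `y` is increasing and the kernel is at most 1. In contrast to the smeared
bound, no bound of `ζ` enters, so this one may be used to derive a priori bounds. -/
lemma Adm.abs_pot_le_integral (hY : Adm Y) (hE : ExactClass Y) (hi : Integrable Y.h)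
    (hθ1 : ∀ x, |θ x| ≤ 1) (ξ : ℝ) : |pot θ γ Y ξ| ≤ sourceConst γ * ∫ η, Y.h η := by
  have mono : Monotone Y.y := fun a b hab => by
    rw [← sub_nonneg, ← hE.prim_y.eq a b]
    exact intervalIntegral.integral_nonneg hab fun x _ => hY.q_nonneg x
  rw [← integral_const_mul, pot, ← Real.norm_eq_abs]
  refine norm_integral_le_of_norm_le (hi.const_mul _) (ae_of_all _ fun η => ?_)
  have hk : ker Y ξ η ≤ 1 := by
    rcases lt_trichotomy η ξ with h | h | h
    · rw [ker_of_lt h]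
      exact Real.exp_le_one_iff.2 (by linarith [mono h.le])
    · simp [ker, h]
    · rw [ker_of_gt h]
      exact Real.exp_le_one_iff.2 (by linarith [mono h.le])
  have h1 := mul_le_mul (hθ1 (ξ - η)) hk (ker_pos Y ξ η).le zero_le_one
  rw [Real.norm_eq_abs, abs_mul, abs_mul, abs_of_pos (ker_pos Y ξ η)]
  calc _ ≤ 1 * 1 * (sourceConst γ * Y.h η) :=
        mul_le_mul h1 (hY.abs_source_le η) (abs_nonneg _) (by norm_num)
    _ = _ := by ring

lemma Adm.abs_P_le_integral (hY : Adm Y) (hE : ExactClass Y) (hi : Integrable Y.h) (ξ : ℝ) :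
    |P γ Y ξ| ≤ sourceConst γ * ∫ η, Y.h η := by
  have h := hY.abs_pot_le_integral (γ := γ) hE hi (θ := fun _ => 1) (by simp) ξ
  rw [P_eq, abs_mul]
  refine le_trans ?_ h
  norm_num
  linarith [abs_nonneg (pot (fun _ => 1) γ Y ξ)]

lemma Adm.abs_Q_le_integral (hY : Adm Y) (hE : ExactClass Y) (hi : Integrable Y.h) (ξ : ℝ) :
    |Q γ Y ξ| ≤ sourceConst γ * ∫ η, Y.h η := by
  have h := hY.abs_pot_le_integral (γ := γ) hE hi abs_sign_le ξ
  rw [Q_eq, abs_mul]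
  refine le_trans ?_ h
  norm_num
  linarith [abs_nonneg (pot Real.sign γ Y ξ)]

end Potentials

/-! ### Decay of the exact solution -/

/-- A weight `ω`, compatible with the exponential kernel, and an integrable function `σ` which
dominates `1 / ω` and is compatible with the kernel as well. -/
structure DecayWeight (ω σ : ℝ → ℝ) (M₀ : ℝ) : Prop where
  meas_ω : Measurable ω
  meas_σ : Measurable σ
  one_le : ∀ ξ, 1 ≤ ω ξ
  σ_pos : ∀ ξ, 0 < σ ξ
  σ_le : ∀ ξ, σ ξ ≤ 1
  int_σ : Integrable σ
  integral_σ_le : ∫ ξ, σ ξ ≤ M₀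
  shift_ω : ∀ ξ η, ω ξ * Real.exp (-|ξ - η|) ≤ M₀ * ω η
  shift_σ : ∀ ξ η, σ η * Real.exp (-|ξ - η| / 2) ≤ M₀ * σ ξ
  inv_le : ∀ ξ, (ω ξ)⁻¹ ≤ σ ξ

/-- Admissible initial data whose energy density decays with the weight `ω`. -/
structure InitData (ω : ℝ → ℝ) (K : ℝ) (Y : State) : Prop extends Adm Y where
  exact : ExactClass Y
  bnd : SupBnd K Y
  int : Integrable (fun ξ => ω ξ * energy Y ξ)
  integral_le : ∫ ξ, ω ξ * energy Y ξ ≤ K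
  v_l2 : L2Le Y.v K

namespace DecayWeight

variable {ω σ : ℝ → ℝ} {M₀ : ℝ}

lemma pos (hω : DecayWeight ω σ M₀) (ξ : ℝ) : 0 < ω ξ := one_pos.trans_le (hω.one_le ξ)

lemma M₀_pos (hω : DecayWeight ω σ M₀) : 0 < M₀ := by
  have h := hω.shift_ω 0 0
  simp only [sub_self, abs_zero, neg_zero, Real.exp_zero, mul_one] at h
  have := hω.pos 0
  by_contra hc
  push Not at hc
  nlinarith [mul_nonpos_of_nonpos_of_nonneg hc this.le]

lemma supLe_σ (hω : DecayWeight ω σ M₀) : SupLe σ 1 :=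
  ⟨hω.meas_σ, fun ξ => by rw [abs_of_pos (hω.σ_pos ξ)]; exact hω.σ_le ξ⟩

lemma supLe_inv (hω : DecayWeight ω σ M₀) : SupLe (fun ξ => (ω ξ)⁻¹) 1 :=
  ⟨hω.meas_ω.inv, fun ξ => by
    rw [abs_of_pos (inv_pos.2 (hω.pos ξ))]; exact inv_le_one_of_one_le₀ (hω.one_le ξ)⟩

/-- One half of the exponent moves `σ` from `η` to `ξ`, the other half remains as an integrable
kernel of total mass 4. For `σ = e^{-|ξ|}` no such bound could hold, since `e^{-|·|} * e^{-|·|}`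
carries an additional factor `1 + |ξ|`. -/
lemma smear_σ_le (hω : DecayWeight ω σ M₀) (ξ : ℝ) : smear σ ξ ≤ 4 * M₀ * σ ξ := by
  have e : (fun η => Real.exp (-|ξ - η| / 2)) = fun η => Real.exp (-|ξ / 2 - η / 2|) := by
    ext η
    rw [← sub_div, abs_div, abs_two, neg_div]
  have hi : Integrable (fun η => Real.exp (-|ξ - η| / 2)) := by
    rw [e]
    exact (integrable_exp_sub (ξ / 2)).comp_div two_ne_zero
  have hv : ∫ η, Real.exp (-|ξ - η| / 2) = 4 := by
    rw [e, Measure.integral_comp_div (fun η => Real.exp (-|ξ / 2 - η|)), integral_exp_sub]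
    norm_num
  have h : smear σ ξ ≤ ∫ η, Real.exp (-|ξ - η| / 2) * (M₀ * σ ξ) := by
    refine integral_mono (hω.supLe_σ.integrable_smear ξ) (hi.mul_const _) fun η => ?_
    have e2 : Real.exp (-|ξ - η|) = Real.exp (-|ξ - η| / 2) * Real.exp (-|ξ - η| / 2) := by
      rw [← Real.exp_add]; ring_nf
    simp only
    rw [e2, mul_assoc, mul_comm _ (σ η)]
    exact mul_le_mul_of_nonneg_left (hω.shift_σ ξ η) (Real.exp_pos _).le
  rw [integral_mul_const, hv] at h
  linarith

/-- Smearing preserves the decay of functions which are integrable against the weight. -/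
lemma smear_le (hω : DecayWeight ω σ M₀) {f : ℝ → ℝ} {m : ℝ} (hf : SupLe f m) (hf0 : ∀ ξ, 0 ≤ f ξ)
    (hi : Integrable (fun ξ => ω ξ * f ξ)) (ξ : ℝ) :
    smear f ξ ≤ M₀ * (∫ η, ω η * f η) * (ω ξ)⁻¹ := by
  have h : ω ξ * smear f ξ ≤ ∫ η, M₀ * (ω η * f η) := by
    rw [smear, ← integral_const_mul]
    refine integral_mono ((hf.integrable_smear ξ).const_mul _) (hi.const_mul _) fun η => ?_
    simp only
    rw [← mul_assoc, ← mul_assoc]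
    exact mul_le_mul_of_nonneg_right (hω.shift_ω ξ η) (hf0 η)
  rw [integral_const_mul] at h
  rw [← div_eq_mul_inv, le_div_iff₀ (hω.pos ξ)]
  linarith

end DecayWeight

/-! ### Preservation of the pointwise relations and growth of the energy density -/

section Evolution

variable {γ τ M : ℝ} {Y₀ : State} {Y : ℝ → State}

/-- The relations of `𝒢` are preserved by the exact system. -/
theorem SupSol.adm (hY : SupSol ExactClass (HyperelasticRod.G γ) τ Y₀ Y) (h0 : Adm Y₀)
    (hM : ∀ t ∈ Icc 0 τ, SupBnd M (Y t)) {t : ℝ} (ht : t ∈ Icc 0 τ) : Adm (Y t) := by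
  have M0 : 0 ≤ M := (hM t ht).nonneg normPair_sup
  have h00 : (0 : ℝ) ∈ Icc 0 τ := ⟨le_rfl, ht.1.trans ht.2⟩
  -- The time derivative of `q h - U² q² - w²` vanishes identically, whatever the values of `P` and
  -- `Q`.
  have inv : ∀ ξ, ∀ t ∈ Icc 0 τ,
      (Y t).q ξ * (Y t).h ξ = (Y t).U ξ ^ 2 * (Y t).q ξ ^ 2 + (Y t).w ξ ^ 2 := by
    intro ξ t ht
    have hder : ∀ t ∈ Icc 0 τ, HasDerivWithinAt (fun s => (Y s).q ξ * (Y s).h ξ -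
        ((Y s).U ξ ^ 2 * (Y s).q ξ ^ 2 + (Y s).w ξ ^ 2)) 0 (Icc 0 τ) t := by
      intro t ht
      obtain ⟨-, h2, -, h4, h5, h6⟩ := hY.hasDeriv ht ξ
      have hq : HasDerivWithinAt (fun s => (Y s).q ξ) ((HyperelasticRod.G γ (Y t)).v ξ)
        (Icc 0 τ) t := h4.const_add 1
      refine ((hq.mul h6).sub (((h2.pow 2).mul (hq.pow 2)).add (h5.pow 2))).congr_deriv ?_
      simp only [HyperelasticRod.G, rhs, Pi.pow_apply]
      ring
    have h1 := abs_sub_le_of_abs_deriv_le (D := 0) hder (fun t _ => by simp) h00 ht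
    rw [zero_mul, abs_nonpos_iff, sub_eq_zero, hY.init, sub_eq_zero.2 (h0.inv ξ)] at h1
    linarith
  set B := potLip γ M * M with hB
  -- The invariant bounds `|w|` and `|U q|` by `|q + h|`, and the derivative of `q + h` is linear in
  -- these two with bounded coefficients. So `q + h` keeps its sign, and with `q h ≥ 0` both
  -- summands are nonnegative.
  have hsum : ∀ ξ, 0 ≤ (Y t).q ξ + (Y t).h ξ := by
    intro ξ
    have hder : ∀ t ∈ Icc 0 τ, HasDerivWithinAt (fun s => (Y s).q ξ + (Y s).h ξ)
        (γ * (Y t).w ξ + (HyperelasticRod.G γ (Y t)).h ξ) (Icc 0 τ) t := by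
      intro t ht
      obtain ⟨-, h2, -, h4, h5, h6⟩ := hY.hasDeriv ht ξ
      exact (h4.const_add 1).add h6
    refine nonneg_of_abs_deriv_le (C := |γ| + 2 * B + 3 * M ^ 2 + 2 * B) hder (fun t ht => ?_)
      (by rw [hY.init]; exact add_nonneg (h0.q_nonneg ξ) (h0.h_nonneg ξ)) ht
    have hI := inv ξ t ht
    set S := |(Y t).q ξ + (Y t).h ξ|
    have hS : (Y t).q ξ * (Y t).h ξ ≤ S ^ 2 := by
      rw [sq_abs]
      nlinarith [sq_nonneg ((Y t).q ξ + (Y t).h ξ), sq_nonneg ((Y t).q ξ), sq_nonneg ((Y t).h ξ)]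
    have S0 : 0 ≤ S := abs_nonneg _
    have hw : |(Y t).w ξ| ≤ S := abs_le_of_sq_le_sq (by nlinarith) S0
    have hu : |(Y t).U ξ * (Y t).q ξ| ≤ S := abs_le_of_sq_le_sq (by nlinarith) S0
    have hP := (P_bnd (γ := γ) potPair_sup (hM t ht)).S.2 ξ
    have hQ := (Q_bnd (γ := γ) potPair_sup (hM t ht)).S.2 ξ
    have hU := (hM t ht).U.2 ξ
    have e : γ * (Y t).w ξ + (HyperelasticRod.G γ (Y t)).h ξ = γ * (Y t).w ξ +
        (-2 * (Q γ (Y t) ξ * ((Y t).U ξ * (Y t).q ξ)) +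
          (3 * (Y t).U ξ ^ 2 - 2 * P γ (Y t) ξ) * (Y t).w ξ) := by
      simp only [HyperelasticRod.G, rhs]; ring
    rw [e]
    have B0 : 0 ≤ B := (abs_nonneg _).trans hP
    have hU2 : (Y t).U ξ ^ 2 ≤ M ^ 2 := sq_le_sq' (by linarith [abs_le.1 hU]) (abs_le.1 hU).2
    have t1 : |γ * (Y t).w ξ| ≤ |γ| * S := by
      rw [abs_mul]; exact mul_le_mul_of_nonneg_left hw (abs_nonneg _)
    have t2 : |-2 * (Q γ (Y t) ξ * ((Y t).U ξ * (Y t).q ξ))| ≤ 2 * (B * S) := by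
      rw [abs_mul, abs_mul, abs_neg, abs_two]
      exact mul_le_mul_of_nonneg_left (mul_le_mul hQ hu (abs_nonneg _) B0) zero_le_two
    have t3 : |(3 * (Y t).U ξ ^ 2 - 2 * P γ (Y t) ξ) * (Y t).w ξ| ≤ (3 * M ^ 2 + 2 * B) * S := by
      rw [abs_mul]
      refine mul_le_mul ?_ hw (abs_nonneg _) (by positivity)
      rw [abs_le] at hP ⊢
      constructor <;> nlinarith [sq_nonneg ((Y t).U ξ)]
    refine (abs_add_le _ _).trans ((add_le_add t1 ((abs_add_le _ _).trans
      (add_le_add t2 t3))).trans (le_of_eq ?_))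
    ring
  have hq : ∀ ξ, 0 ≤ (Y t).q ξ ∧ 0 ≤ (Y t).h ξ := by
    intro ξ
    have h1 := inv ξ t ht
    have h2 : 0 ≤ (Y t).q ξ * (Y t).h ξ := by rw [h1]; positivity
    have h3 := hsum ξ
    constructor <;> by_contra hc <;> push Not at hc <;> nlinarith
  exact ⟨fun ξ => inv ξ t ht, fun ξ => (hq ξ).1, fun ξ => (hq ξ).2⟩

lemma SupSol.hasDeriv_energy (hY : SupSol ExactClass (HyperelasticRod.G γ) τ Y₀ Y) {t : ℝ}
    (ht : t ∈ Icc 0 τ) (ξ : ℝ) :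
    HasDerivWithinAt (fun s => energy (Y s) ξ)
      (2 * (Y t).U ξ * (HyperelasticRod.G γ (Y t)).U ξ + (HyperelasticRod.G γ (Y t)).h ξ)
      (Icc 0 τ) t := by
  obtain ⟨-, h2, -, -, -, h6⟩ := hY.hasDeriv ht ξ
  refine ((h2.pow 2).add h6).congr_deriv ?_
  simp

/-- The mixed products `U Q` and `P w` are split by `2xy ≤ x² + y²`, and `w² ≤ q h ≤ (1 + M) h` is
absorbed. Keeping `P² + Q²` quadratic is essential for the second decay step. -/
lemma Adm.deriv_energy_le {Y : State} (hY : Adm Y) (hM : SupBnd M Y) (ξ : ℝ) :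
    2 * Y.U ξ * (HyperelasticRod.G γ Y).U ξ + (HyperelasticRod.G γ Y).h ξ ≤
      (2 + 4 * M) * (energy Y ξ + (P γ Y ξ ^ 2 + Q γ Y ξ ^ 2)) := by
  have M0 : 0 ≤ M := hM.nonneg normPair_sup
  have hw := hY.w_sq_le ξ
  have hq0 := hY.q_nonneg ξ
  have hh0 := hY.h_nonneg ξ
  have hq : Y.q ξ ≤ 1 + M := by
    have := (abs_le.1 (hM.v.2 ξ)).2
    simp only [State.q]; linarith
  have hwM := (abs_le.1 (hM.w.2 ξ)).2
  simp only [HyperelasticRod.G, rhs, energy]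
  set u := Y.U ξ
  set q := Y.q ξ
  set h := Y.h ξ
  set w := Y.w ξ
  set p := P γ Y ξ
  set r := Q γ Y ξ
  have h1 : q * h ≤ (1 + M) * h := mul_le_mul_of_nonneg_right hq hh0
  have h2 : 3 * (u ^ 2 * w) ≤ 3 * (u ^ 2 * M) := by
    have := mul_le_mul_of_nonneg_left hwM (sq_nonneg u); linarith
  have h3 : -(2 * (u * r)) * (1 + q) ≤ (u ^ 2 + r ^ 2) * (2 + M) := by
    have a1 : -(2 * (u * r)) ≤ u ^ 2 + r ^ 2 := by nlinarith [sq_nonneg (u + r)]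
    calc _ ≤ (u ^ 2 + r ^ 2) * (1 + q) := mul_le_mul_of_nonneg_right a1 (by linarith)
      _ ≤ _ := mul_le_mul_of_nonneg_left (by linarith) (by positivity)
  have h4 : -(2 * (p * w)) ≤ p ^ 2 + w ^ 2 := by nlinarith [sq_nonneg (p + w)]
  have h5 : 0 ≤ M * h := mul_nonneg M0 hh0
  have h6 : 0 ≤ M * p ^ 2 := mul_nonneg M0 (sq_nonneg p)
  have h7 : 0 ≤ M * r ^ 2 := mul_nonneg M0 (sq_nonneg r)
  nlinarith [sq_nonneg p, sq_nonneg r, sq_nonneg u]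

end Evolution

section Decay

variable {ω σ : ℝ → ℝ} {M₀ γ K M T : ℝ}

lemma InitData.energy_integrable (hω : DecayWeight ω σ M₀) {Y₀ : State} (h : InitData ω K Y₀) :
    Integrable (energy Y₀) := by
  refine h.int.mono' h.bnd.energy.1.aestronglyMeasurable (ae_of_all _ fun ξ => ?_)
  rw [Real.norm_eq_abs, abs_of_nonneg (h.energy_nonneg ξ)]
  exact le_mul_of_one_le_left (h.energy_nonneg ξ) (hω.one_le ξ)

/-- Decay of the energy density and of the potentials along exact solutions. -/
theorem exists_energy_le (hω : DecayWeight ω σ M₀) (γ K M T : ℝ) (hK : 0 ≤ K) (hM₁ : 0 ≤ M) :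
    ∃ C : ℝ, 0 ≤ C ∧ ∀ τ ≤ T, ∀ Y₀ Y, InitData ω K Y₀ →
      SupSol ExactClass (HyperelasticRod.G γ) τ Y₀ Y → (∀ t ∈ Icc 0 τ, SupBnd M (Y t)) →
      ∀ t ∈ Icc 0 τ, ∀ ξ, energy (Y t) ξ ≤ C * (energy Y₀ ξ + σ ξ) ∧
        smear (energy (Y t)) ξ ≤ C * (ω ξ)⁻¹ := by
  have M00 := hω.M₀_pos
  set a := potConst γ M with ha
  have a0 : 0 ≤ a := potConst_nonneg γ M
  set p := potLip γ M * M with hp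
  have p0 : 0 ≤ p := mul_nonneg (potLip_nonneg hM₁) hM₁
  set C₀ := (2 + 4 * M) * (1 + 2 * p * a) with hC₀
  have C₀pos : 0 < C₀ := by positivity
  set c₁ := M₀ * K + 4 * M₀ + 2 with hc₁
  have c₁0 : 0 ≤ c₁ := by positivity
  set C₁ := 2 * Real.exp (2 * (C₀ * (1 + c₁)) * T) with hC₁
  have C₁0 : 0 < C₁ := by positivity
  set D₀ := (2 + 4 * M) * (1 + 2 * a ^ 2 * (C₁ * c₁)) with hD₀
  have D₀pos : 0 < D₀ := by positivity
  set c₂ := M₀ * (K + M₀) + 2 with hc₂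
  have c₂0 : 0 ≤ c₂ := by positivity
  set C₂ := 2 * Real.exp (2 * (D₀ * (1 + c₂)) * T) with hC₂
  have C₂0 : 0 < C₂ := by positivity
  refine ⟨C₁ + C₂ * c₂, by positivity, fun τ hτ Y₀ Y h0 hY hM t ht ξ => ?_⟩
  have hadm : ∀ t ∈ Icc 0 τ, Adm (Y t) := fun t ht => hY.adm h0.toAdm hM ht
  have hφ : ∀ t ∈ Icc 0 τ, SupLe (energy (Y t)) (M * M + M) := fun t ht => (hM t ht).energy
  have hφ0 : ∀ t ∈ Icc 0 τ, ∀ ξ, 0 ≤ smear (energy (Y t)) ξ := fun t ht =>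
    smear_nonneg (hadm t ht).energy_nonneg
  have he0 := h0.bnd.energy
  have hs0 : ∀ ξ, smear (energy Y₀) ξ ≤ M₀ * K * (ω ξ)⁻¹ := fun ξ =>
    (hω.smear_le he0 h0.energy_nonneg h0.int ξ).trans
      (mul_le_mul_of_nonneg_right (mul_le_mul_of_nonneg_left h0.integral_le M00.le)
        (inv_pos.2 (hω.pos ξ)).le)
  have hG : SupLe (fun ξ => energy Y₀ ξ + σ ξ) _ := normPair_sup.S_add he0 hω.supLe_σ
  have hsG : ∀ ξ, smear (fun ξ => energy Y₀ ξ + σ ξ) ξ ≤ c₁ * σ ξ := by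
    intro ξ
    rw [smear_add he0 hω.supLe_σ]
    have h1 := mul_le_mul_of_nonneg_left (hω.inv_le ξ) (mul_nonneg M00.le hK)
    rw [hc₁]
    linarith [hs0 ξ, hω.smear_σ_le ξ, hω.σ_pos ξ]
  have exp_le : ∀ {c t : ℝ}, 0 ≤ c → t ∈ Icc 0 τ →
      2 * Real.exp (2 * c * t) ≤ 2 * Real.exp (2 * c * T) := by
    intro c t hc ht
    have := ht.2.trans hτ
    gcongr
  -- First pass: one factor of `P²` and `Q²` is bounded by a constant, the other by the smeared
  -- energy. The comparison function `energy Y₀ + σ` is nearly stable under smearing, `σ` having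
  -- been chosen for that.
  have first : ∀ t ∈ Icc 0 τ, ∀ ξ, energy (Y t) ξ ≤ C₁ * (energy Y₀ ξ + σ ξ) := by
    intro t ht ξ
    have hG0 : ∀ ξ, 0 ≤ energy Y₀ ξ + σ ξ := fun ξ =>
      add_nonneg (h0.energy_nonneg ξ) (hω.σ_pos ξ).le
    refine (le_of_deriv_le_smear (φ := fun t => energy (Y t)) (B := fun _ => 1) (β := 1) (C := C₀)
      (c := c₁) (G := fun ξ => energy Y₀ ξ + σ ξ) hφ (fun t ht ξ => hY.hasDeriv_energy ht ξ)
      (fun t ht ξ => ?_) C₀pos (fun _ => zero_le_one) (fun _ => le_rfl) hG hG0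
      (fun ξ => ?_) (fun ξ => ?_) ?_ ht ξ).trans ?_
    · refine ((hadm t ht).deriv_energy_le (hM t ht) ξ).trans ?_
      rw [hC₀, mul_assoc]
      refine mul_le_mul_of_nonneg_left ?_ (by positivity)
      have hP := (P_bnd (γ := γ) potPair_sup (hM t ht)).S.2 ξ
      have hQ := (Q_bnd (γ := γ) potPair_sup (hM t ht)).S.2 ξ
      have hP' := (hadm t ht).abs_P_le_smear (γ := γ) (hM t ht) ξ
      have hQ' := (hadm t ht).abs_Q_le_smear (γ := γ) (hM t ht) ξ
      have h1 := mul_le_mul hP hP' (abs_nonneg _) p0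
      have h2 := mul_le_mul hQ hQ' (abs_nonneg _) p0
      rw [abs_mul_abs_self] at h1 h2
      have h3 := (hadm t ht).energy_nonneg ξ
      have h4 := hφ0 t ht ξ
      have h5 : 0 ≤ p * a * energy (Y t) ξ := by positivity
      rw [sq, sq, one_mul]
      linarith
    · simp only [hY.init]; linarith [hω.σ_pos ξ]
    · rw [one_mul]
      exact (hsG ξ).trans (mul_le_mul_of_nonneg_left (by linarith [h0.energy_nonneg ξ]) c₁0)
    · rw [hc₁]; nlinarith [mul_nonneg M00.le hK]
    · exact mul_le_mul_of_nonneg_right (exp_le (by positivity) ht) (hG0 ξ)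
  have second : ∀ t ∈ Icc 0 τ, ∀ ξ, smear (energy (Y t)) ξ ≤ C₁ * c₁ * σ ξ := by
    intro t ht ξ
    have h1 := smear_mono (hφ t ht) (normPair_sup.S_smul C₁ hG) (first t ht) ξ
    rw [smear_const_mul] at h1
    rw [mul_assoc]
    exact h1.trans (mul_le_mul_of_nonneg_left (hsG ξ) C₁0.le)
  -- Second pass: one factor of `P²` and `Q²` is now known to decay like `σ`. The comparison
  -- function becomes integrable against `ω` because `σ` is integrable, and hence its smearing,
  -- unlike that of `σ`, decays like `1/ω`.
  set G₂ : ℝ → ℝ := fun ξ => energy Y₀ ξ + σ ξ * (ω ξ)⁻¹ with hG₂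
  have hσω := normPair_sup.S_mul hω.supLe_σ hω.supLe_inv
  have hσω0 : ∀ ξ, 0 ≤ σ ξ * (ω ξ)⁻¹ := fun ξ =>
    mul_nonneg (hω.σ_pos ξ).le (inv_pos.2 (hω.pos ξ)).le
  have hG₂s : SupLe G₂ _ := normPair_sup.S_add he0 hσω
  have hG₂0 : ∀ ξ, 0 ≤ G₂ ξ := fun ξ => add_nonneg (h0.energy_nonneg ξ) (hσω0 ξ)
  have hsG₂ : ∀ ξ, smear G₂ ξ ≤ c₂ * (ω ξ)⁻¹ := by
    intro ξ
    rw [hG₂, smear_add he0 hσω]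
    have e : (fun ξ => ω ξ * (σ ξ * (ω ξ)⁻¹)) = σ := by
      ext ξ
      field_simp [(hω.pos ξ).ne']
    have h1 := hω.smear_le hσω hσω0 (by rw [e]; exact hω.int_σ) ξ
    rw [e] at h1
    have h2 := inv_pos.2 (hω.pos ξ)
    have h3 : M₀ * (∫ ξ, σ ξ) * (ω ξ)⁻¹ ≤ M₀ * M₀ * (ω ξ)⁻¹ :=
      mul_le_mul_of_nonneg_right (mul_le_mul_of_nonneg_left hω.integral_σ_le M00.le) h2.le
    rw [hc₂]
    linarith [hs0 ξ]
  have third : ∀ t ∈ Icc 0 τ, ∀ ξ, energy (Y t) ξ ≤ C₂ * G₂ ξ := by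
    intro t ht ξ
    refine (le_of_deriv_le_smear (φ := fun t => energy (Y t)) (B := σ) (β := 1) (C := D₀)
      (c := c₂) (G := G₂) hφ (fun t ht ξ => hY.hasDeriv_energy ht ξ)
      (fun t ht ξ => ?_) D₀pos (fun ξ => (hω.σ_pos ξ).le) hω.σ_le hG₂s hG₂0
      (fun ξ => ?_) (fun ξ => ?_) ?_ ht ξ).trans ?_
    · refine ((hadm t ht).deriv_energy_le (hM t ht) ξ).trans ?_
      rw [hD₀, mul_assoc]
      refine mul_le_mul_of_nonneg_left ?_ (by positivity)
      set s := smear (energy (Y t)) ξ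
      have h4 : 0 ≤ s := hφ0 t ht ξ
      have hP := (hadm t ht).abs_P_le_smear (γ := γ) (hM t ht) ξ
      have hQ := (hadm t ht).abs_Q_le_smear (γ := γ) (hM t ht) ξ
      have h1 := mul_le_mul hP hP (abs_nonneg _) (mul_nonneg a0 h4)
      have h2 := mul_le_mul hQ hQ (abs_nonneg _) (mul_nonneg a0 h4)
      rw [abs_mul_abs_self] at h1 h2
      have h3 := (hadm t ht).energy_nonneg ξ
      have h5 : s * s ≤ C₁ * c₁ * σ ξ * s := mul_le_mul_of_nonneg_right (second t ht ξ) h4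
      have h6 := mul_le_mul_of_nonneg_left h5 (sq_nonneg a)
      have h7 : 0 ≤ a ^ 2 * (C₁ * c₁) * energy (Y t) ξ := by positivity
      have h8 : 0 ≤ σ ξ * s := mul_nonneg (hω.σ_pos ξ).le h4
      rw [sq, sq]
      linarith
    · simp only [hY.init, hG₂]; linarith [hσω0 ξ]
    · calc σ ξ * smear G₂ ξ ≤ σ ξ * (c₂ * (ω ξ)⁻¹) :=
            mul_le_mul_of_nonneg_left (hsG₂ ξ) (hω.σ_pos ξ).le
        _ = c₂ * (σ ξ * (ω ξ)⁻¹) := by ring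
        _ ≤ _ := mul_le_mul_of_nonneg_left (by simp only [hG₂]; linarith [h0.energy_nonneg ξ]) c₂0
    · rw [hc₂]; nlinarith [mul_nonneg M00.le hK, mul_pos M00 M00]
    · exact mul_le_mul_of_nonneg_right (exp_le (by positivity) ht) (hG₂0 ξ)
  have h2 := (inv_pos.2 (hω.pos ξ)).le
  refine ⟨(first t ht ξ).trans (mul_le_mul_of_nonneg_right (by nlinarith) ?_), ?_⟩
  · exact add_nonneg (h0.energy_nonneg ξ) (hω.σ_pos ξ).le
  · have h1 := smear_mono (hφ t ht) (normPair_sup.S_smul C₂ hG₂s) (third t ht) ξ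
    rw [smear_const_mul] at h1
    refine h1.trans ((mul_le_mul_of_nonneg_left (hsG₂ ξ) C₂0.le).trans ?_)
    rw [← mul_assoc]
    exact mul_le_mul_of_nonneg_right (by linarith) h2

end Decay

/-! ### Conservation of energy and a priori bounds -/

lemma exists_gt_lt_of_integrable {g : ℝ → ℝ} (hg : Integrable g) {ε : ℝ} (hε : 0 < ε) (a : ℝ) :
    ∃ b, a < b ∧ g b < ε := by
  by_contra hc
  push Not at hc
  have h1 : IntegrableOn (fun _ : ℝ => ε) (Ioi a) := by
    refine hg.integrableOn.mono' aestronglyMeasurable_const ?_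
    filter_upwards [ae_restrict_mem measurableSet_Ioi] with x hx
    rw [Real.norm_eq_abs, abs_of_pos hε]
    exact hc x hx
  rw [integrableOn_const_iff] at h1
  simp [hε.ne'] at h1

lemma exists_lt_lt_of_integrable {g : ℝ → ℝ} (hg : Integrable g) {ε : ℝ} (hε : 0 < ε) (a : ℝ) :
    ∃ b, b < a ∧ g b < ε := by
  obtain ⟨b, hb, hb'⟩ := exists_gt_lt_of_integrable hg.comp_neg hε (-a)
  exact ⟨-b, by linarith, hb'⟩

section Apriori

variable {γ τ M C : ℝ} {Y₀ : State} {Y : ℝ → State} {g : ℝ → ℝ}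

lemma abs_U_le_of_energy_le {Y : State} (hY : Adm Y) {ξ ε : ℝ} (hε : 0 ≤ ε)
    (h : energy Y ξ ≤ ε ^ 2) : |Y.U ξ| ≤ ε :=
  abs_le_of_sq_le_sq ((hY.U_sq_le_energy ξ).trans h) hε

lemma integrable_h_of_energy_le {Y : State} (hY : Adm Y) (hM : SupBnd M Y) (hg : Integrable g)
    (h : ∀ ξ, energy Y ξ ≤ g ξ) : Integrable Y.h :=
  hg.mono' hM.h.1.aestronglyMeasurable (ae_of_all _ fun ξ => by
    rw [Real.norm_eq_abs, abs_of_nonneg (hY.h_nonneg ξ)]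
    exact (Adm.h_le_energy Y ξ).trans (h ξ))

/-- The total energy does not increase. -/
theorem SupSol.integral_h_le (hY : SupSol ExactClass (HyperelasticRod.G γ) τ Y₀ Y) (h0 : Adm Y₀)
    (hM : ∀ t ∈ Icc 0 τ, SupBnd M (Y t)) (hg : Integrable g)
    (hle : ∀ t ∈ Icc 0 τ, ∀ ξ, energy (Y t) ξ ≤ g ξ) {t : ℝ} (ht : t ∈ Icc 0 τ) :
    ∫ ξ, (Y t).h ξ ≤ ∫ ξ, Y₀.h ξ := by
  have h00 : (0 : ℝ) ∈ Icc 0 τ := ⟨le_rfl, ht.1.trans ht.2⟩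
  have M0 : 0 ≤ M := (hM t ht).nonneg normPair_sup
  have hadm : ∀ t ∈ Icc 0 τ, Adm (Y t) := fun t ht => hY.adm h0 hM ht
  have hi : ∀ t ∈ Icc 0 τ, Integrable (Y t).h := fun t ht =>
    integrable_h_of_energy_le (hadm t ht) (hM t ht) hg (hle t ht)
  have hi0 := hi 0 h00
  rw [hY.init] at hi0
  set B := M ^ 2 + 2 * (potLip γ M * M) with hB
  have B0 : 0 ≤ B := by have := potLip_nonneg (γ := γ) M0; positivity
  -- `H_t` contains the factor `U`, which is small wherever the majorant `g` is small, uniformly in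
  -- time. Integrability of `g` supplies such points arbitrarily far out on both sides, and between
  -- them `∫ h` is a difference of values of `H`.
  have flux : ∀ ε : ℝ, 0 ≤ ε → ∀ ξ, g ξ < ε ^ 2 → |(Y t).H ξ - Y₀.H ξ| ≤ B * ε * τ := by
    intro ε hε ξ hξ
    have h1 := abs_sub_le_of_abs_deriv_le (D := B * ε)
      (fun t ht => (hY.hasDeriv ht ξ).2.2.1) (fun t ht => ?_) h00 ht
    · rw [hY.init, sub_zero, abs_of_nonneg ht.1] at h1
      exact h1.trans (mul_le_mul_of_nonneg_left ht.2 (by positivity))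
    · have hU := abs_U_le_of_energy_le (hadm t ht) hε ((hle t ht ξ).trans hξ.le)
      have hP := (P_bnd (γ := γ) potPair_sup (hM t ht)).S.2 ξ
      have hUM := (hM t ht).U.2 ξ
      have e : (HyperelasticRod.G γ (Y t)).H ξ =
          ((Y t).U ξ ^ 2 - 2 * P γ (Y t) ξ) * (Y t).U ξ := by
        simp only [HyperelasticRod.G, rhs]; ring
      rw [e, abs_mul]
      refine mul_le_mul ?_ hU (abs_nonneg _) B0
      have hU2 : (Y t).U ξ ^ 2 ≤ M ^ 2 := sq_le_sq' (by linarith [abs_le.1 hUM]) (abs_le.1 hUM).2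
      rw [abs_le] at hP ⊢
      constructor <;> nlinarith [sq_nonneg ((Y t).U ξ)]
  have h0t : τ ≥ 0 := h00.2
  have hloc : ∀ n : ℝ, 0 ≤ n → ∫ ξ in -n..n, (Y t).h ξ ≤ ∫ ξ, Y₀.h ξ := by
    intro n hn
    refine le_of_forall_pos_le_add fun δ hδ => ?_
    set ε := δ / (2 * (B * τ + 1)) with hε
    have ε0 : 0 < ε := by positivity
    obtain ⟨a, ha, ha'⟩ := exists_lt_lt_of_integrable hg (sq_pos_of_pos ε0) (-n)
    obtain ⟨b, hb, hb'⟩ := exists_gt_lt_of_integrable hg (sq_pos_of_pos ε0) n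
    have hab : a ≤ b := by linarith
    have h1 : ∫ ξ in -n..n, (Y t).h ξ ≤ ∫ ξ in a..b, (Y t).h ξ :=
      intervalIntegral.integral_mono_interval ha.le (by linarith) hb.le
        (ae_of_all _ (hadm t ht).h_nonneg) (hi t ht).intervalIntegrable
    have h2 : ∫ ξ in a..b, Y₀.h ξ ≤ ∫ ξ, Y₀.h ξ := by
      rw [intervalIntegral.integral_of_le hab]
      exact setIntegral_le_integral hi0 (ae_of_all _ h0.h_nonneg)
    have hE0 := hY.mem 0 h00
    rw [hY.init] at hE0
    rw [(hY.mem t ht).H.eq a b] at h1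
    rw [hE0.H.eq] at h2
    have h3 := abs_le.1 (flux ε ε0.le a ha')
    have h4 := abs_le.1 (flux ε ε0.le b hb')
    have h5 : 2 * (B * ε * τ) ≤ δ := by
      have : 2 * (B * τ + 1) * ε = δ := by rw [hε]; field_simp
      nlinarith
    linarith
  refine le_of_tendsto (intervalIntegral_tendsto_integral (hi t ht)
    (tendsto_neg_atTop_atBot.comp tendsto_natCast_atTop_atTop) tendsto_natCast_atTop_atTop)
    (Eventually.of_forall fun n => hloc n n.cast_nonneg)

/-- Integrate `(U²)_ξ = 2 U w ≤ h` from a point far to the left where `U²` is as small as desired.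
-/
lemma Adm.U_sq_le {Y : State} (hY : Adm Y) (hE : ExactClass Y) (hi : Integrable Y.h)
    (hg : Integrable g) (hle : ∀ ξ, energy Y ξ ≤ g ξ) (ξ : ℝ) : Y.U ξ ^ 2 ≤ ∫ ξ, Y.h ξ := by
  refine le_of_forall_pos_le_add fun ε hε => ?_
  obtain ⟨a, ha, ha'⟩ := exists_lt_lt_of_integrable hg hε ξ
  have h1 := (hE.U.mul hE.U).eq a ξ
  have h2 : ∫ x in a..ξ, (Y.w x * Y.U x + Y.U x * Y.w x) ≤ ∫ x in a..ξ, Y.h x := by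
    refine intervalIntegral.integral_mono_on ha.le ((hE.U.mul hE.U).int a ξ) (hE.H.int a ξ)
      fun x _ => ?_
    linarith [(abs_le.1 (hY.two_abs_U_mul_w_le x)).2]
  have h3 : ∫ x in a..ξ, Y.h x ≤ ∫ x, Y.h x := by
    rw [intervalIntegral.integral_of_le ha.le]
    exact setIntegral_le_integral hi (ae_of_all _ hY.h_nonneg)
  have h4 := (hY.U_sq_le_energy a).trans (hle a)
  nlinarith

end Apriori

/-- Growth of `1 + v² + w² + h²` along the linear part of the system. -/
lemma abs_mul_sum_le {γ A B D : ℝ} {Y : State} {ξ : ℝ}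
    (hA : |(3 - 2 * γ) / 2 * Y.U ξ ^ 2 - P γ Y ξ| ≤ A) (hB : |Q γ Y ξ * Y.U ξ| ≤ B)
    (hD : |3 * Y.U ξ ^ 2 - 2 * P γ Y ξ| ≤ D) :
    2 * Y.v ξ * (HyperelasticRod.G γ Y).v ξ + 2 * Y.w ξ * (HyperelasticRod.G γ Y).w ξ
      + 2 * Y.h ξ * (HyperelasticRod.G γ Y).h ξ ≤
      (2 * |γ| + 2 * A + 4 * B + D) * (1 + (Y.v ξ ^ 2 + Y.w ξ ^ 2 + Y.h ξ ^ 2)) := by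
  simp only [HyperelasticRod.G, rhs, State.q]
  set v := Y.v ξ
  set w := Y.w ξ
  set h := Y.h ξ
  set a := (3 - 2 * γ) / 2 * Y.U ξ ^ 2 - P γ Y ξ
  set b := Q γ Y ξ * Y.U ξ with hb
  set d := 3 * Y.U ξ ^ 2 - 2 * P γ Y ξ
  set m := 1 + (v ^ 2 + w ^ 2 + h ^ 2) with hm
  have hv := sq_nonneg v
  have hw := sq_nonneg w
  have hh := sq_nonneg h
  -- Every term is a bounded coefficient times `2yz ≤ y² + z²`. The summand 1 in `m` pairs with the
  -- inhomogeneous part that comes from `q = 1 + v`.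
  have key : ∀ {x y z c : ℝ}, |x| ≤ c → y ^ 2 + z ^ 2 ≤ m → x * (2 * (y * z)) ≤ c * m := by
    intro x y z c hx hy
    refine (le_abs_self _).trans ?_
    rw [abs_mul]
    refine mul_le_mul hx ?_ (abs_nonneg _) ((abs_nonneg _).trans hx)
    rw [abs_le]
    constructor <;> linarith [sq_nonneg (y + z), sq_nonneg (y - z), add_sq y z, sub_sq y z]
  have k1 := key (y := v) (z := w) (le_refl |γ|) (by linarith)
  have k2 := key (y := w) (z := h) (le_refl |γ|) (by linarith)
  have k3 := key (y := w) (z := 1) hA (by linarith)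
  have k4 := key (y := w) (z := v) hA (by linarith)
  have k5 := key (x := -b) (c := B) (y := h) (z := 1) (by rwa [abs_neg]) (by linarith)
  have k6 := key (x := -b) (c := B) (y := h) (z := v) (by rwa [abs_neg]) (by linarith)
  have k7 := key (y := h) (z := w) hD (by linarith)
  have k8 : 0 ≤ |γ| * m := by positivity
  have e : 2 * v * (γ * w) + 2 * w * (γ / 2 * h + a * (1 + v)) +
      2 * h * (-2 * Q γ Y ξ * Y.U ξ * (1 + v) + d * w) =
      γ * (2 * (v * w)) + 1 / 2 * (γ * (2 * (w * h))) + a * (2 * (w * 1)) + a * (2 * (w * v))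
        + 2 * (-b * (2 * (h * 1))) + 2 * (-b * (2 * (h * v))) + d * (2 * (h * w)) := by
    rw [hb]; ring
  rw [e]
  linarith

set_option maxHeartbeats 1000000 in
/-- Bounds for the exact solution which depend on the size of the initial data only. -/
theorem exists_apriori {ω σ : ℝ → ℝ} {M₀ : ℝ} (hω : DecayWeight ω σ M₀) (γ K T : ℝ) (hK : 0 ≤ K)
    (hT : 0 ≤ T) :
    ∃ M : ℝ, K ≤ M ∧ ∀ M₁ : ℝ, 0 ≤ M₁ → ∀ τ ≤ T, ∀ Y₀ Y, InitData ω K Y₀ →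
      SupSol ExactClass (HyperelasticRod.G γ) τ Y₀ Y → (∀ t ∈ Icc 0 τ, SupBnd M₁ (Y t)) →
      ∀ t ∈ Icc 0 τ, SupBnd M (Y t) := by
  set u := 1 + K with hu
  have u0 : 0 ≤ u := by positivity
  set p := sourceConst γ * K with hp
  have p0 : 0 ≤ p := mul_nonneg (sourceConst_nonneg γ) hK
  set A := |(3 - 2 * γ) / 2| * u ^ 2 + p with hA
  have A0 : 0 ≤ A := by positivity
  set D := 3 * u ^ 2 + 2 * p with hD
  have D0 : 0 ≤ D := by positivity
  set L := 2 * |γ| + 2 * A + 4 * (p * u) + D with hL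
  have L0 : 0 ≤ L := by positivity
  set n₀ := Real.exp (L * T) * (1 + 3 * K ^ 2) with hn₀
  have n₀0 : 0 ≤ n₀ := by positivity
  set M := K + u + |γ| * u * T + (u ^ 2 + 2 * p) * u * T + n₀ with hMdef
  have hKM : K ≤ M := by
    have : 0 ≤ u + |γ| * u * T + (u ^ 2 + 2 * p) * u * T + n₀ := by positivity
    linarith
  refine ⟨M, hKM, fun M₁ hM₁ τ hτ Y₀ Y h0 hY hM t ht => ?_⟩
  have h00 : (0 : ℝ) ∈ Icc 0 τ := ⟨le_rfl, ht.1.trans ht.2⟩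
  -- The constant `C` depends on `M₁`, but it is used only to know that an integrable majorant
  -- exists. It enters none of the final bounds, so `M` is independent of `M₁`, as the continuation
  -- argument requires.
  obtain ⟨C, hC0, hC⟩ := exists_energy_le hω γ K M₁ T hK hM₁
  have hadm : ∀ t ∈ Icc 0 τ, Adm (Y t) := fun t ht => hY.adm h0.toAdm hM ht
  have hg : Integrable (fun ξ => C * (energy Y₀ ξ + σ ξ)) :=
    ((h0.energy_integrable hω).add hω.int_σ).const_mul C
  have hle : ∀ t ∈ Icc 0 τ, ∀ ξ, energy (Y t) ξ ≤ C * (energy Y₀ ξ + σ ξ) := fun t ht ξ =>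
    (hC τ hτ Y₀ Y h0 hY hM t ht ξ).1
  have hi : ∀ t ∈ Icc 0 τ, Integrable (Y t).h := fun t ht =>
    integrable_h_of_energy_le (hadm t ht) (hM t ht) hg (hle t ht)
  have hi0 := hi 0 h00
  rw [hY.init] at hi0
  have hint : ∀ t ∈ Icc 0 τ, ∫ ξ, (Y t).h ξ ≤ K := by
    intro t ht
    refine (hY.integral_h_le h0.toAdm hM hg hle ht).trans (le_trans ?_ h0.integral_le)
    refine integral_mono hi0 h0.int fun ξ => (Adm.h_le_energy Y₀ ξ).trans ?_
    exact le_mul_of_one_le_left (h0.energy_nonneg ξ) (hω.one_le ξ)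
  have hU : ∀ t ∈ Icc 0 τ, ∀ ξ, |(Y t).U ξ| ≤ u := by
    intro t ht ξ
    refine abs_le_of_sq_le_sq ?_ u0
    have := ((hadm t ht).U_sq_le (hY.mem t ht) (hi t ht) hg (hle t ht) ξ).trans (hint t ht)
    rw [hu]; nlinarith
  have hU2 : ∀ t ∈ Icc 0 τ, ∀ ξ, (Y t).U ξ ^ 2 ≤ u ^ 2 := fun t ht ξ =>
    sq_le_sq' (by linarith [abs_le.1 (hU t ht ξ)]) (abs_le.1 (hU t ht ξ)).2
  have hP : ∀ t ∈ Icc 0 τ, ∀ ξ, |P γ (Y t) ξ| ≤ p := fun t ht ξ =>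
    ((hadm t ht).abs_P_le_integral (hY.mem t ht) (hi t ht) ξ).trans
      (mul_le_mul_of_nonneg_left (hint t ht) (sourceConst_nonneg γ))
  have hQ : ∀ t ∈ Icc 0 τ, ∀ ξ, |Q γ (Y t) ξ| ≤ p := fun t ht ξ =>
    ((hadm t ht).abs_Q_le_integral (hY.mem t ht) (hi t ht) ξ).trans
      (mul_le_mul_of_nonneg_left (hint t ht) (sourceConst_nonneg γ))
  have htT : t ≤ T := ht.2.trans hτ
  have grow : ∀ {f f' : ℝ → ℝ} {d : ℝ}, 0 ≤ d →
      (∀ t ∈ Icc 0 τ, HasDerivWithinAt f (f' t) (Icc 0 τ) t) → (∀ t ∈ Icc 0 τ, |f' t| ≤ d) →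
      |f 0| ≤ K → |f t| ≤ K + d * T := by
    intro f f' d hd hf hf' hf0
    have h1 := abs_sub_le_of_abs_deriv_le hf hf' h00 ht
    rw [sub_zero, abs_of_nonneg ht.1] at h1
    have h2 := mul_le_mul_of_nonneg_left htT hd
    have h3 := abs_sub_abs_le_abs_sub (f t) (f 0)
    linarith
  refine (hM t ht).stateMeas.supBnd fun ξ => ?_
  have hb0 := h0.bnd.ptBnd ξ
  have hder := fun (t : ℝ) (ht : t ∈ Icc 0 τ) => hY.hasDeriv ht ξ
  have hζ : |(Y t).ζ ξ| ≤ K + |γ| * u * T := by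
    refine grow (by positivity) (fun t ht => (hder t ht).1) (fun t ht => ?_)
      (by rw [hY.init]; exact hb0.1)
    change |γ * (Y t).U ξ| ≤ _
    rw [abs_mul]
    exact mul_le_mul_of_nonneg_left (hU t ht ξ) (abs_nonneg _)
  have hH : |(Y t).H ξ| ≤ K + (u ^ 2 + 2 * p) * u * T := by
    refine grow (by positivity) (fun t ht => (hder t ht).2.2.1) (fun t ht => ?_)
      (by rw [hY.init]; exact hb0.2.2.1)
    have e : (HyperelasticRod.G γ (Y t)).H ξ = ((Y t).U ξ ^ 2 - 2 * P γ (Y t) ξ) * (Y t).U ξ := by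
      simp only [HyperelasticRod.G, rhs]; ring
    rw [e, abs_mul]
    refine mul_le_mul ?_ (hU t ht ξ) (abs_nonneg _) (by positivity)
    have h1 := abs_le.1 (hP t ht ξ)
    rw [abs_le]
    constructor <;> linarith [sq_nonneg ((Y t).U ξ), hU2 t ht ξ]
  -- With `U`, `P`, `Q` bounded, `(v, w, h)` solves an affine linear system at each `ξ`, so this
  -- quantity grows at most exponentially from its initial value, which is at most `1 + 3K²`.
  set n : ℝ → ℝ := fun t => 1 + ((Y t).v ξ ^ 2 + (Y t).w ξ ^ 2 + (Y t).h ξ ^ 2) with hn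
  have hn' : ∀ t ∈ Icc 0 τ, HasDerivWithinAt n
      (2 * (Y t).v ξ * (HyperelasticRod.G γ (Y t)).v ξ
        + 2 * (Y t).w ξ * (HyperelasticRod.G γ (Y t)).w ξ
        + 2 * (Y t).h ξ * (HyperelasticRod.G γ (Y t)).h ξ) (Icc 0 τ) t := by
    intro t ht
    obtain ⟨-, -, -, h4, h5, h6⟩ := hder t ht
    refine ((((h4.pow 2).add (h5.pow 2)).add (h6.pow 2)).const_add 1).congr_deriv ?_
    simp
  have hnle := le_exp_mul_of_deriv_le (C := L) hn' (fun t ht => by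
    have hu2 := hU2 t ht ξ
    have hA' : |(3 - 2 * γ) / 2 * (Y t).U ξ ^ 2 - P γ (Y t) ξ| ≤ A := by
      refine (abs_sub _ _).trans (add_le_add ?_ (hP t ht ξ))
      rw [abs_mul, abs_of_nonneg (sq_nonneg ((Y t).U ξ))]
      exact mul_le_mul_of_nonneg_left hu2 (abs_nonneg _)
    have hB' : |Q γ (Y t) ξ * (Y t).U ξ| ≤ p * u := by
      rw [abs_mul]; exact mul_le_mul (hQ t ht ξ) (hU t ht ξ) (abs_nonneg _) p0
    have hD' : |3 * (Y t).U ξ ^ 2 - 2 * P γ (Y t) ξ| ≤ D := by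
      have h1 := abs_le.1 (hP t ht ξ)
      rw [abs_le, hD]
      constructor <;> linarith [sq_nonneg ((Y t).U ξ)]
    exact abs_mul_sum_le hA' hB' hD') ht
  have hn0 : n 0 ≤ 1 + 3 * K ^ 2 := by
    simp only [hn, hY.init]
    obtain ⟨-, -, -, h4, h5, h6⟩ := hb0
    have := sq_le_sq' (by linarith [abs_le.1 h4]) (abs_le.1 h4).2
    have := sq_le_sq' (by linarith [abs_le.1 h5]) (abs_le.1 h5).2
    have := sq_le_sq' (by linarith [abs_le.1 h6]) (abs_le.1 h6).2
    linarith
  have hnt : n t ≤ n₀ := by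
    refine hnle.trans (mul_le_mul (Real.exp_le_exp.2 (mul_le_mul_of_nonneg_left htT L0)) hn0
      (by positivity) (Real.exp_pos _).le)
  have hMn : n₀ ≤ M := by
    have : 0 ≤ K + u + |γ| * u * T + (u ^ 2 + 2 * p) * u * T := by positivity
    linarith
  have hlast : ∀ x : ℝ, x ^ 2 ≤ n t - 1 → |x| ≤ M := fun x hx => by
    refine abs_le_of_sq_le_sq ?_ (hK.trans hKM)
    nlinarith [sq_nonneg x]
  refine ⟨hζ.trans ?_, (hU t ht ξ).trans ?_, hH.trans ?_, hlast _ ?_, hlast _ ?_, hlast _ ?_⟩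
  · have : 0 ≤ u + (u ^ 2 + 2 * p) * u * T + n₀ := by positivity
    linarith
  · have : 0 ≤ K + |γ| * u * T + (u ^ 2 + 2 * p) * u * T + n₀ := by positivity
    linarith
  · have : 0 ≤ u + |γ| * u * T + n₀ := by positivity
    linarith
  all_goals
    simp only [hn]
    linarith [sq_nonneg ((Y t).v ξ), sq_nonneg ((Y t).w ξ), sq_nonneg ((Y t).h ξ)]

/-- Existence of the exact solution for admissible initial data. -/
theorem exists_exact_supSol {ω σ : ℝ → ℝ} {M₀ : ℝ} (hω : DecayWeight ω σ M₀) (γ K T : ℝ)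
    (hK : 0 ≤ K) (hT : 0 < T) :
    ∃ M : ℝ, 0 ≤ M ∧ ∀ Y₀, InitData ω K Y₀ →
      ∃ Y, SupSol ExactClass (HyperelasticRod.G γ) T Y₀ Y ∧ ∀ t ∈ Icc 0 T, SupBnd M (Y t) := by
  obtain ⟨M, hKM, hM⟩ := exists_apriori hω γ K T hK hT.le
  have M0 := hK.trans hKM
  refine ⟨M, M0, fun Y₀ h0 => exists_supSol exactClass_closedClass (fun hY _ => hY.G) G_zero
    (fun M hM => ⟨GLip γ M, GLip_nonneg hM, fun _ _ hX hZ hd => G_sub_bnd potPair_sup hX hZ hd⟩)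
    hT h0.exact (h0.bnd.mono normPair_sup hKM) fun τ hτ Y hY hb =>
      hM (M + 1) (by linarith) τ hτ.2 Y₀ Y h0 hY hb⟩

/-! ### From bounded solutions to solutions in `F` -/

/-- `f` is measurable and dominated by `c ρ`. -/
def Dom (ρ f : ℝ → ℝ) (c : ℝ) : Prop := Measurable f ∧ 0 ≤ c ∧ ∀ ξ, |f ξ| ≤ c * ρ ξ

/-- A third pair of norms, with pointwise domination in place of the L² norm: it retains the
pointwise description and still implies membership in `F` once `ρ` is in L². -/
lemma normPair_dom {ρ : ℝ → ℝ} (hρ : ∀ ξ, 0 ≤ ρ ξ) : NormPair SupLe (Dom ρ) where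
  S_nonneg h := h.nonneg
  S_mono h hcd := ⟨h.1, fun x => (h.2 x).trans hcd⟩
  N_mono h hcd := ⟨h.1, h.2.1.trans hcd, fun x =>
    (h.2.2 x).trans (mul_le_mul_of_nonneg_right hcd (hρ x))⟩
  S_add := normPair_sup.S_add
  N_add hf hg := ⟨hf.1.add hg.1, add_nonneg hf.2.1 hg.2.1, fun x => by
    rw [add_mul]; exact (abs_add_le _ _).trans (add_le_add (hf.2.2 x) (hg.2.2 x))⟩
  S_mul := normPair_sup.S_mul
  N_mul hf hg := ⟨hf.1.mul hg.1, mul_nonneg hf.nonneg hg.2.1, fun x => by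
    rw [abs_mul, mul_assoc]
    exact mul_le_mul (hf.2 x) (hg.2.2 x) (abs_nonneg _) hf.nonneg⟩
  S_const := normPair_sup.S_const
  N_zero := ⟨measurable_const, le_rfl, fun x => by simp⟩

lemma Dom.l2Le {ρ f : ℝ → ℝ} {c r : ℝ} (hr : L2Le ρ r) (h : Dom ρ f c) :
    L2Le f (c * r) := by
  have h' := (normPair_essSup_l2.N_smul c hr).of_abs_le h.1.aestronglyMeasurable
    (ae_of_all _ h.2.2)
  rwa [abs_of_nonneg h.2.1] at h'

lemma Bnd.fBnd_of_dom {ρ : ℝ → ℝ} {c r : ℝ} {Y : State} (hr : L2Le ρ r)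
    (h : Bnd SupLe (Dom ρ) c Y) : FBnd (c * (1 + r)) Y := by
  have hp := normPair_essSup_l2
  have c0 : 0 ≤ c := h.ζ.nonneg
  have l1 : c ≤ c * (1 + r) := by nlinarith [mul_nonneg c0 hr.2.1]
  have l2 : c * r ≤ c * (1 + r) := by nlinarith
  exact ⟨hp.S_mono h.ζ.essLe l1, hp.S_mono h.U.essLe l1, hp.N_mono (h.U'.l2Le hr) l2,
    hp.S_mono h.H.essLe l1, hp.N_mono (h.v.l2Le hr) l2, hp.N_mono (h.w.l2Le hr) l2,
    hp.N_mono (h.h.l2Le hr) l2⟩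

/-- Uniform convergence alone says nothing about L² norms on the line; a common L² majorant allows
dominated convergence. -/
lemma tendsto_eLpNorm_two_of_dom {l : Filter ℝ} [l.IsCountablyGenerated] {ρ : ℝ → ℝ} {c r : ℝ}
    (hρ : ∀ ξ, 0 ≤ ρ ξ) (hr : L2Le ρ r) {f : ℝ → ℝ → ℝ}
    (h0 : ∀ ε > 0, ∀ᶠ s in l, ∀ ξ, |f s ξ| ≤ ε) (h : ∀ᶠ s in l, Dom ρ (f s) c) :
    Tendsto (fun s => eLpNorm (f s) 2 volume) l (𝓝 0) := by
  have hfin : ∫⁻ ξ, ‖c * ρ ξ‖ₑ ^ 2 ≠ ∞ := by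
    have h1 := (normPair_essSup_l2.N_smul c hr).memLp.eLpNorm_lt_top
    rw [eLpNorm_two_eq] at h1
    intro h2
    rw [h2, ENNReal.top_rpow_of_pos (by norm_num)] at h1
    exact lt_irrefl _ h1
  have hlim : Tendsto (fun s => ∫⁻ ξ, ‖f s ξ‖ₑ ^ 2) l (𝓝 (∫⁻ _ : ℝ, 0)) := by
    refine tendsto_lintegral_filter_of_dominated_convergence (fun ξ => ‖c * ρ ξ‖ₑ ^ 2)
      (h.mono fun s hs => (hs.1.enorm).pow_const 2) (h.mono fun s hs => ae_of_all _ fun ξ => ?_)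
      hfin (ae_of_all _ fun ξ => ?_)
    · refine pow_le_pow_left' ?_ 2
      rw [Real.enorm_eq_ofReal_abs, Real.enorm_eq_ofReal_abs, abs_mul, abs_of_nonneg hs.2.1,
        abs_of_nonneg (hρ ξ)]
      exact ENNReal.ofReal_le_ofReal (hs.2.2 ξ)
    · have h1 : Tendsto (fun s => f s ξ) l (𝓝 0) := by
        rw [Metric.tendsto_nhds]
        intro ε hε
        filter_upwards [h0 (ε / 2) (by positivity)] with s hs
        rw [Real.dist_eq, sub_zero]
        linarith [hs ξ]
      have h2 := (((ENNReal.continuous_pow 2).comp continuous_enorm).tendsto (0 : ℝ)).comp h1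
      simpa [Function.comp_def] using h2
  rw [lintegral_zero] at hlim
  have h3 := hlim.ennrpow_const (1 / 2 : ℝ)
  rw [ENNReal.zero_rpow_of_pos (by norm_num)] at h3
  simpa only [eLpNorm_two_eq] using h3

lemma tendsto_eLpNorm_top {l : Filter ℝ} {f : ℝ → ℝ → ℝ}
    (h0 : ∀ ε > 0, ∀ᶠ s in l, ∀ ξ, |f s ξ| ≤ ε) :
    Tendsto (fun s => eLpNorm (f s) ∞ volume) l (𝓝 0) := by
  rw [ENNReal.tendsto_nhds_zero]
  intro ε hε
  obtain ⟨δ, hδ, hδε⟩ : ∃ δ : ℝ, 0 < δ ∧ ENNReal.ofReal δ ≤ ε := by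
    rcases eq_or_ne ε ∞ with rfl | hε'
    · exact ⟨1, one_pos, le_top⟩
    · exact ⟨ε.toReal, ENNReal.toReal_pos hε.ne' hε', (ENNReal.ofReal_toReal hε').le⟩
  filter_upwards [h0 δ hδ] with s hs
  refine le_trans ?_ hδε
  have := eLpNorm_le_of_ae_bound (p := ∞) (μ := volume) (f := f s) (C := δ)
    (ae_of_all _ fun ξ => by simpa [Real.norm_eq_abs] using hs ξ)
  simpa using this

lemma tendsto_normF_of_dom {l : Filter ℝ} [l.IsCountablyGenerated] {ρ : ℝ → ℝ} {c r : ℝ}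
    (hρ : ∀ ξ, 0 ≤ ρ ξ) (hr : L2Le ρ r) {E : ℝ → State} (h0 : ∀ ε > 0, ∀ᶠ s in l, PtBnd ε (E s))
    (h : ∀ᶠ s in l, Bnd SupLe (Dom ρ) c (E s)) : Tendsto (fun s => normF (E s)) l (𝓝 0) := by
  have t1 := tendsto_eLpNorm_top (f := fun s => (E s).ζ) fun ε hε =>
    (h0 ε hε).mono fun s hs ξ => (hs ξ).1
  have hU := fun ε hε => (h0 ε hε).mono fun s hs ξ => (hs ξ).2.1
  have t2 := tendsto_eLpNorm_two_of_dom (f := fun s => (E s).U) hρ hr hU (h.mono fun s hs => hs.U')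
  have t3 := tendsto_eLpNorm_top (f := fun s => (E s).U) hU
  have t4 := tendsto_eLpNorm_top (f := fun s => (E s).H) fun ε hε =>
    (h0 ε hε).mono fun s hs ξ => (hs ξ).2.2.1
  have t5 := tendsto_eLpNorm_two_of_dom (f := fun s => (E s).v) hρ hr
    (fun ε hε => (h0 ε hε).mono fun s hs ξ => (hs ξ).2.2.2.1) (h.mono fun s hs => hs.v)
  have t6 := tendsto_eLpNorm_two_of_dom (f := fun s => (E s).w) hρ hr
    (fun ε hε => (h0 ε hε).mono fun s hs ξ => (hs ξ).2.2.2.2.1) (h.mono fun s hs => hs.w)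
  have t7 := tendsto_eLpNorm_two_of_dom (f := fun s => (E s).h) hρ hr
    (fun ε hε => (h0 ε hε).mono fun s hs ξ => (hs ξ).2.2.2.2.2) (h.mono fun s hs => hs.h)
  have := (((((t1.add t2).add t3).add t4).add t5).add t6).add t7
  simp only [add_zero] at this
  exact this

/-- A majorant for the field along the solution is, by the mean value inequality, one for all
difference quotients. Their uniform convergence therefore upgrades to convergence in `F`. -/
theorem SupSol.isSolution {A : State → Prop} {𝒱 : State → State} {T : ℝ} {Y₀ : State}
    {Y : ℝ → State} {ρ : ℝ → ℝ} {c r L : ℝ} (hY : SupSol A 𝒱 T Y₀ Y) (hρ : ∀ ξ, 0 ≤ ρ ξ)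
    (hr : L2Le ρ r) (hb : ∀ t ∈ Icc 0 T, Bnd SupLe (Dom ρ) c (Y t))
    (hV : ∀ t ∈ Icc 0 T, Bnd SupLe (Dom ρ) c (𝒱 (Y t)))
    (hL : ∀ s ∈ Icc 0 T, ∀ t ∈ Icc 0 T, ∀ d, Bnd SupLe (Dom ρ) d (Y s - Y t) →
      normF (𝒱 (Y s) - 𝒱 (Y t)) ≤ ENNReal.ofReal (L * d)) :
    IsSolution 𝒱 T Y₀ Y := by
  have hp := normPair_dom hρ
  have hlip : ∀ s ∈ Icc 0 T, ∀ t ∈ Icc 0 T, Bnd SupLe (Dom ρ) (c * |s - t|) (Y s - Y t) := by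
    intro s hs t ht
    have c0 : 0 ≤ c := (hb t ht).nonneg hp
    have hd := (hb s hs).sub hp (hb t ht)
    have der := fun t ht ξ => hY.hasDeriv (t := t) ht ξ
    have N : ∀ {f f' : State → ℝ → ℝ}, Measurable (fun ξ => f (Y s) ξ - f (Y t) ξ) →
        (∀ t ∈ Icc 0 T, ∀ ξ, HasDerivWithinAt (fun s => f (Y s) ξ) (f' (Y t) ξ) (Icc 0 T) t) →
        (∀ t ∈ Icc 0 T, Dom ρ (f' (Y t)) c) →
        Dom ρ (fun ξ => f (Y s) ξ - f (Y t) ξ) (c * |s - t|) := by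
      intro f f' hm hf hf'
      refine ⟨hm, by positivity, fun ξ => ?_⟩
      have := abs_sub_le_of_abs_deriv_le (fun t ht => hf t ht ξ)
        (fun t ht => (hf' t ht).2.2 ξ) ht hs
      linarith
    have S : ∀ {f f' : State → ℝ → ℝ}, Measurable (fun ξ => f (Y s) ξ - f (Y t) ξ) →
        (∀ t ∈ Icc 0 T, ∀ ξ, HasDerivWithinAt (fun s => f (Y s) ξ) (f' (Y t) ξ) (Icc 0 T) t) →
        (∀ t ∈ Icc 0 T, SupLe (f' (Y t)) c) →
        SupLe (fun ξ => f (Y s) ξ - f (Y t) ξ) (c * |s - t|) := by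
      intro f f' hm hf hf'
      exact ⟨hm, fun ξ => abs_sub_le_of_abs_deriv_le (fun t ht => hf t ht ξ)
        (fun t ht => (hf' t ht).2 ξ) ht hs⟩
    exact ⟨S (f := State.ζ) (f' := fun Z => (𝒱 Z).ζ) hd.ζ.1 (fun t ht ξ => (der t ht ξ).1)
        fun t ht => (hV t ht).ζ,
      S (f := State.U) (f' := fun Z => (𝒱 Z).U) hd.U.1 (fun t ht ξ => (der t ht ξ).2.1)
        fun t ht => (hV t ht).U,
      N (f := State.U) (f' := fun Z => (𝒱 Z).U) hd.U.1 (fun t ht ξ => (der t ht ξ).2.1)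
        fun t ht => (hV t ht).U',
      S (f := State.H) (f' := fun Z => (𝒱 Z).H) hd.H.1 (fun t ht ξ => (der t ht ξ).2.2.1)
        fun t ht => (hV t ht).H,
      N (f := State.v) (f' := fun Z => (𝒱 Z).v) hd.v.1 (fun t ht ξ => (der t ht ξ).2.2.2.1)
        fun t ht => (hV t ht).v,
      N (f := State.w) (f' := fun Z => (𝒱 Z).w) hd.w.1 (fun t ht ξ => (der t ht ξ).2.2.2.2.1)
        fun t ht => (hV t ht).w,
      N (f := State.h) (f' := fun Z => (𝒱 Z).h) hd.h.1 (fun t ht ξ => (der t ht ξ).2.2.2.2.2)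
        fun t ht => (hV t ht).h⟩
  refine ⟨hY.init, fun t ht => ((hb t ht).fBnd_of_dom hr).memF, fun t ht => ?_, fun t ht => ?_⟩
  · refine tendsto_normF_of_dom (c := c + c) hρ hr (fun ε hε => ?_) ?_
    · filter_upwards [(hY.deriv t ht ε hε).filter_mono (nhdsWithin_mono t sdiff_subset),
        self_mem_nhdsWithin] with s hs hst ξ
      have hne : s - t ≠ 0 := sub_ne_zero.2 hst.2
      have key : ∀ a b : ℝ, |a - (s - t) * b| ≤ ε * |s - t| → |(s - t)⁻¹ * a - b| ≤ ε := by
        intro a b hab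
        have e : (s - t)⁻¹ * a - b = (s - t)⁻¹ * (a - (s - t) * b) := by field_simp
        rw [e, abs_mul, abs_inv, inv_mul_le_iff₀ (abs_pos.2 hne), mul_comm |s - t|]
        exact hab
      obtain ⟨h1, h2, h3, h4, h5, h6⟩ := hs ξ
      exact ⟨key _ _ h1, key _ _ h2, key _ _ h3, key _ _ h4, key _ _ h5, key _ _ h6⟩
    · filter_upwards [self_mem_nhdsWithin] with s hs
      have hne : |s - t| ≠ 0 := abs_ne_zero.2 (sub_ne_zero.2 hs.2)
      have h1 := (hlip s hs.1 t ht).smul hp (s - t)⁻¹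
      have e : |(s - t)⁻¹| * (c * |s - t|) = c := by rw [abs_inv]; field_simp
      rw [e] at h1
      exact h1.sub hp (hV t ht)
  · have h1 : Tendsto (fun s => ENNReal.ofReal (L * (c * |s - t|))) (𝓝[Icc 0 T] t) (𝓝 0) := by
      have h2 : Continuous fun s : ℝ => L * (c * |s - t|) := by fun_prop
      have h3 := (ENNReal.tendsto_ofReal (h2.tendsto t)).mono_left
        (nhdsWithin_le_nhds (s := Icc 0 T))
      simpa using h3
    refine tendsto_of_tendsto_of_tendsto_of_le_of_le' tendsto_const_nhds h1
      (Eventually.of_forall fun _ => zero_le) ?_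
    filter_upwards [self_mem_nhdsWithin] with s hs using hL s hs t ht _ (hlip s hs t ht)

lemma L2Le.of_sq_le {f g : ℝ → ℝ} {c : ℝ} (hf : AEStronglyMeasurable f volume)
    (hg : Integrable g) (hle : ∀ ξ, f ξ ^ 2 ≤ g ξ) (hc : 0 ≤ c) (hgc : ∫ ξ, g ξ ≤ c ^ 2) :
    L2Le f c := by
  refine ⟨hf, hc, ?_⟩
  rw [eLpNorm_two_eq]
  have h1 : ∫⁻ ξ, ‖f ξ‖ₑ ^ 2 ≤ ENNReal.ofReal c ^ 2 := by
    rw [← ENNReal.ofReal_pow hc]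
    refine le_trans ?_ (ENNReal.ofReal_le_ofReal hgc)
    rw [ofReal_integral_eq_lintegral_ofReal hg
      (ae_of_all _ fun ξ => (sq_nonneg (f ξ)).trans (hle ξ))]
    refine lintegral_mono fun ξ => ?_
    rw [Real.enorm_eq_ofReal_abs, ← ENNReal.ofReal_pow (abs_nonneg _), sq_abs]
    exact ENNReal.ofReal_le_ofReal (hle ξ)
  calc _ ≤ (ENNReal.ofReal c ^ 2) ^ (1 / 2 : ℝ) := ENNReal.rpow_le_rpow h1 (by norm_num)
    _ = ENNReal.ofReal c := by
        rw [← ENNReal.rpow_natCast, ← ENNReal.rpow_mul]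
        norm_num

/-! ### The exact solution in `F` -/

lemma abs_le_mul_sqrt {x a g : ℝ} (ha : 0 ≤ a) (hg : 0 ≤ g) (h : x ^ 2 ≤ a * g) :
    |x| ≤ (1 + a) * √g := by
  refine abs_le_of_sq_le_sq ?_ (by positivity)
  rw [mul_pow, Real.sq_sqrt hg]
  exact h.trans (mul_le_mul_of_nonneg_right (by nlinarith) hg)

/-- The exact solution, bounded in `F` with decaying potentials, for data with the pointwise
relations everywhere. -/
theorem exists_exactSolution_of_initData {ω σ : ℝ → ℝ} {M₀ : ℝ} (hω : DecayWeight ω σ M₀)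
    (γ K T : ℝ) (hK : 0 ≤ K) (hT : 0 < T) :
    ∃ M : ℝ, 0 ≤ M ∧ ∀ Y₀, InitData ω K Y₀ → ∃ Y, IsExactSolution γ T Y₀ Y ∧
      ∀ t ∈ Icc 0 T, FBnd M (Y t) ∧ (∀ ξ, |P γ (Y t) ξ| ≤ M * (ω ξ)⁻¹) ∧
        ∀ ξ, |Q γ (Y t) ξ| ≤ M * (ω ξ)⁻¹ := by
  obtain ⟨M, hM0, hex⟩ := exists_exact_supSol hω γ K T hK hT
  obtain ⟨C, hC0, hC⟩ := exists_energy_le hω γ K M T hK hM0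
  have M00 := hω.M₀_pos
  set a := potConst γ M * C with ha
  have a0 : 0 ≤ a := mul_nonneg (potConst_nonneg γ M) hC0
  set g₁ := K * K + K + 1 with hg₁
  have g₁0 : 0 ≤ g₁ := by positivity
  set b := 1 + (1 + M) * C with hb
  have b0 : 0 ≤ b := by positivity
  set A := M + (1 + C) + (1 + |γ| * T * b) + b + C * (1 + g₁) with hA
  have A0 : 0 ≤ A := by positivity
  set B := potLip γ M * M + a with hB
  have B0 : 0 ≤ B := by have := potLip_nonneg (γ := γ) hM0; positivity
  set A₂ := A + rhsLip γ A B * (A + B) with hA₂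
  have A₂0 : 0 ≤ A₂ := by have := rhsLip_nonneg (γ := γ) A0 B0; positivity
  set r := (1 + K + M₀) + K with hr
  have r0 : 0 ≤ r := by positivity
  refine ⟨A₂ * (1 + r) + a, by positivity, fun Y₀ h0 => ?_⟩
  obtain ⟨Y, hY, hbd⟩ := hex Y₀ h0
  have hadm : ∀ t ∈ Icc 0 T, Adm (Y t) := fun t ht => hY.adm h0.toAdm hbd ht
  set g : ℝ → ℝ := fun ξ => energy Y₀ ξ + σ ξ with hg
  have hg0 : ∀ ξ, 0 ≤ g ξ := fun ξ => add_nonneg (h0.energy_nonneg ξ) (hω.σ_pos ξ).le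
  have hgm : Measurable g := h0.bnd.energy.1.add hω.meas_σ
  have hgi : Integrable g := (h0.energy_integrable hω).add hω.int_σ
  -- `U²` and `w² ≤ q h` are of order `g`, hence `U` and `w` of order `√g`; the same holds for `h`,
  -- since `g` is bounded. The component `v` differs from its initial value by a time integral of `γ
  -- w`. The potentials are of order `1/ω ≤ σ ≤ √g`. Finally `√g` is in L² because `g` is
  -- integrable.
  set ρ : ℝ → ℝ := fun ξ => √(g ξ) + |Y₀.v ξ| with hρdef
  have hsρ : ∀ ξ, √(g ξ) ≤ ρ ξ := fun ξ => le_add_of_nonneg_right (abs_nonneg _)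
  have hρ : ∀ ξ, 0 ≤ ρ ξ := fun ξ => (Real.sqrt_nonneg _).trans (hsρ ξ)
  have hrL : L2Le ρ r := by
    refine normPair_essSup_l2.N_add (L2Le.of_sq_le hgm.sqrt.aestronglyMeasurable hgi
      (fun ξ => (Real.sq_sqrt (hg0 ξ)).le) (by positivity) ?_) h0.v_l2.abs
    rw [hg, integral_add (h0.energy_integrable hω) hω.int_σ]
    have h1 : ∫ ξ, energy Y₀ ξ ≤ K := le_trans (integral_mono (h0.energy_integrable hω) h0.int
      fun ξ => le_mul_of_one_le_left (h0.energy_nonneg ξ) (hω.one_le ξ)) h0.integral_le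
    nlinarith [hω.integral_σ_le]
  have hp := normPair_dom hρ
  have dom : ∀ {f : ℝ → ℝ} {c : ℝ}, Measurable f → 0 ≤ c → c ≤ A →
      (∀ ξ, |f ξ| ≤ c * √(g ξ)) → Dom ρ f A := fun hf hc hcA h =>
    ⟨hf, A0, fun ξ => (h ξ).trans (mul_le_mul hcA (hsρ ξ) (Real.sqrt_nonneg _) A0)⟩
  have hpos : 0 ≤ |γ| * T * b := by positivity
  have hposC : 0 ≤ C * (1 + g₁) := by positivity
  have hle : ∀ t ∈ Icc 0 T, ∀ ξ, energy (Y t) ξ ≤ C * g ξ := fun t ht ξ =>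
    (hC T le_rfl Y₀ Y h0 hY hbd t ht ξ).1
  have hsm : ∀ t ∈ Icc 0 T, ∀ ξ, smear (energy (Y t)) ξ ≤ C * (ω ξ)⁻¹ := fun t ht ξ =>
    (hC T le_rfl Y₀ Y h0 hY hbd t ht ξ).2
  have hgs : ∀ ξ, g ξ ≤ (1 + g₁) * √(g ξ) := by
    intro ξ
    have h1 : g ξ ≤ g₁ := by
      have := (abs_le.1 (h0.bnd.energy.2 ξ)).2
      have := hω.σ_le ξ
      simp only [hg]
      linarith
    have h2 : √(g ξ) ≤ 1 + g₁ := by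
      rw [Real.sqrt_le_left (by positivity)]
      nlinarith
    calc g ξ = √(g ξ) * √(g ξ) := (Real.mul_self_sqrt (hg0 ξ)).symm
      _ ≤ _ := mul_le_mul_of_nonneg_right h2 (Real.sqrt_nonneg _)
  have hσs : ∀ ξ, σ ξ ≤ √(g ξ) := by
    intro ξ
    refine Real.le_sqrt_of_sq_le ?_
    have h1 := hω.σ_pos ξ
    have h2 := hω.σ_le ξ
    have := h0.energy_nonneg ξ
    simp only [hg]
    nlinarith
  have hw : ∀ t ∈ Icc 0 T, ∀ ξ, |(Y t).w ξ| ≤ b * √(g ξ) := by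
    intro t ht ξ
    refine abs_le_mul_sqrt (by positivity) (hg0 ξ) (((hadm t ht).w_sq_le ξ).trans ?_)
    have hq : (Y t).q ξ ≤ 1 + M := by
      have := (abs_le.1 ((hbd t ht).v.2 ξ)).2
      simp only [State.q]; linarith
    rw [mul_assoc]
    exact mul_le_mul hq ((Adm.h_le_energy _ ξ).trans (hle t ht ξ)) ((hadm t ht).h_nonneg ξ)
      (by positivity)
  have hYb : ∀ t ∈ Icc 0 T, Bnd SupLe (Dom ρ) A (Y t) := by
    intro t ht
    have hMA : M ≤ A := by linarith
    refine ⟨normPair_sup.S_mono (hbd t ht).ζ hMA, normPair_sup.S_mono (hbd t ht).U hMA,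
      dom (c := 1 + C) (hbd t ht).U.1 (by positivity) (by linarith) fun ξ => ?_,
      normPair_sup.S_mono (hbd t ht).H hMA, ⟨(hbd t ht).v.1, A0, fun ξ => ?_⟩,
      dom (hbd t ht).w.1 b0 (by linarith) (hw t ht),
      dom (c := C * (1 + g₁)) (hbd t ht).h.1 hposC (by linarith) fun ξ => ?_⟩
    · exact abs_le_mul_sqrt hC0 (hg0 ξ) (((hadm t ht).U_sq_le_energy ξ).trans (hle t ht ξ))
    · have h1 := abs_sub_le_of_abs_deriv_le (fun t ht => (hY.hasDeriv ht ξ).2.2.2.1)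
        (D := |γ| * (b * √(g ξ))) (fun t ht => by
          change |γ * (Y t).w ξ| ≤ _
          rw [abs_mul]
          exact mul_le_mul_of_nonneg_left (hw t ht ξ) (abs_nonneg _)) ⟨le_rfl, hT.le⟩ ht
      rw [hY.init, sub_zero, abs_of_nonneg ht.1] at h1
      have h2 := abs_sub_abs_le_abs_sub ((Y t).v ξ) (Y₀.v ξ)
      have s0 := Real.sqrt_nonneg (g ξ)
      have h3 : |γ| * (b * √(g ξ)) * t ≤ |γ| * (b * √(g ξ)) * T :=
        mul_le_mul_of_nonneg_left ht.2 (by positivity)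
      have h4 : 0 ≤ |γ| * T * b * |Y₀.v ξ| := by positivity
      calc |(Y t).v ξ| ≤ (1 + |γ| * T * b) * ρ ξ := by simp only [hρdef]; linarith
        _ ≤ A * ρ ξ := mul_le_mul_of_nonneg_right (by linarith) (hρ ξ)
    · rw [abs_of_nonneg ((hadm t ht).h_nonneg ξ), mul_assoc]
      exact ((Adm.h_le_energy _ ξ).trans (hle t ht ξ)).trans
        (mul_le_mul_of_nonneg_left (hgs ξ) hC0)
  have hPω : ∀ t ∈ Icc 0 T, ∀ ξ, |P γ (Y t) ξ| ≤ a * (ω ξ)⁻¹ := fun t ht ξ =>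
    ((hadm t ht).abs_P_le_smear (hbd t ht) ξ).trans (by
      rw [ha, mul_assoc]
      exact mul_le_mul_of_nonneg_left (hsm t ht ξ) (potConst_nonneg γ M))
  have hQω : ∀ t ∈ Icc 0 T, ∀ ξ, |Q γ (Y t) ξ| ≤ a * (ω ξ)⁻¹ := fun t ht ξ =>
    ((hadm t ht).abs_Q_le_smear (hbd t ht) ξ).trans (by
      rw [ha, mul_assoc]
      exact mul_le_mul_of_nonneg_left (hsm t ht ξ) (potConst_nonneg γ M))
  have hBpot : potLip γ M * M ≤ B := by linarith
  have haB : a ≤ B := by have := mul_nonneg (potLip_nonneg (γ := γ) hM0) hM0; linarith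
  have pot2 : ∀ {f : ℝ → ℝ}, SupLe f (potLip γ M * M) → (∀ ξ, |f ξ| ≤ a * (ω ξ)⁻¹) →
      Bnd₂ SupLe (Dom ρ) B f := fun hf h =>
    ⟨normPair_sup.S_mono hf hBpot, hf.1, B0, fun ξ => (h ξ).trans
      (mul_le_mul haB ((hω.inv_le ξ).trans ((hσs ξ).trans (hsρ ξ)))
        (inv_pos.2 (hω.pos ξ)).le B0)⟩
  have hVb : ∀ t ∈ Icc 0 T,
      Bnd SupLe (Dom ρ) (rhsLip γ A B * (A + B)) (HyperelasticRod.G γ (Y t)) := fun t ht =>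
    rhs_bnd hp (hYb t ht)
      (pot2 (P_bnd (γ := γ) potPair_sup (hbd t ht)).S (hPω t ht))
      (pot2 (Q_bnd (γ := γ) potPair_sup (hbd t ht)).S (hQω t ht))
  have hAA₂ : A ≤ A₂ := by
    have := rhsLip_nonneg (γ := γ) A0 B0
    have : 0 ≤ rhsLip γ A B * (A + B) := by positivity
    linarith
  have hF : ∀ t ∈ Icc 0 T, FBnd (A₂ * (1 + r)) (Y t) := fun t ht =>
    ((hYb t ht).mono hp hAA₂).fBnd_of_dom hrL
  refine ⟨Y, ?_, fun t ht => ⟨(hF t ht).mono normPair_essSup_l2 (by linarith),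
    fun ξ => (hPω t ht ξ).trans (mul_le_mul_of_nonneg_right
      (by have : 0 ≤ A₂ * (1 + r) := by positivity
          linarith) (inv_pos.2 (hω.pos ξ)).le),
    fun ξ => (hQω t ht ξ).trans (mul_le_mul_of_nonneg_right
      (by have : 0 ≤ A₂ * (1 + r) := by positivity
          linarith) (inv_pos.2 (hω.pos ξ)).le)⟩⟩
  refine hY.isSolution (c := A₂) (L := 7 * GLip γ (A₂ * (1 + r)) * (7 * (1 + r))) hρ hrL
    (fun t ht => (hYb t ht).mono hp hAA₂) (fun t ht => (hVb t ht).mono hp (by linarith))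
    fun s hs t ht d hd => ?_
  have d0 : 0 ≤ d := hd.nonneg hp
  refine (normF_G_sub_le (hF s hs) (hF t ht)).trans ?_
  have hGL := GLip_nonneg (γ := γ) (M := A₂ * (1 + r)) (by positivity)
  refine (mul_le_mul_right (hd.fBnd_of_dom hrL).normF_le _).trans ?_
  rw [← ENNReal.ofReal_mul (by positivity)]
  refine ENNReal.ofReal_le_ofReal (le_of_eq ?_)
  ring

/-! ### Modification on null sets -/

/-- `X` and `Z` differ in the components `v`, `w`, `h` on a null set only. -/
structure StateAE (X Z : State) : Prop where
  ζ : X.ζ = Z.ζ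
  U : X.U = Z.U
  H : X.H = Z.H
  v : X.v =ᵐ[volume] Z.v
  w : X.w =ᵐ[volume] Z.w
  h : X.h =ᵐ[volume] Z.h

namespace StateAE

variable {X Z X' Z' : State} {γ : ℝ}

lemma refl (X : State) : StateAE X X :=
  ⟨rfl, rfl, rfl, Filter.EventuallyEq.rfl, Filter.EventuallyEq.rfl, Filter.EventuallyEq.rfl⟩

lemma sub (h : StateAE X Z) (h' : StateAE X' Z') : StateAE (X - X') (Z - Z') :=
  ⟨by simp [h.ζ, h'.ζ], by simp [h.U, h'.U], by simp [h.H, h'.H], h.v.sub h'.v, h.w.sub h'.w,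
    h.h.sub h'.h⟩

lemma smul (h : StateAE X Z) (c : ℝ) : StateAE (c • X) (c • Z) :=
  ⟨by simp [h.ζ], by simp [h.U], by simp [h.H], h.v.const_smul c, h.w.const_smul c,
    h.h.const_smul c⟩

lemma normF_eq (h : StateAE X Z) : normF X = normF Z := by
  unfold normF
  rw [h.ζ, h.U, h.H, eLpNorm_congr_ae h.v, eLpNorm_congr_ae h.w, eLpNorm_congr_ae h.h]

lemma memF (h : StateAE X Z) (hX : MemF X) : MemF Z :=
  ⟨h.ζ ▸ hX.1, h.U ▸ hX.2, h.U ▸ hX.3, h.H ▸ hX.4, hX.5.ae_eq h.v, hX.6.ae_eq h.w, hX.7.ae_eq h.h⟩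

lemma source_eq (h : StateAE X Z) : source γ X =ᵐ[volume] source γ Z := by
  filter_upwards [h.v, h.h] with ξ h1 h2
  simp only [source, State.q, h.U, h1, h2]

lemma P_eq (h : StateAE X Z) : P γ X = P γ Z := by
  ext ξ
  unfold P State.y
  rw [h.ζ]
  congr 1
  refine integral_congr_ae ?_
  filter_upwards [h.source_eq (γ := γ)] with η hη
  rw [hη]

lemma Q_eq (h : StateAE X Z) : Q γ X = Q γ Z := by
  ext ξ
  unfold Q State.y
  rw [h.ζ]
  congr 1
  refine integral_congr_ae ?_
  filter_upwards [h.source_eq (γ := γ)] with η hη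
  rw [hη]

lemma G (h : StateAE X Z) : StateAE (G γ X) (G γ Z) := by
  unfold HyperelasticRod.G
  rw [h.P_eq, h.Q_eq]
  refine ⟨by simp [rhs, h.U], rfl, by simp [rhs, h.U], ?_, ?_, ?_⟩
  · filter_upwards [h.w] with ξ h1
    simp [rhs, h1]
  · filter_upwards [h.v, h.h] with ξ h1 h2
    simp [rhs, State.q, h.U, h1, h2]
  · filter_upwards [h.v, h.w] with ξ h1 h2
    simp [rhs, State.q, h.U, h1, h2]

end StateAE

lemma IsSolution.congr_ae {γ T : ℝ} {Y₀ Z₀ : State} {Y Z : ℝ → State}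
    (hY : IsExactSolution γ T Y₀ Y) (h : ∀ t, StateAE (Y t) (Z t)) (h0 : Z 0 = Z₀) :
    IsExactSolution γ T Z₀ Z := by
  refine ⟨h0, fun t ht => (h t).memF (hY.memF t ht), fun t ht => ?_, fun t ht => ?_⟩
  · refine (hY.hasDeriv t ht).congr fun s => ?_
    exact (((h s).sub (h t)).smul _ |>.sub (h t).G).normF_eq
  · refine (hY.contDeriv t ht).congr fun s => ?_
    exact ((h s).G.sub (h t).G).normF_eq

/-! ### Initial data in `𝒢` -/

lemma L2Le.integral_sq_le {f : ℝ → ℝ} {c : ℝ} (h : L2Le f c) : ∫ ξ, f ξ ^ 2 ≤ c ^ 2 := by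
  have h1 : ∫⁻ ξ, ENNReal.ofReal (f ξ ^ 2) ≤ ENNReal.ofReal (c ^ 2) := by
    have h2 := h.2.2
    rw [eLpNorm_two_eq] at h2
    have h3 := ENNReal.rpow_le_rpow h2 (zero_le_two (α := ℝ))
    rw [← ENNReal.rpow_mul] at h3
    norm_num at h3
    rw [ENNReal.ofReal_pow h.2.1]
    refine le_trans (le_of_eq (lintegral_congr fun ξ => ?_)) h3
    rw [Real.enorm_eq_ofReal_abs, ← ENNReal.ofReal_pow (abs_nonneg _), sq_abs]
  rw [integral_eq_lintegral_of_nonneg_ae (ae_of_all _ fun ξ => sq_nonneg _) (h.1.pow 2)]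
  exact ENNReal.toReal_le_of_le_ofReal (sq_nonneg _) h1

lemma integral_le_of_eLpNorm_one_le {f : ℝ → ℝ} {c : ℝ} (hf : AEStronglyMeasurable f volume)
    (hc : 0 ≤ c) (h : eLpNorm f 1 volume ≤ ENNReal.ofReal c) :
    Integrable f ∧ ∫ ξ, f ξ ≤ c := by
  have hi : Integrable f := memLp_one_iff_integrable.1 ⟨hf, h.trans_lt ENNReal.ofReal_lt_top⟩
  refine ⟨hi, (integral_mono hi hi.norm fun ξ => le_abs_self _).trans ?_⟩
  rw [integral_norm_eq_lintegral_enorm hf, ← eLpNorm_one_eq_lintegral_enorm]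
  exact ENNReal.toReal_le_of_le_ofReal hc h

lemma abs_le_of_continuous_of_essLe {f : ℝ → ℝ} {c : ℝ} (hf : Continuous f) (h : EssLe f c)
    (ξ : ℝ) : |f ξ| ≤ c := by
  have hd := Measure.dense_of_ae h.2
  have hcl : IsClosed {x | |f x| ≤ c} := isClosed_le hf.abs continuous_const
  have : ξ ∈ closure {x | |f x| ≤ c} := hd ξ
  rwa [hcl.closure_eq] at this

/-- Bounds for admissible data: those of `F`, those of `L^∞`, and the weighted ones. -/
structure DataBnd (θ ω : ℝ → ℝ) (K : ℝ) (Y : State) : Prop where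
  norm : normF Y ≤ ENNReal.ofReal K
  q : eLpNorm Y.q ∞ volume ≤ ENNReal.ofReal K
  w : eLpNorm Y.w ∞ volume ≤ ENNReal.ofReal K
  h : eLpNorm Y.h ∞ volume ≤ ENNReal.ofReal K
  U_weight : eLpNorm (fun ξ => θ ξ * Y.U ξ) 2 volume ≤ ENNReal.ofReal K
  h_weight : eLpNorm (fun ξ => ω ξ * Y.h ξ) 1 volume ≤ ENNReal.ofReal K

lemma prim_of_ae {f g g' : ℝ → ℝ} {M : ℝ} (hg' : SupLe g' M) (h : g =ᵐ[volume] g')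
    (hf : ∀ a b : ℝ, ∫ ξ in a..b, g ξ = f b - f a) : Prim f g' :=
  ⟨hg'.intervalIntegrable, fun a b => by
    rw [← hf a b]
    exact intervalIntegral.integral_congr_ae (h.mono fun x hx _ => hx.symm)⟩

/-- Only `v, w, h` have to be altered: `ζ, U, H` are primitives, hence continuous, and inherit their
bounds everywhere. The constant covers `1 + K` for `v` and `K² + K` for the weighted energy. -/
theorem MemG.exists_initData {θ ω : ℝ → ℝ} {K : ℝ} {Y : State} (hK : 0 ≤ K) (hY : MemG Y)
    (hθ : Measurable θ) (hω : Measurable ω) (hθω : ∀ ξ, θ ξ ^ 2 = ω ξ)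
    (hb : DataBnd θ ω K Y) : ∃ Z, StateAE Y Z ∧ InitData ω (K ^ 2 + 2 * K + 1) Z := by
  have hF := hY.memF.fBnd hK hb.norm
  have hq := essLe_of_eLpNorm_le hK hY.memLp_q.1 hb.q
  have hw := essLe_of_eLpNorm_le hK hY.memLp_w.1 hb.w
  have hh := essLe_of_eLpNorm_le hK hY.memLp_h.1 hb.h
  set v₁ := hY.memF.memLp_v.1.mk Y.v
  set w₁ := hY.memF.memLp_w.1.mk Y.w
  set h₁ := hY.memF.memLp_h.1.mk Y.h
  have hgood : ∀ᵐ ξ, (Y.v ξ = v₁ ξ ∧ Y.w ξ = w₁ ξ ∧ Y.h ξ = h₁ ξ) ∧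
      (Y.q ξ * Y.h ξ = Y.U ξ ^ 2 * Y.q ξ ^ 2 + Y.w ξ ^ 2 ∧ 0 ≤ Y.q ξ ∧ 0 ≤ Y.h ξ) ∧
      |Y.q ξ| ≤ K ∧ |Y.w ξ| ≤ K ∧ |Y.h ξ| ≤ K := by
    filter_upwards [hY.memF.memLp_v.1.ae_eq_mk, hY.memF.memLp_w.1.ae_eq_mk,
      hY.memF.memLp_h.1.ae_eq_mk, hY.invariant, hY.q_nonneg, hY.h_nonneg, hq.2, hw.2, hh.2]
      with ξ a1 a2 a3 a4 a5 a6 a7 a8 a9 using ⟨⟨a1, a2, a3⟩, ⟨a4, a5, a6⟩, a7, a8, a9⟩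
  obtain ⟨N, hNsub, hNm, hN0⟩ := exists_measurable_superset_of_null (ae_iff.1 hgood)
  have hN : ∀ ξ ∉ N, (Y.v ξ = v₁ ξ ∧ Y.w ξ = w₁ ξ ∧ Y.h ξ = h₁ ξ) ∧
      (Y.q ξ * Y.h ξ = Y.U ξ ^ 2 * Y.q ξ ^ 2 + Y.w ξ ^ 2 ∧ 0 ≤ Y.q ξ ∧ 0 ≤ Y.h ξ) ∧
      |Y.q ξ| ≤ K ∧ |Y.w ξ| ≤ K ∧ |Y.h ξ| ≤ K := fun ξ hξ => by
    by_contra hc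
    exact hξ (hNsub hc)
  have hNae : ∀ᵐ ξ, ξ ∉ N := measure_eq_zero_iff_ae_notMem.1 hN0
  classical
  -- On the exceptional null set `q = w = h = 0`, a choice satisfying all pointwise relations
  -- whatever `U` is.
  set v₂ : ℝ → ℝ := N.piecewise (fun _ => -1) v₁ with hv₂
  set w₂ : ℝ → ℝ := N.piecewise (fun _ => 0) w₁ with hw₂
  set h₂ : ℝ → ℝ := N.piecewise (fun _ => 0) h₁ with hh₂
  have val : ∀ ξ ∉ N, v₂ ξ = Y.v ξ ∧ w₂ ξ = Y.w ξ ∧ h₂ ξ = Y.h ξ := fun ξ hξ => by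
    obtain ⟨⟨a1, a2, a3⟩, -⟩ := hN ξ hξ
    simp [hv₂, hw₂, hh₂, piecewise_eq_of_notMem _ _ _ hξ, a1, a2, a3]
  have val' : ∀ ξ ∈ N, v₂ ξ = -1 ∧ w₂ ξ = 0 ∧ h₂ ξ = 0 := fun ξ hξ => by
    simp [hv₂, hw₂, hh₂, piecewise_eq_of_mem _ _ _ hξ]
  have ev : Y.v =ᵐ[volume] v₂ := hNae.mono fun ξ hξ => (val ξ hξ).1.symm
  have ew : Y.w =ᵐ[volume] w₂ := hNae.mono fun ξ hξ => (val ξ hξ).2.1.symm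
  have eh : Y.h =ᵐ[volume] h₂ := hNae.mono fun ξ hξ => (val ξ hξ).2.2.symm
  have mv : Measurable v₂ :=
    Measurable.piecewise hNm measurable_const hY.memF.memLp_v.1.stronglyMeasurable_mk.measurable
  have mw : Measurable w₂ :=
    Measurable.piecewise hNm measurable_const hY.memF.memLp_w.1.stronglyMeasurable_mk.measurable
  have mh : Measurable h₂ :=
    Measurable.piecewise hNm measurable_const hY.memF.memLp_h.1.stronglyMeasurable_mk.measurable
  set K' := K ^ 2 + 2 * K + 1 with hK'
  have hKK' : K ≤ K' := by rw [hK']; nlinarith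
  have hKK1 : 1 + K ≤ K' := by rw [hK']; nlinarith
  have K'0 : 0 ≤ K' := hK.trans hKK'
  have bv : SupLe v₂ K' := ⟨mv, fun ξ => by
    by_cases hξ : ξ ∈ N
    · rw [(val' ξ hξ).1, abs_neg, abs_one]; linarith
    · rw [(val ξ hξ).1]
      have h1 := (hN ξ hξ).2.2.1
      rw [State.q] at h1
      rw [abs_le] at h1 ⊢
      constructor <;> linarith [h1.1, h1.2]⟩
  have bw : SupLe w₂ K' := ⟨mw, fun ξ => by
    by_cases hξ : ξ ∈ N
    · rw [(val' ξ hξ).2.1, abs_zero]; exact K'0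
    · rw [(val ξ hξ).2.1]; exact ((hN ξ hξ).2.2.2.1).trans hKK'⟩
  have bh : SupLe h₂ K' := ⟨mh, fun ξ => by
    by_cases hξ : ξ ∈ N
    · rw [(val' ξ hξ).2.2, abs_zero]; exact K'0
    · rw [(val ξ hξ).2.2]; exact ((hN ξ hξ).2.2.2.2).trans hKK'⟩
  have pζ : Prim Y.ζ v₂ := by
    have h1 : Prim Y.y (fun ξ => 1 + v₂ ξ) := by
      refine prim_of_ae (normPair_sup.S_add (normPair_sup.S_const 1) bv) ?_ hY.deriv_y
      exact ev.mono fun ξ hξ => by rw [State.q, hξ]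
    exact (h1.add (Prim.id.const_mul (-1))).congr (fun ξ => by simp [State.y]) (fun ξ => by ring)
  have pU : Prim Y.U w₂ := prim_of_ae bw ew hY.deriv_U
  have pH : Prim Y.H h₂ := prim_of_ae bh eh hY.deriv_H
  have bnd : ∀ {f : ℝ → ℝ}, Continuous f → EssLe f K → SupLe f K' := fun hf h =>
    ⟨hf.measurable, fun ξ => (abs_le_of_continuous_of_essLe hf h ξ).trans hKK'⟩
  have bU := bnd pU.continuous hF.U
  have hE : Integrable (fun ξ => ω ξ * (Y.U ξ ^ 2 + h₂ ξ)) ∧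
      ∫ ξ, ω ξ * (Y.U ξ ^ 2 + h₂ ξ) ≤ K' := by
    have l2 : L2Le (fun ξ => θ ξ * Y.U ξ) K :=
      ⟨(hθ.mul bU.1).aestronglyMeasurable, hK, hb.U_weight⟩
    have i1 := l2.memLp.integrable_sq
    have i2 := l2.integral_sq_le
    have eh' : (fun ξ => ω ξ * Y.h ξ) =ᵐ[volume] fun ξ => ω ξ * h₂ ξ :=
      eh.mono fun ξ hξ => by simp only [hξ]
    have hw2 := hb.h_weight
    rw [eLpNorm_congr_ae eh'] at hw2
    obtain ⟨i3, i4⟩ := integral_le_of_eLpNorm_one_le (f := fun ξ => ω ξ * h₂ ξ)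
      (hω.mul mh).aestronglyMeasurable hK hw2
    have e : (fun ξ => ω ξ * (Y.U ξ ^ 2 + h₂ ξ)) =
        fun ξ => (θ ξ * Y.U ξ) ^ 2 + ω ξ * h₂ ξ := by
      ext ξ
      rw [mul_pow, hθω, mul_add]
    rw [e]
    refine ⟨i1.add i3, ?_⟩
    rw [integral_add i1 i3, hK']
    linarith
  refine ⟨⟨Y.ζ, Y.U, Y.H, v₂, w₂, h₂⟩, ⟨rfl, rfl, rfl, ev, ew, eh⟩, ⟨?_, ?_, ?_⟩, ?_, ?_, hE.1,
    hE.2, ?_⟩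
  · intro ξ
    by_cases hξ : ξ ∈ N
    · simp [State.q, val' ξ hξ]
    · simpa [State.q, val ξ hξ] using (hN ξ hξ).2.1.1
  · intro ξ
    by_cases hξ : ξ ∈ N
    · simp [State.q, val' ξ hξ]
    · simpa [State.q, val ξ hξ] using (hN ξ hξ).2.1.2.1
  · intro ξ
    by_cases hξ : ξ ∈ N
    · simp [val' ξ hξ]
    · simpa [val ξ hξ] using (hN ξ hξ).2.1.2.2
  · exact ⟨⟨K', bnd pζ.continuous hF.ζ, bU, bU, bnd pH.continuous hF.H, bv, bw, bh⟩, pζ, pU, pH⟩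
  · exact ⟨bnd pζ.continuous hF.ζ, bU, bU, bnd pH.continuous hF.H, bv, bw, bh⟩
  · refine ⟨mv.aestronglyMeasurable, K'0, ?_⟩
    change eLpNorm v₂ 2 volume ≤ _
    rw [← eLpNorm_congr_ae ev]
    exact hF.v.2.2.trans (ENNReal.ofReal_le_ofReal hKK')

/-- The exact solution with data in `𝒢`, bounded in `F`, with decaying potentials. -/
theorem exists_exactSolution {θ ω σ : ℝ → ℝ} {M₀ : ℝ} (hω : DecayWeight ω σ M₀)
    (hθ : Measurable θ) (hθω : ∀ ξ, θ ξ ^ 2 = ω ξ) (γ K T : ℝ) (hK : 0 ≤ K) (hT : 0 < T) :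
    ∃ M : ℝ, 0 ≤ M ∧ ∀ Y₀, MemG Y₀ → DataBnd θ ω K Y₀ → ∃ Y, IsExactSolution γ T Y₀ Y ∧
      ∀ t ∈ Icc 0 T, FBnd M (Y t) ∧ (∀ ξ, |P γ (Y t) ξ| ≤ M * (ω ξ)⁻¹) ∧
        ∀ ξ, |Q γ (Y t) ξ| ≤ M * (ω ξ)⁻¹ := by
  obtain ⟨M, hM, hex⟩ :=
    exists_exactSolution_of_initData hω γ (K ^ 2 + 2 * K + 1) T (by positivity) hT
  refine ⟨M, hM, fun Y₀ hG hb => ?_⟩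
  obtain ⟨Z₀, hZ₀, hi⟩ := hG.exists_initData hK hθ hω.meas_ω hθω hb
  obtain ⟨Z, hZ, hZb⟩ := hex Z₀ hi
  -- The initial condition is an equality of functions, so the original representative is restored
  -- at `t = 0`; norms do not notice.
  have hae : ∀ t, StateAE (Z t) (if t = 0 then Y₀ else Z t) := by
    intro t
    split_ifs with h
    · rw [h, hZ.init]
      exact ⟨hZ₀.ζ.symm, hZ₀.U.symm, hZ₀.H.symm, hZ₀.v.symm, hZ₀.w.symm, hZ₀.h.symm⟩
    · exact StateAE.refl _
  refine ⟨fun t => if t = 0 then Y₀ else Z t, IsSolution.congr_ae hZ hae (by simp),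
    fun t ht => ?_⟩
  obtain ⟨h1, h2, h3⟩ := hZb t ht
  have e := hae t
  simp only
  rw [← e.P_eq, ← e.Q_eq]
  refine ⟨?_, h2, h3⟩
  have hp := normPair_essSup_l2
  refine ⟨e.ζ ▸ h1.ζ, e.U ▸ h1.U, e.U ▸ h1.U', e.H ▸ h1.H,
    ⟨h1.v.1.congr e.v, h1.v.2.1, ?_⟩, ⟨h1.w.1.congr e.w, h1.w.2.1, ?_⟩,
    ⟨h1.h.1.congr e.h, h1.h.2.1, ?_⟩⟩
  · rw [← eLpNorm_congr_ae e.v]; exact h1.v.2.2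
  · rw [← eLpNorm_congr_ae e.w]; exact h1.w.2.2
  · rw [← eLpNorm_congr_ae e.h]; exact h1.h.2.2

/-! ### The discretised and truncated system -/

/-- The linear conditions which define `F_{Δξ,R}`. -/
structure DiscClass (Δ : ℝ) (N : ℕ) (Z : State) : Prop where
  step_ζ : IsStep Δ Z.ζ
  step_U : IsStep Δ Z.U
  step_H : IsStep Δ Z.H
  step_v : IsStep Δ Z.v
  step_w : IsStep Δ Z.w
  step_h : IsStep Δ Z.h
  vanish_U : ∀ ξ ∉ Ico (-(N * Δ)) (N * Δ), Z.U ξ = 0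
  vanish_v : ∀ ξ ∉ Ico (-(N * Δ)) (N * Δ), Z.v ξ = 0
  vanish_w : ∀ ξ ∉ Ico (-(N * Δ)) (N * Δ), Z.w ξ = 0
  vanish_h : ∀ ξ ∉ Ico (-(N * Δ)) (N * Δ), Z.h ξ = 0
  right_ζ : ∀ ξ, N * Δ ≤ ξ → Z.ζ ξ = Z.ζ (N * Δ)
  right_H : ∀ ξ, N * Δ ≤ ξ → Z.H ξ = Z.H (N * Δ)
  left_ζ : ∀ ξ, ξ < -(N * Δ) → Z.ζ ξ = Z.ζ (-(N * Δ) - 1)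
  left_H : ∀ ξ, ξ < -(N * Δ) → Z.H ξ = 0

lemma IsStep.add {Δ : ℝ} {f g : ℝ → ℝ} (hf : IsStep Δ f) (hg : IsStep Δ g) : IsStep Δ (f + g) :=
  fun i ξ hξ => by rw [Pi.add_apply, Pi.add_apply, hf i ξ hξ, hg i ξ hξ]

lemma IsStep.smul {Δ : ℝ} {f : ℝ → ℝ} (hf : IsStep Δ f) (c : ℝ) : IsStep Δ (c • f) :=
  fun i ξ hξ => by rw [Pi.smul_apply, Pi.smul_apply, hf i ξ hξ]

lemma eq_of_approx {f : ℝ → ℝ} {x y : ℝ}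
    (h : ∀ ε > 0, ∃ g : ℝ → ℝ, g x = g y ∧ ∀ ξ, |f ξ - g ξ| ≤ ε) : f x = f y := by
  rw [← sub_eq_zero, ← abs_nonpos_iff]
  refine le_of_forall_pos_le_add fun ε hε => ?_
  obtain ⟨g, hg, hb⟩ := h (ε / 2) (by positivity)
  have h1 := abs_le.1 (hb x)
  have h2 := abs_le.1 (hb y)
  rw [abs_le]
  constructor <;> linarith

lemma eq_zero_of_approx {f : ℝ → ℝ} {x : ℝ}
    (h : ∀ ε > 0, ∃ g : ℝ → ℝ, g x = 0 ∧ ∀ ξ, |f ξ - g ξ| ≤ ε) : f x = 0 := by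
  rw [← abs_nonpos_iff]
  refine le_of_forall_pos_le_add fun ε hε => ?_
  obtain ⟨g, hg, hb⟩ := h ε hε
  have := hb x
  rwa [hg, sub_zero, ← zero_add ε] at this

lemma discClass_closedClass {Δ : ℝ} (hΔ : 0 < Δ) (N : ℕ) : ClosedClass (DiscClass Δ N) where
  zero := by constructor <;> intros <;> first | rfl | (intro i ξ _; rfl)
  add := fun {X Z} hX hZ =>
    { step_ζ := hX.step_ζ.add hZ.step_ζ
      step_U := hX.step_U.add hZ.step_U
      step_H := hX.step_H.add hZ.step_H
      step_v := hX.step_v.add hZ.step_v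
      step_w := hX.step_w.add hZ.step_w
      step_h := hX.step_h.add hZ.step_h
      vanish_U := fun ξ h => by simp [hX.vanish_U ξ h, hZ.vanish_U ξ h]
      vanish_v := fun ξ h => by simp [hX.vanish_v ξ h, hZ.vanish_v ξ h]
      vanish_w := fun ξ h => by simp [hX.vanish_w ξ h, hZ.vanish_w ξ h]
      vanish_h := fun ξ h => by simp [hX.vanish_h ξ h, hZ.vanish_h ξ h]
      right_ζ := fun ξ h => by simp [hX.right_ζ ξ h, hZ.right_ζ ξ h]
      right_H := fun ξ h => by simp [hX.right_H ξ h, hZ.right_H ξ h]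
      left_ζ := fun ξ h => by simp [hX.left_ζ ξ h, hZ.left_ζ ξ h]
      left_H := fun ξ h => by simp [hX.left_H ξ h, hZ.left_H ξ h] }
  smul := fun c {X} hX =>
    { step_ζ := hX.step_ζ.smul c
      step_U := hX.step_U.smul c
      step_H := hX.step_H.smul c
      step_v := hX.step_v.smul c
      step_w := hX.step_w.smul c
      step_h := hX.step_h.smul c
      vanish_U := fun ξ h => by simp [hX.vanish_U ξ h]
      vanish_v := fun ξ h => by simp [hX.vanish_v ξ h]
      vanish_w := fun ξ h => by simp [hX.vanish_w ξ h]
      vanish_h := fun ξ h => by simp [hX.vanish_h ξ h]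
      right_ζ := fun ξ h => by simp [hX.right_ζ ξ h]
      right_H := fun ξ h => by simp [hX.right_H ξ h]
      left_ζ := fun ξ h => by simp [hX.left_ζ ξ h]
      left_H := fun ξ h => by simp [hX.left_H ξ h] }
  meas := fun hX => ⟨hX.step_ζ.measurable hΔ, hX.step_U.measurable hΔ, hX.step_H.measurable hΔ,
    hX.step_v.measurable hΔ, hX.step_w.measurable hΔ, hX.step_h.measurable hΔ⟩
  closed := fun {X} h => by
    have comp : ∀ {f : State → ℝ → ℝ} {p : (ℝ → ℝ) → Prop},
        (∀ Z ε, PtBnd ε (X - Z) → ∀ ξ, |f X ξ - f Z ξ| ≤ ε) → (∀ Z, DiscClass Δ N Z → p (f Z)) →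
        ∀ ε > 0, ∃ g : ℝ → ℝ, p g ∧ ∀ ξ, |f X ξ - g ξ| ≤ ε := by
      intro f p hf hp ε hε
      obtain ⟨Z, hZ, hb⟩ := h ε hε
      exact ⟨f Z, hp Z hZ, hf Z ε hb⟩
    have cζ : ∀ Z ε, PtBnd ε (X - Z) → ∀ ξ, |X.ζ ξ - Z.ζ ξ| ≤ ε := fun _ _ hb ξ => (hb ξ).1
    have cU : ∀ Z ε, PtBnd ε (X - Z) → ∀ ξ, |X.U ξ - Z.U ξ| ≤ ε := fun _ _ hb ξ => (hb ξ).2.1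
    have cH : ∀ Z ε, PtBnd ε (X - Z) → ∀ ξ, |X.H ξ - Z.H ξ| ≤ ε := fun _ _ hb ξ => (hb ξ).2.2.1
    have cv : ∀ Z ε, PtBnd ε (X - Z) → ∀ ξ, |X.v ξ - Z.v ξ| ≤ ε := fun _ _ hb ξ =>
      (hb ξ).2.2.2.1
    have cw : ∀ Z ε, PtBnd ε (X - Z) → ∀ ξ, |X.w ξ - Z.w ξ| ≤ ε := fun _ _ hb ξ =>
      (hb ξ).2.2.2.2.1
    have ch : ∀ Z ε, PtBnd ε (X - Z) → ∀ ξ, |X.h ξ - Z.h ξ| ≤ ε := fun _ _ hb ξ =>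
      (hb ξ).2.2.2.2.2
    exact
    { step_ζ := fun i ξ hξ => eq_of_approx (comp (f := State.ζ) (p := fun g => g ξ = g (i * Δ))
        cζ fun Z hZ => hZ.step_ζ i ξ hξ)
      step_U := fun i ξ hξ => eq_of_approx (comp (f := State.U) (p := fun g => g ξ = g (i * Δ))
        cU fun Z hZ => hZ.step_U i ξ hξ)
      step_H := fun i ξ hξ => eq_of_approx (comp (f := State.H) (p := fun g => g ξ = g (i * Δ))
        cH fun Z hZ => hZ.step_H i ξ hξ)
      step_v := fun i ξ hξ => eq_of_approx (comp (f := State.v) (p := fun g => g ξ = g (i * Δ))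
        cv fun Z hZ => hZ.step_v i ξ hξ)
      step_w := fun i ξ hξ => eq_of_approx (comp (f := State.w) (p := fun g => g ξ = g (i * Δ))
        cw fun Z hZ => hZ.step_w i ξ hξ)
      step_h := fun i ξ hξ => eq_of_approx (comp (f := State.h) (p := fun g => g ξ = g (i * Δ))
        ch fun Z hZ => hZ.step_h i ξ hξ)
      vanish_U := fun ξ hξ => eq_zero_of_approx (comp (f := State.U) (p := fun g => g ξ = 0)
        cU fun Z hZ => hZ.vanish_U ξ hξ)
      vanish_v := fun ξ hξ => eq_zero_of_approx (comp (f := State.v) (p := fun g => g ξ = 0)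
        cv fun Z hZ => hZ.vanish_v ξ hξ)
      vanish_w := fun ξ hξ => eq_zero_of_approx (comp (f := State.w) (p := fun g => g ξ = 0)
        cw fun Z hZ => hZ.vanish_w ξ hξ)
      vanish_h := fun ξ hξ => eq_zero_of_approx (comp (f := State.h) (p := fun g => g ξ = 0)
        ch fun Z hZ => hZ.vanish_h ξ hξ)
      right_ζ := fun ξ hξ => eq_of_approx (comp (f := State.ζ) (p := fun g => g ξ = g (N * Δ))
        cζ fun Z hZ => hZ.right_ζ ξ hξ)
      right_H := fun ξ hξ => eq_of_approx (comp (f := State.H) (p := fun g => g ξ = g (N * Δ))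
        cH fun Z hZ => hZ.right_H ξ hξ)
      left_ζ := fun ξ hξ => eq_of_approx
        (comp (f := State.ζ) (p := fun g => g ξ = g (-(N * Δ) - 1))
        cζ fun Z hZ => hZ.left_ζ ξ hξ)
      left_H := fun ξ hξ => eq_zero_of_approx (comp (f := State.H) (p := fun g => g ξ = 0)
        cH fun Z hZ => hZ.left_H ξ hξ) }

lemma notMem_cell_iff {ξ R : ℝ} : ξ ∉ Ico (-R) R ↔ ξ < -R ∨ R ≤ ξ := by
  rw [mem_Ico, not_and_or, not_le, not_lt]

section Disc

variable {γ Δ M : ℝ} {N : ℕ} {X Z : State}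

lemma MemFdisc.discClass (h : MemFdisc Δ N Z) : DiscClass Δ N Z := by
  obtain ⟨hg, hc⟩ := h
  obtain ⟨ζr, Hr, hr⟩ := hc.right
  obtain ⟨ζl, hl⟩ := hc.left
  exact
  { step_ζ := hg.step_ζ
    step_U := hg.step_U
    step_H := hg.step_H
    step_v := hg.step_v
    step_w := hg.step_w
    step_h := hg.step_h
    vanish_U := fun ξ hξ => (hc.vanish ξ (notMem_cell_iff.1 hξ)).1
    vanish_v := fun ξ hξ => (hc.vanish ξ (notMem_cell_iff.1 hξ)).2.1
    vanish_w := fun ξ hξ => (hc.vanish ξ (notMem_cell_iff.1 hξ)).2.2.1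
    vanish_h := fun ξ hξ => (hc.vanish ξ (notMem_cell_iff.1 hξ)).2.2.2
    right_ζ := fun ξ hξ => (hr ξ hξ).1.trans (hr _ le_rfl).1.symm
    right_H := fun ξ hξ => (hr ξ hξ).2.trans (hr _ le_rfl).2.symm
    -- The point `-R` belongs to the inner region, so `-R - 1` is the reference point for the value
    -- on the left.
    left_ζ := fun ξ hξ => (hl ξ hξ).1.trans (hl _ (by linarith)).1.symm
    left_H := fun ξ hξ => (hl ξ hξ).2 }

lemma DiscClass.memFdisc (h : DiscClass Δ N Z) (hF : MemF Z) : MemFdisc Δ N Z :=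
  ⟨⟨hF, h.step_ζ, h.step_U, h.step_H, h.step_v, h.step_w, h.step_h⟩, hF,
    fun ξ hξ => ⟨h.vanish_U ξ (notMem_cell_iff.2 hξ), h.vanish_v ξ (notMem_cell_iff.2 hξ),
      h.vanish_w ξ (notMem_cell_iff.2 hξ), h.vanish_h ξ (notMem_cell_iff.2 hξ)⟩,
    ⟨_, _, fun ξ hξ => ⟨h.right_ζ ξ hξ, h.right_H ξ hξ⟩⟩,
    ⟨_, fun ξ hξ => ⟨h.left_ζ ξ hξ, h.left_H ξ hξ⟩⟩⟩

/-- Outside `[-R, R)` the sampled potentials vanish by construction and every other term has a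
factor among `U, w, h`. In particular `ζ` and `H` are frozen there. -/
lemma DiscClass.Gdisc (hΔ : 0 < Δ) (h : DiscClass Δ N Z) : DiscClass Δ N (Gdisc γ Δ N Z) := by
  have sp := isStep_sampleCut (N := N) (f := P γ Z) hΔ
  have sr := isStep_sampleCut (N := N) (f := Q γ Z) hΔ
  have vp : ∀ ξ ∉ Ico (-(N * Δ)) (N * Δ), sampleCut Δ N (P γ Z) ξ = 0 := fun ξ hξ =>
    sampleCut_of_notMem hΔ hξ
  have vr : ∀ ξ ∉ Ico (-(N * Δ)) (N * Δ), sampleCut Δ N (Q γ Z) ξ = 0 := fun ξ hξ =>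
    sampleCut_of_notMem hΔ hξ
  have hr : ∀ ξ, N * Δ ≤ ξ → ξ ∉ Ico (-(N * Δ)) (N * Δ) := fun ξ hξ =>
    notMem_cell_iff.2 (Or.inr hξ)
  have hl : ∀ ξ, ξ < -(N * Δ) → ξ ∉ Ico (-(N * Δ)) (N * Δ) := fun ξ hξ =>
    notMem_cell_iff.2 (Or.inl hξ)
  constructor <;> intro i
  · intro ξ hξ
    simp only [HyperelasticRod.Gdisc, rhs, h.step_U i ξ hξ]
  · intro ξ hξ
    simp only [HyperelasticRod.Gdisc, rhs, sr i ξ hξ]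
  · intro ξ hξ
    simp only [HyperelasticRod.Gdisc, rhs, h.step_U i ξ hξ, sp i ξ hξ]
  · intro ξ hξ
    simp only [HyperelasticRod.Gdisc, rhs, h.step_w i ξ hξ]
  · intro ξ hξ
    simp only [HyperelasticRod.Gdisc, rhs, State.q, h.step_U i ξ hξ, sp i ξ hξ, h.step_v i ξ hξ,
      h.step_h i ξ hξ]
  · intro ξ hξ
    simp only [HyperelasticRod.Gdisc, rhs, State.q, h.step_U i ξ hξ, sp i ξ hξ, h.step_v i ξ hξ,
      h.step_w i ξ hξ, sr i ξ hξ]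
  all_goals intro hi
  · simp [HyperelasticRod.Gdisc, rhs, vr i hi]
  · simp [HyperelasticRod.Gdisc, rhs, h.vanish_w i hi]
  · simp [HyperelasticRod.Gdisc, rhs, h.vanish_h i hi, h.vanish_U i hi, vp i hi]
  · simp [HyperelasticRod.Gdisc, rhs, h.vanish_U i hi, h.vanish_w i hi]
  · simp [HyperelasticRod.Gdisc, rhs, h.vanish_U i (hr i hi), h.vanish_U _ (hr _ le_rfl)]
  · simp [HyperelasticRod.Gdisc, rhs, h.vanish_U i (hr i hi), h.vanish_U _ (hr _ le_rfl)]
  · simp [HyperelasticRod.Gdisc, rhs, h.vanish_U i (hl i hi),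
      h.vanish_U _ (hl (-(N * Δ) - 1) (by linarith))]
  · simp [HyperelasticRod.Gdisc, rhs, h.vanish_U i (hl i hi)]

lemma SupLe.sampleCut (hΔ : 0 < Δ) {f : ℝ → ℝ} {c : ℝ} (h : SupLe f c) :
    SupLe (sampleCut Δ N f) c := by
  refine ⟨measurable_sampleCut, fun ξ => ?_⟩
  rw [sampleCut_eq hΔ]
  split_ifs
  · exact h.2 _
  · rw [abs_zero]; exact h.nonneg

lemma SupLe.sampleCut_sub (hΔ : 0 < Δ) {f g : ℝ → ℝ} {c : ℝ} (h : SupLe (fun ξ => f ξ - g ξ) c) :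
    SupLe (fun ξ => HyperelasticRod.sampleCut Δ N f ξ - HyperelasticRod.sampleCut Δ N g ξ) c := by
  have e : (fun ξ => HyperelasticRod.sampleCut Δ N f ξ - HyperelasticRod.sampleCut Δ N g ξ) =
      HyperelasticRod.sampleCut Δ N (fun ξ => f ξ - g ξ) := by
    ext ξ
    rw [sampleCut_eq hΔ, sampleCut_eq hΔ, sampleCut_eq hΔ]
    split_ifs <;> simp
  rw [e]
  exact h.sampleCut hΔ

/-- Sampling and cutting off do not increase a sup norm, so the Lipschitz constant of `G` is
inherited. Point evaluation has no such bound in L², which is why the discrete system too is solved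
in the sup norm. -/
lemma Gdisc_sub_supBnd (hΔ : 0 < Δ) {d : ℝ} (hX : SupBnd M X) (hZ : SupBnd M Z)
    (hd : SupBnd d (X - Z)) :
    SupBnd (GLip γ M * d) (Gdisc γ Δ N X - Gdisc γ Δ N Z) := by
  have hP := (P_bnd (γ := γ) potPair_sup hZ).S.sampleCut (N := N) hΔ
  have hQ := (Q_bnd (γ := γ) potPair_sup hZ).S.sampleCut (N := N) hΔ
  have hPd := (P_sub_bnd (γ := γ) potPair_sup hX hZ hd).S.sampleCut_sub (N := N) hΔ
  have hQd := (Q_sub_bnd (γ := γ) potPair_sup hX hZ hd).S.sampleCut_sub (N := N) hΔ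
  have h := rhs_sub_bnd (γ := γ) normPair_sup hX hZ hd ⟨hP, hP⟩ ⟨hQ, hQ⟩ ⟨hPd, hPd⟩ ⟨hQd, hQd⟩
  have e : rhsLip γ M (potLip γ M * M) * (d + potLip γ M * d) = GLip γ M * d := by
    rw [GLip]; ring
  rwa [e] at h

lemma Gdisc_zero (hΔ : 0 < Δ) : Gdisc γ Δ N 0 = 0 := by
  have h : ∀ {f : ℝ → ℝ}, (∀ ξ, f ξ = 0) → sampleCut Δ N f = fun _ => 0 := fun h => by
    ext ξ
    rw [sampleCut_eq hΔ]
    simp [h]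
  rw [Gdisc, h P_zero, h Q_zero, rhs_zero]

lemma DiscClass.supBnd (hΔ : 0 < Δ) (h : DiscClass Δ N Z) (hM : FBnd M Z) :
    SupBnd (M * (1 + (√Δ)⁻¹)) Z := by
  have M0 : 0 ≤ M := hM.nonneg normPair_essSup_l2
  have s0 : 0 ≤ (√Δ)⁻¹ := inv_nonneg.2 (Real.sqrt_nonneg _)
  have l1 : M ≤ M * (1 + (√Δ)⁻¹) := le_mul_of_one_le_right M0 (by linarith)
  have l2 : M / √Δ ≤ M * (1 + (√Δ)⁻¹) := by
    rw [div_eq_mul_inv]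
    exact mul_le_mul_of_nonneg_left (by linarith) M0
  refine ((discClass_closedClass hΔ N).meas h).supBnd fun ξ => ⟨?_, ?_, ?_, ?_, ?_, ?_⟩
  · exact (h.step_ζ.abs_le_of_ae hΔ hM.ζ.2 ξ).trans l1
  · exact (h.step_U.abs_le_of_ae hΔ hM.U.2 ξ).trans l1
  · exact (h.step_H.abs_le_of_ae hΔ hM.H.2 ξ).trans l1
  · exact (h.step_v.abs_le_of_l2 hΔ hM.v ξ).trans l2
  · exact (h.step_w.abs_le_of_l2 hΔ hM.w ξ).trans l2
  · exact (h.step_h.abs_le_of_l2 hΔ hM.h ξ).trans l2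

lemma DiscClass.bnd_dom (h : DiscClass Δ N Z) (hM : SupBnd M Z) :
    Bnd SupLe (Dom ((Ico (-(N * Δ)) (N * Δ)).indicator 1)) M Z := by
  have M0 : 0 ≤ M := hM.nonneg normPair_sup
  have key : ∀ {f : ℝ → ℝ}, SupLe f M → (∀ ξ ∉ Ico (-(N * Δ)) (N * Δ), f ξ = 0) →
      Dom ((Ico (-(N * Δ)) (N * Δ)).indicator 1) f M := by
    intro f hf h0
    refine ⟨hf.1, M0, fun ξ => ?_⟩
    by_cases hξ : ξ ∈ Ico (-(N * Δ)) (N * Δ)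
    · simpa [indicator_of_mem hξ] using hf.2 ξ
    · simp [indicator_of_notMem hξ, h0 ξ hξ]
  exact ⟨hM.ζ, hM.U, key hM.U h.vanish_U, hM.H, key hM.v h.vanish_v, key hM.w h.vanish_w,
    key hM.h h.vanish_h⟩

theorem SupSol.isDiscreteSolution (hΔ : 0 < Δ) {τ : ℝ} {Z₀ : State} {Z : ℝ → State}
    (hZ : SupSol (DiscClass Δ N) (HyperelasticRod.Gdisc γ Δ N) τ Z₀ Z)
    (hM : ∀ t ∈ Icc 0 τ, SupBnd M (Z t)) (M0 : 0 ≤ M) : IsDiscreteSolution γ Δ N τ Z₀ Z := by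
  set ρ : ℝ → ℝ := (Ico (-(N * Δ)) (N * Δ)).indicator 1 with hρdef
  have hρ : ∀ ξ, 0 ≤ ρ ξ := fun ξ => indicator_nonneg (fun _ _ => zero_le_one) ξ
  have hp := normPair_dom hρ
  have hρL : L2Le ρ (1 * √(2 * (N * Δ))) := by
    refine L2Le.of_support (by positivity) ⟨measurable_one.indicator measurableSet_Ico,
      fun ξ => ?_⟩ fun ξ hξ => indicator_of_notMem hξ _
    rw [abs_of_nonneg (hρ ξ)]
    exact indicator_le_self' (fun _ _ => zero_le_one) ξ
  set r := 1 * √(2 * (N * Δ))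
  have hGL := GLip_nonneg (γ := γ) M0
  have hc : 0 ≤ GLip γ M * M := mul_nonneg hGL M0
  have hV : ∀ t ∈ Icc 0 τ, SupBnd (GLip γ M * M) (HyperelasticRod.Gdisc γ Δ N (Z t)) := by
    intro t ht
    have := Gdisc_sub_supBnd (γ := γ) (N := N) hΔ (hM t ht) (Bnd.zero normPair_sup M0) (d := M)
      (by simpa using hM t ht)
    rwa [Gdisc_zero hΔ, sub_zero] at this
  have hb : ∀ t ∈ Icc 0 τ, Bnd SupLe (Dom ρ) M (Z t) := fun t ht => (hZ.mem t ht).bnd_dom (hM t ht)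
  refine ⟨hZ.isSolution (c := M + GLip γ M * M) (L := 7 * (GLip γ M * (1 + r))) hρ hρL
    (fun t ht => (hb t ht).mono hp (by linarith))
    (fun t ht => (((hZ.mem t ht).Gdisc hΔ).bnd_dom (hV t ht)).mono hp (by linarith))
    fun s hs t ht d hd => ?_, fun t ht =>
      (hZ.mem t ht).memFdisc ((hb t ht).fBnd_of_dom hρL).memF⟩
  have h1 := Gdisc_sub_supBnd (γ := γ) (N := N) hΔ (hM s hs) (hM t ht)
    (d := d) ⟨hd.ζ, hd.U, hd.U, hd.H, ?_, ?_, ?_⟩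
  · have h2 := ((discClass_closedClass hΔ N).sub ((hZ.mem s hs).Gdisc (γ := γ) hΔ)
      ((hZ.mem t ht).Gdisc hΔ)).bnd_dom h1
    refine (h2.fBnd_of_dom hρL).normF_le.trans (ENNReal.ofReal_le_ofReal (le_of_eq ?_))
    ring
  all_goals
    have d0 : 0 ≤ d := hd.ζ.nonneg
    have hle : ∀ ξ, d * ρ ξ ≤ d := fun ξ => mul_le_of_le_one_right d0
      (indicator_le_self' (fun _ _ => zero_le_one) ξ)
  · exact ⟨hd.v.1, fun ξ => (hd.v.2.2 ξ).trans (hle ξ)⟩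
  · exact ⟨hd.w.1, fun ξ => (hd.w.2.2 ξ).trans (hle ξ)⟩
  · exact ⟨hd.h.1, fun ξ => (hd.h.2.2 ξ).trans (hle ξ)⟩

/-- Existence for the discretised system under an a priori bound in `F`. -/
theorem exists_discreteSolution_of_apriori (hΔ : 0 < Δ) {T m : ℝ} (hT : 0 < T) (hm : 0 ≤ m)
    {Z₀ : State} (hZ₀ : MemFdisc Δ N Z₀) (hZ₀m : normF Z₀ ≤ ENNReal.ofReal m)
    (hap : ∀ τ ∈ Ioc 0 T, ∀ Z, IsDiscreteSolution γ Δ N τ Z₀ Z →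
      ∀ t ∈ Icc 0 τ, normF (Z t) ≤ ENNReal.ofReal m) :
    ∃ Z, IsDiscreteSolution γ Δ N T Z₀ Z := by
  have hM0 : 0 ≤ m * (1 + (√Δ)⁻¹) :=
    mul_nonneg hm (by have := inv_nonneg.2 (Real.sqrt_nonneg Δ); linarith)
  obtain ⟨Z, hZ, hZM⟩ := exists_supSol (discClass_closedClass hΔ N)
    (𝒱 := HyperelasticRod.Gdisc γ Δ N) (fun h _ => h.Gdisc hΔ) (Gdisc_zero hΔ)
    (fun M hM => ⟨GLip γ M, GLip_nonneg hM, fun _ _ hX hZ hd => Gdisc_sub_supBnd hΔ hX hZ hd⟩)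
    hT hZ₀.discClass (hZ₀.discClass.supBnd hΔ (hZ₀.1.memF.fBnd hm hZ₀m))
    -- A solution bounded in the sup norm solves the system in `F`, where the a priori bound
    -- applies; the inverse inequality for step functions leads back to the sup norm.
    fun τ hτ Z hZ hb t ht => by
      have hsol := hZ.isDiscreteSolution hΔ hb (by linarith)
      exact (hZ.mem t ht).supBnd hΔ ((hsol.1.memF t ht).fBnd hm (hap τ hτ Z hsol t ht))
  exact ⟨Z, hZ.isDiscreteSolution hΔ hZM hM0⟩

end Disc

/-! ### The error estimate -/

lemma IsSolution.restrict {𝒱 : State → State} {T τ : ℝ} {Y₀ : State} {Y : ℝ → State}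
    (h : IsSolution 𝒱 T Y₀ Y) (hτ : τ ≤ T) : IsSolution 𝒱 τ Y₀ Y := by
  have hsub : Icc 0 τ ⊆ Icc 0 T := Icc_subset_Icc_right hτ
  exact ⟨h.init, fun t ht => h.memF t (hsub ht),
    fun t ht => (h.hasDeriv t (hsub ht)).mono_left (nhdsWithin_mono t fun s hs => ⟨hsub hs.1, hs.2⟩),
    fun t ht => (h.contDeriv t (hsub ht)).mono_left (nhdsWithin_mono t hsub)⟩

lemma nF_le_of_normF_le {X : State} {c : ℝ} (hc : 0 ≤ c) (h : normF X ≤ ENNReal.ofReal c) :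
    nF X ≤ c := ENNReal.toReal_le_of_le_ofReal hc h

lemma MemF.fBnd_nF {X : State} (hX : MemF X) : FBnd (nF X) X :=
  hX.fBnd (nF_nonneg X) (ofReal_nF hX).ge

/-- Bounds along a solution near a bounded one. -/
lemma fBnd_of_nF_sub_le {Y Z : State} {M : ℝ} (hY : FBnd M Y) (hZ : MemF Z)
    (h : nF (Y - Z) ≤ 1) : FBnd (7 * M + 1) Y ∧ FBnd (7 * M + 1) Z ∧
      normF Z ≤ ENNReal.ofReal (7 * M + 1) := by
  have M0 : 0 ≤ M := hY.nonneg normPair_essSup_l2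
  have h1 : normF Z ≤ ENNReal.ofReal (7 * M + 1) := by
    have e : Z = Y - (Y - Z) := by abel
    rw [e, ENNReal.ofReal_add (by positivity) zero_le_one]
    refine (normF_sub_le hY.memF (hY.memF.sub hZ)).trans (add_le_add hY.normF_le ?_)
    rw [← ofReal_nF (hY.memF.sub hZ)]
    exact ENNReal.ofReal_le_ofReal h
  exact ⟨hY.mono normPair_essSup_l2 (by linarith), hZ.fBnd (by positivity) h1, h1⟩

/-- Two exact solutions with the same initial data coincide, if one of them is bounded. -/
lemma IsExactSolution.normF_sub_eq_zero {γ T M : ℝ} {Y₀ : State} {X Y : ℝ → State}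
    (hX : IsExactSolution γ T Y₀ X) (hY : IsExactSolution γ T Y₀ Y)
    (hM : ∀ t ∈ Icc 0 T, FBnd M (X t)) {t : ℝ} (ht : t ∈ Icc 0 T) : normF (X t - Y t) = 0 := by
  have M0 : 0 ≤ M := (hM t ht).nonneg normPair_essSup_l2
  have hL := GLip_nonneg (γ := γ) (M := 7 * M + 1) (by positivity)
  have e0 : nF (Y₀ - Y₀) = 0 := by simp [nF]
  have h := IsSolution.nF_sub_le hX hY (fun t ht => (hX.memF t ht).G) (fun t ht => (hY.memF t ht).G)
    (L := 7 * GLip γ (7 * M + 1)) (e := 0) (by positivity) le_rfl (fun t ht h1 => by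
      obtain ⟨b1, b2, -⟩ := fBnd_of_nF_sub_le (hM t ht) (hY.memF t ht) h1
      rw [add_zero]
      refine nF_le_of_normF_le (mul_nonneg (by positivity) (nF_nonneg _)) ?_
      rw [ENNReal.ofReal_mul (by positivity), ofReal_nF ((hX.memF t ht).sub (hY.memF t ht))]
      exact normF_G_sub_le b1 b2) (by rw [e0]; simp) t ht
  rw [e0, zero_mul, add_zero, zero_mul] at h
  rw [← ofReal_nF ((hX.memF t ht).sub (hY.memF t ht))]
  exact ENNReal.ofReal_of_nonpos h

lemma outside_bnd_of_abs_le {f g : ℝ → ℝ} {R M c : ℝ} (hM : 0 ≤ M)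
    (hf : AEStronglyMeasurable f volume) (h : ∀ ξ, |f ξ| ≤ M * g ξ)
    (hg : Bnd₂ EssLe L2Le c (outside R g)) : Bnd₂ EssLe L2Le (M * c) (outside R f) := by
  have hm : AEStronglyMeasurable (outside R f) volume := hf.indicator measurableSet_Ico.compl
  have hle : ∀ ξ, |outside R f ξ| ≤ M * outside R g ξ := by
    intro ξ
    unfold outside
    by_cases hξ : ξ ∈ (Ico (-R) R)ᶜ
    · rw [indicator_of_mem hξ, indicator_of_mem hξ]; exact h ξ
    · rw [indicator_of_notMem hξ, indicator_of_notMem hξ]; simp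
  have := hg.smul normPair_essSup_l2 M
  rw [abs_of_nonneg hM] at this
  exact ⟨this.S.of_abs_le hm (ae_of_all _ hle), this.N.of_abs_le hm (ae_of_all _ hle)⟩

/-- Common form of both parts: the weight matters only through its compatibility with the kernel and
through the tail `ε R` of `1/ω`. The constructed solution `X` carries the bounds; uniqueness
transfers the estimate to any other exact solution. -/
theorem exists_error_estimate {θ ω σ ε : ℝ → ℝ} {M₀ M₁ : ℝ} (hω : DecayWeight ω σ M₀)
    (hθ : Measurable θ) (hθω : ∀ ξ, θ ξ ^ 2 = ω ξ)
    (htail : ∀ R, 1 ≤ R → Bnd₂ EssLe L2Le (M₁ * ε R) (outside R fun ξ => (ω ξ)⁻¹))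
    (hε : ∀ R, 1 ≤ R → 0 ≤ ε R) (hM₁ : 0 ≤ M₁) (hlim : Tendsto ε atTop (𝓝 0))
    (γ K T : ℝ) (hK : 0 ≤ K) (hT : 0 < T) :
    ∃ (C δ : ℝ) (n : ℕ), 0 ≤ C ∧ 0 < δ ∧ 0 < n ∧ ∀ Y₀, MemG Y₀ → DataBnd θ ω K Y₀ →
      (∃ Y, IsExactSolution γ T Y₀ Y) ∧ ∀ Y, IsExactSolution γ T Y₀ Y →
      ∀ (Δ : ℝ) (N : ℕ), 0 < Δ → 0 < N → Δ + 1 / (N * Δ) ≤ 1 / n →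
      ∀ Z₀, MemFdisc Δ N Z₀ → normF (Y₀ - Z₀) ≤ ENNReal.ofReal δ →
      (∃ Z, IsDiscreteSolution γ Δ N T Z₀ Z) ∧ ∀ Z, IsDiscreteSolution γ Δ N T Z₀ Z →
        ∀ t ∈ Icc 0 T, normF (Y t - Z t) ≤
          ENNReal.ofReal (C * (nF (Y₀ - Z₀) + √Δ + ε (N * Δ))) := by
  obtain ⟨M, hM, hex⟩ := exists_exactSolution hω hθ hθω γ K T hK hT
  -- The norm of the exact solution is at most `7M`; states within distance 1 of it have norm at
  -- most `B`, and `L` is the Lipschitz constant on that ball.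
  set B := 7 * M + 1 with hB
  have B0 : 0 ≤ B := by positivity
  set L := 7 * GLip γ B with hLdef
  have L0 : 0 ≤ L := by have := GLip_nonneg (γ := γ) B0; positivity
  set c := |consistConst γ B| * (1 + M * M₁) with hc
  have c0 : 0 ≤ c := by positivity
  set E := Real.exp (L * T) with hE
  have E0 : 0 < E := Real.exp_pos _
  -- Threshold for `√Δ` and for `ε R`: the consistency error then contributes at most 2/8 to the
  -- Grönwall bound, and `δ = 1/(8E)` limits the initial error to 1/8. The sum is below the 1/2
  -- required by the bootstrap.
  set s := 1 / (8 * E * (c * T + 1)) with hs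
  have s0 : 0 < s := by positivity
  have hsE : c * T * s * E ≤ 1 / 8 := by
    have e : (c * T + 1) * s * E = 1 / 8 := by rw [hs]; field_simp
    have : 0 ≤ s * E := by positivity
    nlinarith
  obtain ⟨R₀, hR₀⟩ := eventually_atTop.1 (hlim.eventually (ge_mem_nhds s0))
  -- The three lower bounds give `Δ ≤ 1 ≤ R`, `ε R ≤ s` and `√Δ ≤ s`, in this order.
  obtain ⟨n, hn⟩ := exists_nat_ge (max (max 1 R₀) (1 / s ^ 2))
  have hn1 : (1 : ℝ) ≤ n := (le_max_left _ _).trans ((le_max_left _ _).trans hn)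
  have hnR : R₀ ≤ n := (le_max_right _ _).trans ((le_max_left _ _).trans hn)
  have hns : 1 / s ^ 2 ≤ n := (le_max_right _ _).trans hn
  have hn0 : (0 : ℝ) < n := by linarith
  refine ⟨(1 + c * T) * E, 1 / (8 * E), n, by positivity, by positivity, by exact_mod_cast hn0,
    fun Y₀ hG hb => ?_⟩
  obtain ⟨X, hX, hXb⟩ := hex Y₀ hG hb
  refine ⟨⟨X, hX⟩, fun Y hY Δ N hΔ hN hn' Z₀ hZ₀ hδ => ?_⟩
  set R : ℝ := N * Δ with hR
  have hR0 : 0 < R := by have : (0 : ℝ) < N := by exact_mod_cast hN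
                         positivity
  have hΔn : Δ ≤ 1 / n := by have : 0 < 1 / R := by positivity
                             linarith
  have hRn : n ≤ R := by
    have : 1 / R ≤ 1 / n := by linarith
    exact (one_div_le_one_div hR0 hn0).1 this
  have hΔ1 : Δ ≤ 1 := hΔn.trans ((div_le_one hn0).2 hn1)
  have hR1 : 1 ≤ R := hn1.trans hRn
  have hεR : ε R ≤ s := hR₀ R (hnR.trans hRn)
  have hε0 : 0 ≤ ε R := hε R hR1
  have hΔs : √Δ ≤ s := by
    rw [Real.sqrt_le_left s0.le]
    refine hΔn.trans ?_
    rw [one_div_le hn0 (by positivity)]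
    exact hns
  have hd0 := nF_le_of_normF_le (by positivity) hδ
  have hd00 := nF_nonneg (Y₀ - Z₀)
  set e := c * (√Δ + ε R) with he
  have e0 : 0 ≤ e := by positivity
  have small : (nF (Y₀ - Z₀) + e * T) * E ≤ 1 / 2 := by
    have h1 : nF (Y₀ - Z₀) * E ≤ 1 / 8 := by
      calc nF (Y₀ - Z₀) * E ≤ 1 / (8 * E) * E := mul_le_mul_of_nonneg_right hd0 E0.le
        _ = 1 / 8 := by field_simp
    have h2 : e * T * E ≤ 2 * (c * T * s * E) := by
      have : √Δ + ε R ≤ 2 * s := by linarith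
      calc e * T * E = c * T * E * (√Δ + ε R) := by rw [he]; ring
        _ ≤ c * T * E * (2 * s) := mul_le_mul_of_nonneg_left this (by positivity)
        _ = _ := by ring
    linarith
  have tail : ∀ t ∈ Icc 0 T, Bnd₂ EssLe L2Le (M * (M₁ * ε R)) (outside R (P γ (X t))) ∧
      Bnd₂ EssLe L2Le (M * (M₁ * ε R)) (outside R (Q γ (X t))) := fun t ht =>
    ⟨outside_bnd_of_abs_le hM (P_bnd potPair_essSup_l2 (hXb t ht).1).S.1 (hXb t ht).2.1
      (htail R hR1),
    outside_bnd_of_abs_le hM (Q_bnd potPair_essSup_l2 (hXb t ht).1).S.1 (hXb t ht).2.2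
      (htail R hR1)⟩
  -- Needed on every shorter interval, since the existence of the discrete solution up to `T` is
  -- itself deduced from this estimate.
  have stab : ∀ τ ∈ Ioc 0 T, ∀ Z, IsDiscreteSolution γ Δ N τ Z₀ Z →
      ∀ t ∈ Icc 0 τ, nF (X t - Z t) ≤ (nF (Y₀ - Z₀) + e * T) * E := by
    intro τ hτ Z hZ t ht
    have hmono : (nF (Y₀ - Z₀) + e * τ) * Real.exp (L * τ) ≤ (nF (Y₀ - Z₀) + e * T) * E := by
      have := hτ.2
      rw [hE]
      gcongr
    have hsub : ∀ t ∈ Icc 0 τ, t ∈ Icc 0 T := fun t ht => ⟨ht.1, ht.2.trans hτ.2⟩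
    refine (IsSolution.nF_sub_le (hX.restrict hτ.2) hZ.1
      (fun t ht => (hX.memF t (hsub t ht)).G) (fun t ht => (hZ.1.memF t ht).Gdisc hΔ) L0 e0
      (fun t ht h1 => ?_) (hmono.trans small) t ht).trans hmono
    have hXt := hX.memF t (hsub t ht)
    have hZt := hZ.1.memF t ht
    obtain ⟨b1, b2, -⟩ := fBnd_of_nF_sub_le (hXb t (hsub t ht)).1 hZt h1
    refine nF_le_of_normF_le (add_nonneg (mul_nonneg L0 (nF_nonneg _)) e0)
      ((normF_G_sub_Gdisc_le hΔ hΔ1 b1 b2 (hXt.sub hZt).fBnd_nF (hZ.2 t ht).1.step_ζ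
        (tail t (hsub t ht)).1 (tail t (hsub t ht)).2).trans (ENNReal.ofReal_le_ofReal ?_))
    refine add_le_add le_rfl ?_
    have h2 : √Δ + M * (M₁ * ε R) ≤ (1 + M * M₁) * (√Δ + ε R) := by
      have : 0 ≤ M * M₁ * √Δ := by positivity
      linarith
    calc consistConst γ B * (√Δ + M * (M₁ * ε R))
        ≤ |consistConst γ B| * (√Δ + M * (M₁ * ε R)) :=
          mul_le_mul_of_nonneg_right (le_abs_self _) (by positivity)
      _ ≤ |consistConst γ B| * ((1 + M * M₁) * (√Δ + ε R)) :=
          mul_le_mul_of_nonneg_left h2 (abs_nonneg _)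
      _ = e := by rw [he, hc]; ring
  have bound : ∀ τ ∈ Ioc 0 T, ∀ Z, IsDiscreteSolution γ Δ N τ Z₀ Z →
      ∀ t ∈ Icc 0 τ, normF (Z t) ≤ ENNReal.ofReal B := fun τ hτ Z hZ t ht =>
    (fBnd_of_nF_sub_le (hXb t ⟨ht.1, ht.2.trans hτ.2⟩).1 (hZ.1.memF t ht)
      (((stab τ hτ Z hZ t ht).trans small).trans (by norm_num))).2.2
  refine ⟨exists_discreteSolution_of_apriori hΔ hT B0 hZ₀ ?_ bound, fun Z hZ t ht => ?_⟩
  · have h0 : (0 : ℝ) ∈ Icc 0 T := ⟨le_rfl, hT.le⟩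
    have h1 := (hXb 0 h0).1
    rw [hX.init] at h1
    refine (fBnd_of_nF_sub_le h1 hZ₀.1.memF ?_).2.2
    have : nF (Y₀ - Z₀) ≤ (nF (Y₀ - Z₀) + e * T) * E := by
      have h2 : 1 ≤ E := Real.one_le_exp (by positivity)
      have h3 : 0 ≤ e * T := by positivity
      nlinarith
    linarith
  · have hXt := hX.memF t ht
    have hYt := hY.memF t ht
    have hZt := hZ.1.memF t ht
    refine (normF_triangle hYt hXt hZt).trans ?_
    rw [normF_sub_comm, hX.normF_sub_eq_zero hY (fun t ht => (hXb t ht).1) ht, zero_add,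
      ← ofReal_nF (hXt.sub hZt)]
    refine ENNReal.ofReal_le_ofReal ((stab T ⟨hT, le_rfl⟩ Z hZ t ht).trans ?_)
    have h1 : 0 ≤ c * T * E * nF (Y₀ - Z₀) := by positivity
    have h2 : 0 ≤ E * (√Δ + ε R) := by positivity
    calc (nF (Y₀ - Z₀) + e * T) * E
        = E * nF (Y₀ - Z₀) + c * T * E * (√Δ + ε R) := by rw [he]; ring
      _ ≤ (1 + c * T) * E * (nF (Y₀ - Z₀) + √Δ + ε R) := by linarith

/-! ### Exponential and polynomial weights -/

lemma integrable_exp_neg_abs_half : Integrable (fun ξ : ℝ => Real.exp (-|ξ| / 2)) ∧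
    ∫ ξ : ℝ, Real.exp (-|ξ| / 2) = 4 := by
  have e : (fun ξ : ℝ => Real.exp (-|ξ| / 2)) = fun ξ => Real.exp (-|ξ / 2|) := by
    ext ξ
    rw [abs_div, abs_two, neg_div]
  rw [e, Measure.integral_comp_div (fun ξ => Real.exp (-|ξ|)), integral_exp_neg_abs]
  exact ⟨integrable_exp_neg_abs.comp_div two_ne_zero, by norm_num⟩

lemma abs_le_abs_sub_add (ξ η : ℝ) : |ξ| ≤ |ξ - η| + |η| := by
  have := abs_add_le (ξ - η) η
  rwa [sub_add_cancel] at this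

lemma decayWeight_exp :
    DecayWeight (fun ξ => Real.exp |ξ|) (fun ξ => Real.exp (-|ξ| / 2)) 4 where
  meas_ω := by fun_prop
  meas_σ := by fun_prop
  one_le ξ := Real.one_le_exp (abs_nonneg _)
  σ_pos ξ := Real.exp_pos _
  σ_le ξ := Real.exp_le_one_iff.2 (by linarith [abs_nonneg ξ])
  int_σ := integrable_exp_neg_abs_half.1
  integral_σ_le := integrable_exp_neg_abs_half.2.le
  shift_ω ξ η := by
    rw [← Real.exp_add]
    have h : Real.exp (|ξ| + -|ξ - η|) ≤ Real.exp |η| :=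
      Real.exp_le_exp.2 (by linarith [abs_le_abs_sub_add ξ η])
    linarith [Real.exp_pos |η|]
  shift_σ ξ η := by
    rw [← Real.exp_add]
    have h : Real.exp (-|η| / 2 + -|ξ - η| / 2) ≤ Real.exp (-|ξ| / 2) :=
      Real.exp_le_exp.2 (by linarith [abs_le_abs_sub_add ξ η])
    linarith [Real.exp_pos (-|ξ| / 2)]
  inv_le ξ := by
    rw [← Real.exp_neg]
    exact Real.exp_le_exp.2 (by linarith [abs_nonneg ξ])

lemma le_abs_of_notMem {R ξ : ℝ} (h : ξ ∈ (Ico (-R) R)ᶜ) : R ≤ |ξ| := by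
  rcases notMem_cell_iff.1 h with h | h
  · rw [le_abs]; right; linarith
  · exact h.trans (le_abs_self ξ)

/-- For `|ξ| ≥ R` one has `e^{-2|ξ|} ≤ e^{-2R} e^{-(|ξ| - R)}`. Adding the kernels centred at `±R`,
each of mass 2, bounds the squared L² norm by `4 e^{-2R}`. -/
lemma tail_exp {R : ℝ} (hR : 0 ≤ R) :
    Bnd₂ EssLe L2Le (2 * Real.exp (-R)) (outside R fun ξ => (Real.exp |ξ|)⁻¹) := by
  have hm : Measurable (outside R fun ξ => (Real.exp |ξ|)⁻¹) :=
    Measurable.indicator (by fun_prop) measurableSet_Ico.compl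
  have hE := Real.exp_pos (-R)
  have hi := (integrable_exp_sub R).add (integrable_exp_sub (-R))
  refine ⟨⟨hm.aestronglyMeasurable, ae_of_all _ fun ξ => ?_⟩,
    L2Le.of_sq_le hm.aestronglyMeasurable (hi.const_mul (Real.exp (-R) ^ 2)) (fun ξ => ?_)
      (by positivity) ?_⟩
  · by_cases hξ : ξ ∈ (Ico (-R) R)ᶜ
    · rw [outside, indicator_of_mem hξ, ← Real.exp_neg, Real.abs_exp]
      have := Real.exp_le_exp.2 (neg_le_neg (le_abs_of_notMem hξ))
      linarith
    · rw [outside, indicator_of_notMem hξ, abs_zero]; positivity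
  · simp only [Pi.add_apply]
    by_cases hξ : ξ ∈ (Ico (-R) R)ᶜ
    · rw [outside, indicator_of_mem hξ, ← Real.exp_neg, sq, sq, mul_add, ← Real.exp_add,
        ← Real.exp_add, ← Real.exp_add, ← Real.exp_add]
      rcases notMem_cell_iff.1 hξ with h | h
      · refine le_trans (Real.exp_le_exp.2 ?_) (le_add_of_nonneg_left (Real.exp_pos _).le)
        rw [abs_of_nonpos (by linarith), abs_of_nonneg (by linarith)]
        linarith
      · refine le_trans (Real.exp_le_exp.2 ?_) (le_add_of_nonneg_right (Real.exp_pos _).le)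
        rw [abs_of_nonneg (by linarith), abs_of_nonpos (by linarith)]
        linarith
    · rw [outside, indicator_of_notMem hξ, zero_pow two_ne_zero]
      positivity
  · rw [integral_const_mul]
    simp only [Pi.add_apply]
    rw [integral_add (integrable_exp_sub R) (integrable_exp_sub (-R)), integral_exp_sub,
      integral_exp_sub]
    linarith

section Polynomial

variable {α : ℝ}

/-- The polynomial weight. -/
def polWeight (α ξ : ℝ) : ℝ := (1 + |ξ|) ^ α

lemma polWeight_pos (α ξ : ℝ) : 0 < polWeight α ξ :=
  Real.rpow_pos_of_pos (by linarith [abs_nonneg ξ]) α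

lemma one_le_polWeight (hα : 0 ≤ α) (ξ : ℝ) : 1 ≤ polWeight α ξ :=
  Real.one_le_rpow (by linarith [abs_nonneg ξ]) hα

lemma measurable_polWeight (α : ℝ) : Measurable (polWeight α) := by unfold polWeight; fun_prop

lemma integrable_inv_polWeight (hα : 1 < α) : Integrable (fun ξ => (polWeight α ξ)⁻¹) := by
  have h := integrable_one_add_norm (E := ℝ) (μ := volume) (r := α) (by simpa using hα)
  refine h.congr (ae_of_all _ fun ξ => ?_)
  simp only [polWeight, Real.norm_eq_abs]
  rw [Real.rpow_neg (by positivity)]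

/-- With `x = |ξ - η|`, `1 + |ξ| ≤ (1 + x)(1 + |η|)` and `1 + x ≤ 2α e^{x/(2α)}`; the power `α`
turns the last exponential into `e^{x/2}`, so half of the kernel suffices. -/
lemma polWeight_mul_exp_le (hα : 1 < α) (ξ η : ℝ) :
    polWeight α ξ * Real.exp (-|ξ - η| / 2) ≤ (2 * α) ^ α * polWeight α η := by
  have hα0 : 0 < α := by linarith
  set x := |ξ - η|
  have x0 : 0 ≤ x := abs_nonneg _
  have h1 : 1 + |ξ| ≤ (1 + x) * (1 + |η|) := by
    have := abs_le_abs_sub_add ξ η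
    have := mul_nonneg x0 (abs_nonneg η)
    linarith
  have h2 : 1 + x ≤ 2 * α * Real.exp (x / (2 * α)) := by
    have h3 := Real.add_one_le_exp (x / (2 * α))
    calc 1 + x ≤ 2 * α + x := by linarith
      _ = 2 * α * (x / (2 * α) + 1) := by field_simp; ring
      _ ≤ _ := mul_le_mul_of_nonneg_left h3 (by positivity)
  have h4 : polWeight α ξ ≤ (2 * α) ^ α * Real.exp (x / 2) * polWeight α η := by
    calc polWeight α ξ ≤ (2 * α * Real.exp (x / (2 * α)) * (1 + |η|)) ^ α :=
          Real.rpow_le_rpow (by positivity)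
            (h1.trans (mul_le_mul_of_nonneg_right h2 (by positivity))) hα0.le
      _ = _ := by
          rw [Real.mul_rpow (by positivity) (by positivity),
            Real.mul_rpow (by positivity) (Real.exp_pos _).le, ← Real.exp_mul, polWeight]
          congr 3
          field_simp
  calc _ ≤ (2 * α) ^ α * Real.exp (x / 2) * polWeight α η * Real.exp (-x / 2) :=
        mul_le_mul_of_nonneg_right h4 (Real.exp_pos _).le
    _ = (2 * α) ^ α * polWeight α η * (Real.exp (x / 2) * Real.exp (-x / 2)) := by ring
    _ = _ := by rw [← Real.exp_add, neg_div, add_neg_cancel, Real.exp_zero, mul_one]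

/-- Here `σ = 1/ω` itself is possible: polynomial decay survives smearing, and `α > 1` is exactly
what makes `1/ω` integrable. -/
lemma decayWeight_pol (hα : 1 < α) :
    DecayWeight (polWeight α) (fun ξ => (polWeight α ξ)⁻¹)
      ((2 * α) ^ α + ∫ ξ, (polWeight α ξ)⁻¹) where
  meas_ω := measurable_polWeight α
  meas_σ := (measurable_polWeight α).inv
  one_le := one_le_polWeight (by linarith)
  σ_pos ξ := inv_pos.2 (polWeight_pos α ξ)
  σ_le ξ := inv_le_one_of_one_le₀ (one_le_polWeight (by linarith) ξ)
  int_σ := integrable_inv_polWeight hα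
  integral_σ_le := le_add_of_nonneg_left (by positivity)
  shift_ω ξ η := by
    have h1 : Real.exp (-|ξ - η|) ≤ Real.exp (-|ξ - η| / 2) :=
      Real.exp_le_exp.2 (by linarith [abs_nonneg (ξ - η)])
    have h2 : 0 ≤ ∫ ξ, (polWeight α ξ)⁻¹ :=
      integral_nonneg fun ξ => (inv_pos.2 (polWeight_pos α ξ)).le
    have h3 := mul_nonneg h2 (polWeight_pos α η).le
    have h4 := mul_le_mul_of_nonneg_left h1 (polWeight_pos α ξ).le
    linarith [polWeight_mul_exp_le hα ξ η]
  shift_σ ξ η := by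
    have h2 : 0 ≤ ∫ ξ, (polWeight α ξ)⁻¹ :=
      integral_nonneg fun ξ => (inv_pos.2 (polWeight_pos α ξ)).le
    have h3 := mul_nonneg h2 (polWeight_pos α η).le
    have h4 := polWeight_mul_exp_le hα ξ η
    have hξ := polWeight_pos α ξ
    have hη := polWeight_pos α η
    rw [inv_mul_le_iff₀ hη, ← div_eq_mul_inv, ← mul_div_assoc, le_div_iff₀ hξ]
    linarith
  inv_le ξ := le_rfl

/-- In `∫ ω⁻²` over `|ξ| ≥ R` one factor is at most `R^{-α}` and the other is integrable; the square
root leaves `R^{-α/2}`. The supremum `R^{-α}` is smaller still. -/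
lemma tail_pol (hα : 1 < α) {R : ℝ} (hR : 1 ≤ R) :
    Bnd₂ EssLe L2Le ((1 + ∫ ξ, (polWeight α ξ)⁻¹) * (1 / R ^ (α / 2)))
      (outside R fun ξ => (polWeight α ξ)⁻¹) := by
  have hm : Measurable (outside R fun ξ => (polWeight α ξ)⁻¹) :=
    (measurable_polWeight α).inv.indicator measurableSet_Ico.compl
  have hI : 0 ≤ ∫ ξ, (polWeight α ξ)⁻¹ :=
    integral_nonneg fun ξ => (inv_pos.2 (polWeight_pos α ξ)).le
  set I := ∫ ξ, (polWeight α ξ)⁻¹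
  set e := 1 / R ^ (α / 2) with he
  have hR0 : 0 < R := by linarith
  have hR2 : 1 ≤ R ^ (α / 2) := Real.one_le_rpow hR (by linarith)
  have e0 : 0 < e := by positivity
  have e1 : e ≤ 1 := by rw [he, div_le_one (by positivity)]; exact hR2
  have hle : ∀ ξ ∈ (Ico (-R) R)ᶜ, (polWeight α ξ)⁻¹ ≤ e ^ 2 := by
    intro ξ hξ
    have h1 : R ^ α ≤ polWeight α ξ :=
      Real.rpow_le_rpow hR0.le (by linarith [le_abs_of_notMem hξ]) (by linarith)
    have h2 : R ^ α = (R ^ (α / 2)) ^ 2 := by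
      rw [← Real.rpow_natCast, ← Real.rpow_mul hR0.le]
      norm_num
    rw [he, div_pow, one_pow, ← h2, ← one_div]
    exact one_div_le_one_div_of_le (by positivity) h1
  refine ⟨⟨hm.aestronglyMeasurable, ae_of_all _ fun ξ => ?_⟩,
    L2Le.of_sq_le hm.aestronglyMeasurable ((integrable_inv_polWeight hα).const_mul (e ^ 2))
      (fun ξ => ?_) (by positivity) ?_⟩
  · by_cases hξ : ξ ∈ (Ico (-R) R)ᶜ
    · rw [outside, indicator_of_mem hξ, abs_of_pos (inv_pos.2 (polWeight_pos α ξ))]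
      refine (hle ξ hξ).trans ?_
      nlinarith [mul_nonneg hI e0.le]
    · rw [outside, indicator_of_notMem hξ, abs_zero]; positivity
  · have hp := inv_pos.2 (polWeight_pos α ξ)
    by_cases hξ : ξ ∈ (Ico (-R) R)ᶜ
    · rw [outside, indicator_of_mem hξ, sq]
      exact mul_le_mul_of_nonneg_right (hle ξ hξ) hp.le
    · rw [outside, indicator_of_notMem hξ, zero_pow two_ne_zero]
      exact mul_nonneg (sq_nonneg _) hp.le
  · rw [integral_const_mul, mul_pow, mul_comm]
    refine mul_le_mul_of_nonneg_right ?_ (sq_nonneg e)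
    nlinarith

end Polynomial

lemma dataBnd_of_sum_le {θ ω : ℝ → ℝ} {K : ℝ≥0} {Y : State} {a : ℝ≥0∞}
    (h : normF Y + eLpNorm Y.q ∞ volume + eLpNorm Y.w ∞ volume + eLpNorm Y.h ∞ volume
      + eLpNorm (fun ξ => θ ξ * Y.U ξ) 2 volume + a
      + eLpNorm (fun ξ => ω ξ * Y.h ξ) 1 volume ≤ K) : DataBnd θ ω K Y := by
  rw [← ENNReal.ofReal_coe_nnreal] at h
  refine ⟨le_trans ?_ h, le_trans ?_ h, le_trans ?_ h, le_trans ?_ h, le_trans ?_ h,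
    le_trans ?_ h⟩
  · exact le_add_right <| le_add_right <| le_add_right <| le_add_right <| le_add_right le_self_add
  · exact le_add_right <| le_add_right <| le_add_right <| le_add_right <| le_add_right le_add_self
  · exact le_add_right <| le_add_right <| le_add_right <| le_add_right le_add_self
  · exact le_add_right <| le_add_right <| le_add_right le_add_self
  · exact le_add_right <| le_add_right le_add_self
  · exact le_add_self

lemma iSup_normF_le {T C s e : ℝ} (hC : 0 ≤ C) (hs : 0 ≤ s) (he : 0 ≤ e) {X Y : ℝ → State}
    {X₀ : State} (hX₀ : MemF X₀)
    (h : ∀ t ∈ Icc 0 T, normF (X t - Y t) ≤ ENNReal.ofReal (C * (nF X₀ + s + e))) :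
    ⨆ t ∈ Icc 0 T, normF (X t - Y t) ≤
      (C.toNNReal : ℝ≥0∞) * (normF X₀ + ENNReal.ofReal s + ENNReal.ofReal e) := by
  refine iSup₂_le fun t ht => (h t ht).trans (le_of_eq ?_)
  rw [ENNReal.ofReal_mul hC, ENNReal.ofReal_add (add_nonneg (nF_nonneg _) hs) he,
    ENNReal.ofReal_add (nF_nonneg _) hs, ofReal_nF hX₀]
  rfl

end HyperelasticRod

end

theorem mainTheorem4 (γ T : ℝ) (hT : 0 < T) :
    (∀ K : ℝ≥0, ∃ (C : ℝ≥0) (δ : ℝ) (n : ℕ), 0 < δ ∧ 0 < n ∧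
      ∀ Y₀ : HyperelasticRod.State, HyperelasticRod.MemG Y₀ → HyperelasticRod.MemFexp Y₀ →
        HyperelasticRod.normFexp Y₀ ≤ K →
        (∃ Y, HyperelasticRod.IsExactSolution γ T Y₀ Y) ∧
        ∀ Y, HyperelasticRod.IsExactSolution γ T Y₀ Y →
        ∀ (Δξ : ℝ) (N : ℕ) (R : ℝ), 0 < Δξ → 0 < N → R = N * Δξ → Δξ + 1 / R ≤ 1 / n →
        ∀ Z₀ : HyperelasticRod.State, HyperelasticRod.MemFdisc Δξ N Z₀ →
          HyperelasticRod.normF (Y₀ - Z₀) ≤ ENNReal.ofReal δ →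
          (∃ Z, HyperelasticRod.IsDiscreteSolution γ Δξ N T Z₀ Z) ∧
          ∀ Z, HyperelasticRod.IsDiscreteSolution γ Δξ N T Z₀ Z →
            ⨆ t ∈ Icc 0 T, HyperelasticRod.normF (Y t - Z t) ≤
              C * (HyperelasticRod.normF (Y₀ - Z₀) + ENNReal.ofReal (√Δξ)
                + ENNReal.ofReal (Real.exp (-R)))) ∧
    (∀ α : ℝ, 1 < α → ∀ K : ℝ≥0, ∃ (C : ℝ≥0) (δ : ℝ) (n : ℕ), 0 < δ ∧ 0 < n ∧
      ∀ Y₀ : HyperelasticRod.State, HyperelasticRod.MemG Y₀ → HyperelasticRod.MemFpol α Y₀ →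
        HyperelasticRod.normFpol α Y₀ ≤ K →
        (∃ Y, HyperelasticRod.IsExactSolution γ T Y₀ Y) ∧
        ∀ Y, HyperelasticRod.IsExactSolution γ T Y₀ Y →
        ∀ (Δξ : ℝ) (N : ℕ) (R : ℝ), 0 < Δξ → 0 < N → R = N * Δξ → Δξ + 1 / R ≤ 1 / n →
        ∀ Z₀ : HyperelasticRod.State, HyperelasticRod.MemFdisc Δξ N Z₀ →
          HyperelasticRod.normF (Y₀ - Z₀) ≤ ENNReal.ofReal δ →
          (∃ Z, HyperelasticRod.IsDiscreteSolution γ Δξ N T Z₀ Z) ∧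
          ∀ Z, HyperelasticRod.IsDiscreteSolution γ Δξ N T Z₀ Z →
            ⨆ t ∈ Icc 0 T, HyperelasticRod.normF (Y t - Z t) ≤
              C * (HyperelasticRod.normF (Y₀ - Z₀) + ENNReal.ofReal (√Δξ)
                + ENNReal.ofReal (1 / R ^ (α / 2)))) := by
  refine ⟨fun K => ?_, fun α hα K => ?_⟩
  · obtain ⟨C, δ, n, hC, hδ, hn, h⟩ := HyperelasticRod.exists_error_estimate
      -- `U` enters the energy density quadratically, so its weight is the square root of the weight
      -- `e^{|ξ|}` of `h`.
      (θ := fun ξ => Real.exp (|ξ| / 2)) (ε := fun R => Real.exp (-R))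
      HyperelasticRod.decayWeight_exp (by fun_prop)
      (fun ξ => by rw [← Real.exp_nat_mul]; congr 1; push_cast; ring)
      (fun R hR => HyperelasticRod.tail_exp (zero_le_one.trans hR))
      (fun R _ => (Real.exp_pos _).le) zero_le_two Real.tendsto_exp_neg_atTop_nhds_zero
      γ K T K.2 hT
    refine ⟨C.toNNReal, δ, n, hδ, hn, fun Y₀ hG hF hK => ?_⟩
    obtain ⟨hex, hest⟩ := h Y₀ hG (HyperelasticRod.dataBnd_of_sum_le hK)
    refine ⟨hex, fun Y hY Δ N R hΔ hN hR hle Z₀ hZ₀ hd => ?_⟩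
    subst hR
    obtain ⟨h1, h2⟩ := hest Y hY Δ N hΔ hN hle Z₀ hZ₀ hd
    exact ⟨h1, fun Z hZ => HyperelasticRod.iSup_normF_le hC (Real.sqrt_nonneg _)
      (Real.exp_pos _).le (hF.1.sub hZ₀.1.memF) (h2 Z hZ)⟩
  · have hlim : Tendsto (fun R : ℝ => 1 / R ^ (α / 2)) atTop (𝓝 0) :=
      tendsto_const_nhds.div_atTop (tendsto_rpow_atTop (by linarith))
    obtain ⟨C, δ, n, hC, hδ, hn, h⟩ := HyperelasticRod.exists_error_estimate
      (θ := HyperelasticRod.polWeight (α / 2)) (HyperelasticRod.decayWeight_pol hα)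
      (HyperelasticRod.measurable_polWeight _)
      (fun ξ => by
        rw [HyperelasticRod.polWeight, HyperelasticRod.polWeight, ← Real.rpow_natCast,
          ← Real.rpow_mul (by positivity)]
        norm_num)
      (fun R hR => HyperelasticRod.tail_pol hα hR)
      (fun R hR => by positivity)
      (add_nonneg zero_le_one (integral_nonneg fun ξ =>
        (inv_pos.2 (HyperelasticRod.polWeight_pos α ξ)).le)) hlim γ K T K.2 hT
    refine ⟨C.toNNReal, δ, n, hδ, hn, fun Y₀ hG hF hK => ?_⟩
    obtain ⟨hex, hest⟩ := h Y₀ hG (HyperelasticRod.dataBnd_of_sum_le hK)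
    refine ⟨hex, fun Y hY Δ N R hΔ hN hR hle Z₀ hZ₀ hd => ?_⟩
    subst hR
    obtain ⟨h1, h2⟩ := hest Y hY Δ N hΔ hN hle Z₀ hZ₀ hd
    exact ⟨h1, fun Z hZ => HyperelasticRod.iSup_normF_le hC (Real.sqrt_nonneg _)
      (by positivity) (hF.1.sub hZ₀.1.memF) (h2 Z hZ)⟩
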